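/- Let $n\ge 1$ and let $M$ be a compact smooth manifold of dimension $2n+1$ with a contact form $\eta$ and a strongly pseudoconvex CR structure $H_{(1,0)}\subset T_{\mathbb C}M$ (rank $n$, $H_{(1,0)}\cap H_{(0,1)}=0$ with $H_{(0,1)}=\overline{H_{(1,0)}}$, integrable, $-i\,d\eta(Z,\bar Z)>0$ for $0\neq Z\in H_{(1,0)}$) such that $H_{\mathbb C}=H_{(1,0)}\oplus H_{(0,1)}$ is the complexification of $\ker\eta$. Let $g(X,Y)=\eta(X)\eta(Y)+d\eta(X,JY)$ be the adapted metric ($J$ is the complex structure of $\ker\eta$, extended by $0$ on the Reeb field), $\exp$ its exponential map, and $F_X=\exp\circ X$ for a vector field $X$. Fix a finite atlas of charts $\phi_\ell:U_\ell\to\mathbb R^{2n+1}$ with $\eta=\phi_\ell^*(dx^{2n+1}-\sum_j x^{n+j}dx^j)$, open sets $V_\ell\Subset U_\ell$ covering $M$, a partition of unity $\rho_\ell$ subordinate to $V_\ell$, and on each $U_\ell$ a smooth coframing $\eta,\omega_\ell^\alpha,\omega_\ell^{\bar\alpha}=\overline{\omega_\ell^\alpha}$ of $T_{\mathbb C}M$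 such that $H_{(0,1)}$ is the annihilator of $\eta,\omega^\alpha_\ell$; let $Z_{\ell,\alpha}$ be the dual frame of $H_{(1,0)}$ and $Z_{\ell,\bar\alpha}$ its conjugate. $\|\cdot\|_s$ denotes the Folland–Stein norm of order $s$ ($L^2$-norms of the iterated derivatives of order $\le s$ along the horizontal fields $\partial_j+x^{n+j}\partial_{2n+1}$, $\partial_{n+j}$, in the charts, localized by $\rho_\ell$), and $\Gamma^s$ the corresponding classes; the elements of the classes used below are $C^1$. Let $s\ge 2n+4$. A deformation tensor is a bundle map $\phi:H_{(0,1)}\to H_{(1,0)}$, locally $\phi=\phi^\alpha_{\bar\beta}\,\omega^{\bar\beta}\otimes Z_\alpha$, with bundle $\hat H^{\phi}_{(0,1)}=\{\bar Z-\phi(\bar Z)\}$. For a contact diffeomorphism $F$, $F^*\phi$ is the deformation tensor with $\hat H^{F^*\phi}_{(0,1)}=\{Z\in H_{\mathbb C}: F_*Z\in\hat H^{\phi}_{(0,1)}\}$. For a vector field $X$, $\bar\partial_bX(\bar Z)=[\bar Z,X]\bmod H_{(0,1)}$ for sections $\bar Z$ of $H_{(0,1)}$; $H_{(1,0)}$ is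 identified with $H_{\mathbb C}/H_{(0,1)}\subset T_{\mathbb C}M/H_{(0,1)}$. Let $\Psi$ be a parameterization, at order $s+1$, of the contact diffeomorphisms near the identity by the contact vector fields near $0$: $\Psi$ maps a neighbourhood $\mathcal V$ of $0$ in the $\Gamma^{s+1}$ contact vector fields into a neighbourhood $\mathcal U$ of $0$ in the $\Gamma^{s+1}$ vector fields (both for the topology of $\|\cdot\|_{2n+4}$); for $Y\in\mathcal U$, $F_Y$ is a contact diffeomorphism if and only if $Y\in\Psi(\mathcal V)$; and $\Psi(X)=X+B(X)(X,X)$, where $B(X)(\cdot,\cdot)$ is bilinear on the $\Gamma^{s+1}$ contact fields and, for $X$ near $0$, $\|B(X)(Y,Y')\|_{s+1}\le K\|Y\|_{s+1}\|Y'\|_{s+1}$. For a complex one-form $\theta$ put $\mathcal Q_\theta(X)=F_X^*\theta-\theta-\mathcal L_X\theta$. On $V_\ell$ (index $\ell$ suppressed; sums over repeated indices) put $$\mathcal Q^\alpha(X,Y,\phi)=\mathcal L_{\Psi(X)-X}\omega^\alpha+(\phi^\alpha_{\bar\gamma}\circ F_{\Psi(Y)})\mathcal L_{\Psi(X)}\omega^{\bar\gamma}+\mathcal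 Q_{\omega^\alpha}(\Psi(X))+(\phi^\alpha_{\bar\gamma}\circ F_{\Psi(Y)})\mathcal Q_{\omega^{\bar\gamma}}(\Psi(X)),$$ let $A^\alpha_\beta$ and $B^\alpha_{\bar\beta}$ be the values on $Z_\beta$ and $Z_{\bar\beta}$ of $F_{\Psi(X)}^*\omega^\alpha+(\phi^\alpha_{\bar\gamma}\circ F_{\Psi(Y)})F_{\Psi(X)}^*\omega^{\bar\gamma}$, and $\mathcal E^\alpha_{\bar\beta}(X,Y,\phi)=\mathcal Q^\alpha(X,Y,\phi)(Z_{\bar\beta})+[A^{-1}(I-A)B]^\alpha_{\bar\beta}$. Put $$\phi\circ F_{\Psi(X)}=\sum_\ell\rho_\ell\,(\phi^\alpha_{\ell,\bar\beta}\circ F_{\Psi(X)})\,\omega_\ell^{\bar\beta}\otimes Z_{\ell,\alpha},\qquad \mathcal E(X,Y,\phi)=\sum_\ell\rho_\ell\,\mathcal E^\alpha_{\ell,\bar\beta}(X,Y,\phi)\,\omega_\ell^{\bar\beta}\otimes Z_{\ell,\alpha}.$$ (a) There is $\varepsilon>0$ such that for all $X\in\mathcal V$ and all $\phi\in\Gamma^s$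 with $F_{\Psi(X)}$ within $\varepsilon$ of $\mathrm{id}_M$ in the $\Gamma^{s+1}$ topology (that is, $F_{\Psi(X)}(\overline{V_\ell})\subset U_\ell$ for all $\ell$ and $\sum_\ell\|\rho_\ell(\phi_\ell\circ F_{\Psi(X)}-\phi_\ell)\|_{s+1}<\varepsilon$) and $\|\phi\|_s<\varepsilon$: the tensor $F_{\Psi(X)}^*\phi$ exists and is unique, the matrices $A(X,X,\phi)$ are invertible on $V_\ell$, and $$F_{\Psi(X)}^*\phi=\bar\partial_bX+\phi\circ F_{\Psi(X)}+\mathcal E(X,X,\phi).$$ (b) The linearized action at $(\mathrm{id}_M,0)$ is $(X,\dot\phi)\mapsto\bar\partial_bX+\dot\phi$: for every $\Gamma^{s+1}$ contact vector field $X$ and every deformation tensor $\dot\phi$, $\bar\partial_bX+\dot\phi$ is a deformation tensor; and for every $\varepsilon>0$ there is $\delta>0$ such that for all contact $X\in\Gamma^{s+1}$ and all $\phi\in\Gamma^s$ with $\|X\|_{s+1},\|\phi\|_s<\delta$ the tensor $F_{\Psi(X)}^*\phi$ exists and $$\sup_{\ell,\alpha,\beta}\ \sup_{V_\ell}\big|(F_{\Psi(X)}^*\phi-\bar\partial_bX-\phi)^\alpha_{\ell,\bar\beta}\big|\le\varepsilon\,(\|X\|_{s+1}+\|\phi\|_s),$$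 i.e. this map is the Fréchet derivative at $(0,0)$ of $(X,\phi)\mapsto F_{\Psi(X)}^*\phi$ from $\Gamma^{s+1}\times\Gamma^s$ to $C^0$. -/

import Mathlib

open scoped Manifold ContDiff TensorProduct ENNReal Topology

noncomputable section

namespace CRDef

/-! ### Horizontal derivatives and Folland-Stein norms on domains of `ℝ^(2n+1)` -/

/-- The model space `ℝ^(2n+1)`; the coordinates `x^1, …, x^(2n+1)` are indexed by `0, …, 2n`. -/
abbrev Model (n : ℕ) : Type := EuclideanSpace ℝ (Fin (2 * n + 1))

/-- The standard contact form `dx^(2n+1) - ∑ x^(n+j) dx^j` at `x`. -/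
def stdContact (n : ℕ) (x v : Model n) : ℝ :=
  v (Fin.last (2 * n)) -
    ∑ j : Fin n, x ⟨n + j, by omega⟩ * v ⟨j, by omega⟩

/-- The horizontal frame: `X_j = ∂_j + x^(n+j) ∂_(2n+1)` and `X_(n+j) = ∂_(n+j)`
for `1 ≤ j ≤ n`. -/
def horizVec (n : ℕ) (j : Fin (2 * n)) (x : Model n) : Model n :=
  if h : (j : ℕ) < n then
    EuclideanSpace.single j.castSucc (1 : ℝ) +
      (x ⟨n + j, by omega⟩) • EuclideanSpace.single (Fin.last (2 * n)) (1 : ℝ)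
  else EuclideanSpace.single j.castSucc (1 : ℝ)

/-- The iterated horizontal derivative `X_I f = X_(i_1) ⋯ X_(i_t) f`. -/
def horizDeriv {n : ℕ} {F : Type*} [NormedAddCommGroup F] [NormedSpace ℝ F] :
    List (Fin (2 * n)) → (Model n → F) → Model n → F
  | [], f => f
  | j :: I, f => fun x => fderiv ℝ (horizDeriv I f) x (horizVec n j x)

/-- `f` lies in the Folland-Stein space of order `s` on `D`, with horizontal derivatives `g I`:
`f` is the limit of smooth functions whose horizontal derivatives up to order `s`
converge to the `g I` in `L²(D)`. -/
structure IsFSDerivs {n : ℕ} {F : Type*} [NormedAddCommGroup F] [NormedSpace ℝ F]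
    (D : Set (Model n)) (s : ℕ) (f : Model n → F)
    (g : List (Fin (2 * n)) → Model n → F) : Prop where
  memLp : ∀ I, I.length ≤ s → MeasureTheory.MemLp (g I) 2 (MeasureTheory.volume.restrict D)
  eq : g [] =ᵐ[MeasureTheory.volume.restrict D] f
  approx : ∃ u : ℕ → Model n → F, (∀ k, ContDiff ℝ ∞ (u k)) ∧
    ∀ I, I.length ≤ s → Filter.Tendsto
      (fun k => MeasureTheory.eLpNorm (fun x => horizDeriv I (u k) x - g I x) 2
        (MeasureTheory.volume.restrict D)) Filter.atTop (𝓝 0)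

/-- The Folland-Stein norm `‖f‖_{D,s}`; it is `∞` exactly when `f` is not in the space.
(The derivatives `g` are unique almost everywhere, so the infimum is over one value.) -/
def fsNorm {n : ℕ} {F : Type*} [NormedAddCommGroup F] [NormedSpace ℝ F]
    (D : Set (Model n)) (s : ℕ) (f : Model n → F) : ℝ≥0∞ :=
  ⨅ (g : List (Fin (2 * n)) → Model n → F) (_ : IsFSDerivs D s f g),
    (∑ t ∈ Finset.range (s + 1), ∑ I : Fin t → Fin (2 * n),
      MeasureTheory.eLpNorm (g (List.ofFn I)) 2 (MeasureTheory.volume.restrict D) ^ 2)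
        ^ (1 / 2 : ℝ)

/-! ### Tangent vectors, forms and their complexifications -/

section Calculus

variable (n : ℕ) {M : Type*} [TopologicalSpace M] [ChartedSpace (Model n) M]

/-- The tangent space at `x`. -/
abbrev TS (x : M) : Type := TangentSpace (𝓡 (2 * n + 1)) x

/-- The complexified tangent space `T_x M ⊗ ℂ`. -/
abbrev CT (x : M) : Type := ℂ ⊗[ℝ] TS n x

variable (M) in
/-- Vector fields. -/
abbrev VF : Type _ := ∀ x : M, TS n x

variable (M) in
/-- Complex vector fields. -/
abbrev CVF : Type _ := ∀ x : M, CT n x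

variable (M) in
/-- One-forms with values in `F`. -/
abbrev OneForm (F : Type*) [NormedAddCommGroup F] [NormedSpace ℝ F] : Type _ :=
  ∀ x : M, TS n x →L[ℝ] F

variable {n}

/-- Real part of a complex tangent vector. -/
def reT {x : M} : CT n x →ₗ[ℝ] TS n x :=
  (TensorProduct.lid ℝ (TS n x)).toLinearMap ∘ₗ Complex.reLm.rTensor (TS n x)

/-- Imaginary part of a complex tangent vector. -/
def imT {x : M} : CT n x →ₗ[ℝ] TS n x :=
  (TensorProduct.lid ℝ (TS n x)).toLinearMap ∘ₗ Complex.imLm.rTensor (TS n x)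

/-- Complex conjugation on `T_x M ⊗ ℂ`. -/
def conjT {x : M} : CT n x →ₗ[ℝ] CT n x :=
  Complex.conjAe.toLinearMap.rTensor (TS n x)

theorem conjT_smul {x : M} (c : ℂ) (z : CT n x) :
    conjT (c • z) = (starRingEnd ℂ c) • conjT z := by
  induction z using TensorProduct.induction_on with
  | zero => simp
  | tmul a v => simp [conjT, TensorProduct.smul_tmul']
  | add a b ha hb => rw [smul_add, map_add, ha, hb, map_add, smul_add]

/-- The conjugate of a complex subspace of `T_x M ⊗ ℂ`. -/
def conjSub {x : M} (S : Submodule ℂ (CT n x)) : Submodule ℂ (CT n x) where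
  carrier := {z | conjT z ∈ S}
  add_mem' := by
    intro a b ha hb
    simpa using S.add_mem ha hb
  zero_mem' := by simp
  smul_mem' := by
    intro c z hz
    simpa [conjT_smul] using S.smul_mem _ hz

variable [IsManifold (𝓡 (2 * n + 1)) ∞ M]

/-- A vector field is of class `C^k` on `U`. -/
def VFSmoothOn (k : WithTop ℕ∞) (X : VF n M) (U : Set M) : Prop :=
  ContMDiffOn (𝓡 (2 * n + 1)) (𝓡 (2 * n + 1)).tangent k
    (fun x => (⟨x, X x⟩ : TangentBundle (𝓡 (2 * n + 1)) M)) U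

/-- A complex vector field is smooth on `U`. -/
def CVFSmoothOn (Z : CVF n M) (U : Set M) : Prop :=
  VFSmoothOn ∞ (fun x => reT (Z x)) U ∧ VFSmoothOn ∞ (fun x => imT (Z x)) U

/-- A real vector field as a complex one. -/
def toC (X : VF n M) : CVF n M := fun x => (1 : ℂ) ⊗ₜ[ℝ] X x

/-- The Lie bracket of complex vector fields (the complex bilinear extension). -/
def cBracket (Z W : CVF n M) : CVF n M := fun x =>
  (1 : ℂ) ⊗ₜ[ℝ]
      (VectorField.mlieBracket (𝓡 (2 * n + 1)) (fun y => reT (Z y)) (fun y => reT (W y)) x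
      - VectorField.mlieBracket (𝓡 (2 * n + 1)) (fun y => imT (Z y)) (fun y => imT (W y)) x)
  + Complex.I ⊗ₜ[ℝ]
      (VectorField.mlieBracket (𝓡 (2 * n + 1)) (fun y => reT (Z y)) (fun y => imT (W y)) x
      + VectorField.mlieBracket (𝓡 (2 * n + 1)) (fun y => imT (Z y)) (fun y => reT (W y)) x)

section Forms

variable {F : Type*} [NormedAddCommGroup F] [NormedSpace ℝ F]

/-- The coordinate expression of a one-form in the preferred chart at `x₀`. -/
def formInChart (x₀ : M) (θ : OneForm n M F) (y : Model n) : Model n →L[ℝ] F :=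
  (θ ((extChartAt (𝓡 (2 * n + 1)) x₀).symm y)).comp
    (mfderiv 𝓘(ℝ, Model n) (𝓡 (2 * n + 1)) (extChartAt (𝓡 (2 * n + 1)) x₀).symm y)

/-- A one-form is smooth on the open set `U`. -/
def FormSmoothOn (θ : OneForm n M F) (U : Set M) : Prop :=
  ∀ x ∈ U, ContDiffAt ℝ ∞ (formInChart x θ) (extChartAt (𝓡 (2 * n + 1)) x x)

/-- The exterior derivative of a one-form, computed in the preferred chart at `x`;
`dθ(X, Y) = X θ(Y) - Y θ(X) - θ([X, Y])`. -/
def extD (θ : OneForm n M F) (x : M) (v w : TS n x) : F :=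
  let a : Model n := mfderiv (𝓡 (2 * n + 1)) 𝓘(ℝ, Model n) (extChartAt (𝓡 (2 * n + 1)) x) x v
  let b : Model n := mfderiv (𝓡 (2 * n + 1)) 𝓘(ℝ, Model n) (extChartAt (𝓡 (2 * n + 1)) x) x w
  fderiv ℝ (formInChart x θ) (extChartAt (𝓡 (2 * n + 1)) x x) a b -
    fderiv ℝ (formInChart x θ) (extChartAt (𝓡 (2 * n + 1)) x x) b a

/-- The Lie derivative of a one-form, `L_X θ = X ⌟ dθ + d (θ(X))`. -/
def lieD (X : VF n M) (θ : OneForm n M F) (x : M) (v : TS n x) : F :=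
  let d : F := mfderiv (𝓡 (2 * n + 1)) 𝓘(ℝ, F) (fun y => θ y (X y)) x v
  extD θ x (X x) v + d

/-- The pull-back of a one-form by a map. -/
def pullForm (f : M → M) (θ : OneForm n M F) (x : M) (v : TS n x) : F :=
  θ (f x) (mfderiv (𝓡 (2 * n + 1)) (𝓡 (2 * n + 1)) f x v)

end Forms

/-- The complex linear extension to `T_x M ⊗ ℂ` of a real linear map `T_x M → ℂ`
(given as a bare function). -/
def cEval {x : M} (θ : TS n x → ℂ) (z : CT n x) : ℂ := θ (reT z) + Complex.I * θ (imT z)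

/-- The complex bilinear extension of the exterior derivative of a real one-form. -/
def extDC (η : OneForm n M ℝ) (x : M) (z w : CT n x) : ℂ :=
  ((extD η x (reT z) (reT w) - extD η x (imT z) (imT w) : ℝ) : ℂ) +
    Complex.I * ((extD η x (reT z) (imT w) + extD η x (imT z) (reT w) : ℝ) : ℂ)

/-- The conjugate of a complex one-form. -/
def conjForm (θ : OneForm n M ℂ) : OneForm n M ℂ :=
  fun x => (Complex.conjCLE : ℂ →L[ℝ] ℂ).comp (θ x)

/-- The push-forward of complex tangent vectors. -/
def pushC (f : M → M) (x : M) : CT n x →ₗ[ℂ] CT n (f x) :=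
  (mfderiv (𝓡 (2 * n + 1)) (𝓡 (2 * n + 1)) f x).toLinearMap.baseChange ℂ

/-! ### Geodesics and the exponential map -/

/-- `γ` is a geodesic of the metric `g` on the open set `s`: in the preferred chart at each of its
points it satisfies `d/dt g(γ', w) = (1/2) (∂_w g)(γ', γ')` for all constant `w`. -/
def IsGeodesicOn (g : ∀ x : M, TS n x → TS n x → ℝ) (γ : ℝ → M) (s : Set ℝ) : Prop :=
  ContMDiffOn 𝓘(ℝ, ℝ) (𝓡 (2 * n + 1)) 2 γ s ∧
  ∀ t₀ ∈ s, ∀ w : Model n,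
    let e := extChartAt (𝓡 (2 * n + 1)) (γ t₀)
    let G : Model n → Model n → Model n → ℝ := fun y a b =>
      g (e.symm y) (mfderiv 𝓘(ℝ, Model n) (𝓡 (2 * n + 1)) e.symm y a)
        (mfderiv 𝓘(ℝ, Model n) (𝓡 (2 * n + 1)) e.symm y b)
    let c : ℝ → Model n := fun t => e (γ t)
    deriv (fun t => G (c t) (deriv c t) w) t₀ =
      (1 / 2) * fderiv ℝ (fun y => G y (deriv c t₀) (deriv c t₀)) (c t₀) w

/-- `γ` is a geodesic on an open interval containing `[0, 1]` with `γ(0) = x`, `γ'(0) = v`. -/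
def IsGeodesicFrom (g : ∀ x : M, TS n x → TS n x → ℝ) (x : M) (v : TS n x) (γ : ℝ → M) : Prop :=
  (∃ ε > 0, IsGeodesicOn g γ (Set.Ioo (-ε) (1 + ε))) ∧
  (⟨γ 0, mfderiv 𝓘(ℝ, ℝ) (𝓡 (2 * n + 1)) γ 0 (1 : ℝ)⟩ : TangentBundle (𝓡 (2 * n + 1)) M) = ⟨x, v⟩

open Classical in
/-- The exponential map of `g`: the time one value of the geodesic with initial velocity `v`. -/
def expMap (g : ∀ x : M, TS n x → TS n x → ℝ) (x : M) (v : TS n x) : M :=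
  if h : ∃ γ : ℝ → M, IsGeodesicFrom g x v γ then h.choose 1 else x

end Calculus

/-! ### Strongly pseudoconvex CR structures -/

/-- A contact form `η` on `M` together with a strongly pseudoconvex CR structure `H_(1,0)`
such that `H_(1,0) ⊕ H_(0,1)` is the complexification of the contact distribution `ker η`. -/
structure CRStructure (n : ℕ) (M : Type*) [TopologicalSpace M] [ChartedSpace (Model n) M]
  [IsManifold (𝓡 (2 * n + 1)) ∞ M] where
  /-- the contact form -/
  η : OneForm n M ℝ
  /-- the holomorphic tangent bundle `H_(1,0)` -/
  hol : ∀ x : M, Submodule ℂ (CT n x)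
  η_smooth : FormSmoothOn η Set.univ
  rank : ∀ x, Module.finrank ℂ (hol x) = n
  smooth : ∀ x₀ : M, ∃ U : Set M, IsOpen U ∧ x₀ ∈ U ∧ ∃ Z : Fin n → CVF n M,
    (∀ α, CVFSmoothOn (Z α) U) ∧
    ∀ x ∈ U, hol x = Submodule.span ℂ (Set.range fun α => Z α x)
  transverse : ∀ x, hol x ⊓ conjSub (hol x) = ⊥
  integrable : ∀ Z W : CVF n M, CVFSmoothOn Z Set.univ → CVFSmoothOn W Set.univ →
    (∀ x, Z x ∈ hol x) → (∀ x, W x ∈ hol x) → ∀ x, cBracket Z W x ∈ hol x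
  contact : ∀ x (z : CT n x), z ∈ hol x ⊔ conjSub (hol x) ↔ cEval (fun v => (η x v : ℂ)) z = 0
  /-- `-i dη(Z, Z̄) > 0` (this number is always real) -/
  pseudoconvex : ∀ x, ∀ z ∈ hol x, z ≠ 0 → 0 < (-Complex.I * extDC η x z (conjT z)).re

namespace CRStructure

variable {n : ℕ} {M : Type*} [TopologicalSpace M] [ChartedSpace (Model n) M]
  [IsManifold (𝓡 (2 * n + 1)) ∞ M]
  (C : CRStructure n M)

/-- `H_(0,1)`, the conjugate of `H_(1,0)`. -/
def antihol (x : M) : Submodule ℂ (CT n x) := conjSub (C.hol x)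

/-- The Reeb vector field: `η(T) = 1`, `T ⌟ dη = 0`. -/
def reeb (x : M) : TS n x :=
  Classical.epsilon fun v : TS n x => C.η x v = 1 ∧ ∀ w, extD C.η x v w = 0

/-- The `(1,0)`-part `Z` of the contact component of `v`: `v - η(v) T = Z + Z̄`. -/
def holPart (x : M) (v : TS n x) : CT n x :=
  Classical.epsilon fun z : CT n x =>
    z ∈ C.hol x ∧ z + conjT z = (1 : ℂ) ⊗ₜ[ℝ] (v - C.η x v • C.reeb x)

/-- The endomorphism `J` of the contact distribution, `J (Z + Z̄) = i Z + conj (i Z)`,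
extended by `J T = 0`. -/
def J (x : M) (v : TS n x) : TS n x :=
  reT (Complex.I • C.holPart x v + conjT (Complex.I • C.holPart x v))

/-- The adapted metric `g(X, Y) = η(X) η(Y) + dη(X, J Y)`. -/
def metric (x : M) (v w : TS n x) : ℝ := C.η x v * C.η x w + extD C.η x v (C.J x w)

/-- The map `F_X = exp ∘ X`. -/
def flowExp (X : VF n M) (x : M) : M := expMap C.metric x (X x)

/-- `X` is a contact vector field: `L_X η = 0 mod η`. -/
def IsContactVF (X : VF n M) : Prop := ∀ x (v : TS n x), C.η x v = 0 → lieD X C.η x v = 0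

/-- `f` is a (`C¹`) contact diffeomorphism: `f^* η = 0 mod η`. -/
def IsContactDiffeo (f : M → M) : Prop :=
  (∃ f' : M → M, Function.LeftInverse f' f ∧ Function.RightInverse f' f ∧
    ContMDiff (𝓡 (2 * n + 1)) (𝓡 (2 * n + 1)) 1 f ∧
    ContMDiff (𝓡 (2 * n + 1)) (𝓡 (2 * n + 1)) 1 f') ∧
  ∀ x (v : TS n x), C.η x v = 0 → pullForm f C.η x v = 0

/-- Deformation tensors: bundle maps `H_(0,1) → H_(1,0)`. -/
abbrev Deform : Type _ := ∀ x : M, C.antihol x →ₗ[ℂ] C.hol x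

variable {C} in
/-- The deformed bundle `{ Z̄ - φ(Z̄) | Z̄ ∈ H_(0,1) }`. -/
def deformed (φ : C.Deform) (x : M) : Set (CT n x) :=
  {w | ∃ z : C.antihol x, w = (z : CT n x) - (φ x z : CT n x)}

variable {C} in
/-- `μ = f^* φ`: the bundle `{ Z ∈ H_ℂ | f_* Z ∈ Ĥ_(0,1) }`, where `Ĥ_(0,1)` is the bundle of `φ`,
is the bundle of `μ`. -/
def IsPullback (f : M → M) (φ μ : C.Deform) : Prop :=
  ∀ x, {z : CT n x | z ∈ C.hol x ⊔ C.antihol x ∧ pushC f x z ∈ deformed φ (f x)} = deformed μ x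

/-- Smooth sections of `H_(0,1)`. -/
def IsAntiholSection (W : CVF n M) : Prop :=
  CVFSmoothOn W Set.univ ∧ ∀ x, W x ∈ C.antihol x

/-- `∂̄_b X`, evaluated on a section `W` of `H_(0,1)`: the class of `[W, X]` in
`T_(1,0) = T_ℂ M / H_(0,1)`. -/
def dbarb (X : VF n M) (W : CVF n M) (x : M) : CT n x ⧸ C.antihol x :=
  (C.antihol x).mkQ (cBracket W (toC X) x)

/-- `ν` is the deformation tensor `∂̄_b X + ψ` (with `H_(1,0)` embedded in `T_(1,0)`). -/
def IsLinearized (X : VF n M) (ψ ν : C.Deform) : Prop :=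
  ∀ W : CVF n M, ∀ hW : C.IsAntiholSection W, ∀ x,
    (C.antihol x).mkQ (ν x ⟨W x, hW.2 x⟩ : CT n x) =
      C.dbarb X W x + (C.antihol x).mkQ (ψ x ⟨W x, hW.2 x⟩ : CT n x)

end CRStructure

/-! ### Adapted atlases, coframes and Folland-Stein spaces on `M` -/

/-- A finite adapted atlas `U_ℓ ⋑ V_ℓ`, a subordinate partition of unity, and on every `U_ℓ` a
coframing `η, θ^α, θ̄^α` such that `η, θ^α` have the annihilator `H_(0,1)`, with the dual frame
`Z_α` of `H_(1,0)`. -/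
structure AdaptedAtlas {n : ℕ} {M : Type*} [TopologicalSpace M] [ChartedSpace (Model n) M]
  [IsManifold (𝓡 (2 * n + 1)) ∞ M]
    (C : CRStructure n M) (ι : Type*) [Fintype ι] where
  /-- the charts; `U_ℓ` is the source of `chart ℓ` -/
  chart : ι → OpenPartialHomeomorph M (Model n)
  /-- the sets `V_ℓ` -/
  V : ι → Set M
  /-- the partition of unity -/
  ρ : ι → M → ℝ
  /-- the forms `θ_ℓ^α` -/
  θ : ι → Fin n → OneForm n M ℂ
  /-- the frames `Z_{ℓ,α}` -/
  Z : ι → Fin n → CVF n M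
  chart_mem : ∀ l, chart l ∈ IsManifold.maximalAtlas (𝓡 (2 * n + 1)) ∞ M
  chart_contact : ∀ l, ∀ x ∈ (chart l).source, ∀ v : TS n x,
    C.η x v = stdContact n (chart l x)
      (mfderiv (𝓡 (2 * n + 1)) 𝓘(ℝ, Model n) (chart l) x v)
  V_open : ∀ l, IsOpen (V l)
  V_compact : ∀ l, IsCompact (closure (V l))
  V_sub : ∀ l, closure (V l) ⊆ (chart l).source
  V_cover : ∀ x, ∃ l, x ∈ V l
  ρ_smooth : ∀ l, ContMDiff (𝓡 (2 * n + 1)) 𝓘(ℝ, ℝ) ∞ (ρ l)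
  ρ_nonneg : ∀ l x, 0 ≤ ρ l x
  ρ_sum : ∀ x, ∑ l, ρ l x = 1
  ρ_supp : ∀ l, tsupport (ρ l) ⊆ V l
  θ_smooth : ∀ l α, FormSmoothOn (θ l α) (chart l).source
  Z_smooth : ∀ l α, CVFSmoothOn (Z l α) (chart l).source
  annihilator : ∀ l, ∀ x ∈ (chart l).source, ∀ z : CT n x,
    z ∈ C.antihol x ↔ cEval (fun v => (C.η x v : ℂ)) z = 0 ∧ ∀ α, cEval (θ l α x) z = 0
  Z_mem : ∀ l α, ∀ x ∈ (chart l).source, Z l α x ∈ C.hol x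
  dual : ∀ l α β, ∀ x ∈ (chart l).source,
    cEval (θ l α x) (Z l β x) = if α = β then 1 else 0

namespace AdaptedAtlas

variable {n : ℕ} {M : Type*} [TopologicalSpace M] [ChartedSpace (Model n) M]
  [IsManifold (𝓡 (2 * n + 1)) ∞ M]
  {C : CRStructure n M} {ι : Type*} [Fintype ι] (A : AdaptedAtlas C ι)

/-- The domain `D_ℓ`, the image of `V_ℓ` under the chart. -/
def D (l : ι) : Set (Model n) := A.chart l '' A.V l

/-- The conjugate frame `Z_ᾱ`. -/
def Zbar (l : ι) (α : Fin n) : CVF n M := fun x => conjT (A.Z l α x)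

/-- The Folland-Stein norm `‖X‖_s` of a vector field, through its components in the adapted
charts. -/
def vfNorm (s : ℕ) (X : VF n M) : ℝ≥0∞ :=
  ∑ l, fsNorm (A.D l) s fun y => A.ρ l ((A.chart l).symm y) •
    (mfderiv (𝓡 (2 * n + 1)) 𝓘(ℝ, Model n) (A.chart l) ((A.chart l).symm y)
      (X ((A.chart l).symm y)) : Model n)

/-- `X` is a Folland-Stein vector field of order `s` (these are `C¹` for the orders used here). -/
def IsFSVF (s : ℕ) (X : VF n M) : Prop := VFSmoothOn 1 X Set.univ ∧ A.vfNorm s X < ⊤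

open Classical in
/-- The components `φ^α_β̄ = θ^α(φ(Z_β̄))` of a deformation tensor on `U_ℓ`. -/
def coef (φ : C.Deform) (l : ι) (α β : Fin n) (x : M) : ℂ :=
  if h : A.Zbar l β x ∈ C.antihol x then cEval (A.θ l α x) (φ x ⟨A.Zbar l β x, h⟩ : CT n x) else 0

/-- The Folland-Stein norm `‖φ‖_s` of a deformation tensor. -/
def deformNorm (s : ℕ) (φ : C.Deform) : ℝ≥0∞ :=
  ∑ l, ∑ α, ∑ β, fsNorm (A.D l) s fun y =>
    A.ρ l ((A.chart l).symm y) • A.coef φ l α β ((A.chart l).symm y)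

/-- `φ` is a Folland-Stein deformation tensor of order `s`. -/
def IsFSDeform (s : ℕ) (φ : C.Deform) : Prop :=
  (∀ l α β, ContMDiffOn (𝓡 (2 * n + 1)) 𝓘(ℝ, ℂ) 1 (A.coef φ l α β) (A.chart l).source) ∧
    A.deformNorm s φ < ⊤

/-- `f` is a map of Folland-Stein class `s` that lies in the `ε`-neighbourhood of the identity in
the Folland-Stein topology. -/
def NearId (s : ℕ) (ε : ℝ≥0∞) (f : M → M) : Prop :=
  (∀ l, f '' closure (A.V l) ⊆ (A.chart l).source) ∧
  ∑ l, fsNorm (A.D l) s (fun y => A.ρ l ((A.chart l).symm y) •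
    (A.chart l (f ((A.chart l).symm y)) - y)) < ε

/-- `Ψ` is a parameterization of the contact diffeomorphisms near the identity by the contact
vector fields near zero, at the Folland-Stein order `r`: it maps the neighbourhood `𝒱` of zero in
the contact fields into the neighbourhood `𝒰` of zero in all fields, for `Y ∈ 𝒰` the map `F_Y` is
a contact diffeomorphism if and only if `Y ∈ Ψ(𝒱)`, and `Ψ(X) = X + B(X)(X, X)` with `B` bilinear
in the last two arguments and bounded near zero. The sets `𝒱`, `𝒰` are neighbourhoods for the norm
of order `2n+4`. -/
structure IsContactParametrization (r : ℕ) (𝒱 𝒰 : Set (VF n M)) (Ψ : VF n M → VF n M) :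
    Prop where
  dom : ∀ X ∈ 𝒱, A.IsFSVF r X ∧ C.IsContactVF X
  dom_nhds : ∃ δ : ℝ≥0∞, 0 < δ ∧ ∀ X, A.IsFSVF r X → C.IsContactVF X →
    A.vfNorm (2 * n + 4) X < δ → X ∈ 𝒱
  range : ∀ Y ∈ 𝒰, A.IsFSVF r Y
  range_nhds : ∃ δ : ℝ≥0∞, 0 < δ ∧ ∀ Y, A.IsFSVF r Y → A.vfNorm (2 * n + 4) Y < δ → Y ∈ 𝒰
  maps : ∀ X ∈ 𝒱, Ψ X ∈ 𝒰
  contact_iff : ∀ Y ∈ 𝒰, C.IsContactDiffeo (C.flowExp Y) ↔ ∃ X ∈ 𝒱, Y = Ψ X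
  quadratic : ∃ B : VF n M → VF n M → VF n M → VF n M,
    (∀ X ∈ 𝒱, Ψ X = X + B X X X) ∧
    (∀ X ∈ 𝒱, ∀ Y Y' Y'' : VF n M, ∀ a : ℝ,
      A.IsFSVF r Y → C.IsContactVF Y → A.IsFSVF r Y' → C.IsContactVF Y' →
      A.IsFSVF r Y'' → C.IsContactVF Y'' →
      B X (a • Y + Y') Y'' = a • B X Y Y'' + B X Y' Y'' ∧
      B X Y'' (a • Y + Y') = a • B X Y'' Y + B X Y'' Y') ∧
    ∃ δ : ℝ≥0∞, 0 < δ ∧ ∃ K : NNReal, ∀ X ∈ 𝒱, A.vfNorm r X < δ →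
      ∀ Y Y' : VF n M, A.IsFSVF r Y → C.IsContactVF Y → A.IsFSVF r Y' → C.IsContactVF Y' →
        A.IsFSVF r (B X Y Y') ∧ A.vfNorm r (B X Y Y') ≤ K * A.vfNorm r Y * A.vfNorm r Y'

/-! ### The local formulas -/

variable (C) in
/-- The non-linear part `Q_θ(X) = F_X^* θ - θ - L_X θ` of the pull-back of a one-form. -/
def quadPart (θ : OneForm n M ℂ) (X : VF n M) (x : M) (v : TS n x) : ℂ :=
  pullForm (C.flowExp X) θ x v - θ x v - lieD X θ x v

/-- The components `φ^α_γ̄ ∘ F_{Ψ(Y)}` on `V_ℓ`. -/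
def coefComp (Ψ : VF n M → VF n M) (Y : VF n M) (φ : C.Deform) (l : ι) (α γ : Fin n) (x : M) : ℂ :=
  A.coef φ l α γ (C.flowExp (Ψ Y) x)

/-- The one-form `Q^α(X, Y, φ)` on `V_ℓ`:
`L_{Ψ(X)-X} θ^α + (φ^α_γ̄ ∘ F_{Ψ(Y)}) L_{Ψ(X)} θ^γ̄
  + Q_{θ^α}(Ψ(X)) + (φ^α_γ̄ ∘ F_{Ψ(Y)}) Q_{θ^γ̄}(Ψ(X))`. -/
def quadForm (Ψ : VF n M → VF n M) (X Y : VF n M) (φ : C.Deform) (l : ι) (α : Fin n)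
    (x : M) (v : TS n x) : ℂ :=
  lieD (Ψ X - X) (A.θ l α) x v
    + ∑ γ, A.coefComp Ψ Y φ l α γ x * lieD (Ψ X) (conjForm (A.θ l γ)) x v
    + (quadPart C (A.θ l α) (Ψ X) x v
      + ∑ γ, A.coefComp Ψ Y φ l α γ x * quadPart C (conjForm (A.θ l γ)) (Ψ X) x v)

/-- The one-form `F^* θ^α + (φ^α_γ̄ ∘ F_{Ψ(Y)}) F^* θ^γ̄` with `F = F_{Ψ(X)}`. -/
def pulledForm (Ψ : VF n M → VF n M) (X Y : VF n M) (φ : C.Deform) (l : ι) (α : Fin n)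
    (x : M) (v : TS n x) : ℂ :=
  pullForm (C.flowExp (Ψ X)) (A.θ l α) x v
    + ∑ γ, A.coefComp Ψ Y φ l α γ x *
        pullForm (C.flowExp (Ψ X)) (conjForm (A.θ l γ)) x v

/-- The matrix `A(X, Y, φ)`. -/
def matA (Ψ : VF n M → VF n M) (X Y : VF n M) (φ : C.Deform) (l : ι) (x : M) :
    Matrix (Fin n) (Fin n) ℂ :=
  Matrix.of fun α β => cEval (A.pulledForm Ψ X Y φ l α x) (A.Z l β x)

/-- The matrix `B(X, Y, φ)`. -/
def matB (Ψ : VF n M → VF n M) (X Y : VF n M) (φ : C.Deform) (l : ι) (x : M) :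
    Matrix (Fin n) (Fin n) ℂ :=
  Matrix.of fun α β => cEval (A.pulledForm Ψ X Y φ l α x) (A.Zbar l β x)

/-- The local components `E^α_β̄ = Z_β̄ ⌟ Q^α + [A⁻¹ (I - A) B]^α_β̄`. -/
def coefE (Ψ : VF n M → VF n M) (X Y : VF n M) (φ : C.Deform) (l : ι) (α β : Fin n) (x : M) : ℂ :=
  cEval (A.quadForm Ψ X Y φ l α x) (A.Zbar l β x)
    + ((A.matA Ψ X Y φ l x)⁻¹ * (1 - A.matA Ψ X Y φ l x) * A.matB Ψ X Y φ l x) α β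

/-- The tensor `∑_ℓ ρ_ℓ c^α_{ℓ,β̄} θ_ℓ^β̄ ⊗ Z_{ℓ,α}`, evaluated at a complex tangent vector. -/
def assemble (c : ι → Fin n → Fin n → M → ℂ) (x : M) (z : CT n x) : CT n x :=
  ∑ l, (A.ρ l x : ℂ) • ∑ α, ∑ β,
    (c l α β x * cEval (conjForm (A.θ l β) x) z) • A.Z l α x

/-- The tensor `φ ∘ F_{Ψ(Y)}`. -/
def compTensor (Ψ : VF n M → VF n M) (Y : VF n M) (φ : C.Deform) (x : M) (z : CT n x) : CT n x :=
  A.assemble (A.coefComp Ψ Y φ) x z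

/-- The tensor `E(X, Y, φ)`. -/
def tensorE (Ψ : VF n M → VF n M) (X Y : VF n M) (φ : C.Deform) (x : M) (z : CT n x) : CT n x :=
  A.assemble (A.coefE Ψ X Y φ) x z

end AdaptedAtlas

end CRDef

end

open scoped Manifold ContDiff TensorProduct ENNReal Topology
noncomputable section
namespace CRDef
open Set Filter
set_option linter.unusedSectionVars false

/-! ### Tensor fields in a chart -/

/-! Part (a) is linear algebra at each point. In an adapted coframe a vector of H_ℂ belongs to the
bundle of φ exactly when all the forms θ^α + φ^α_γ̄ θ^γ̄ vanish on it. A contact map F preserves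
H_ℂ, so a vector with components a along Z_β and b along Z_β̄ is sent into that bundle exactly when
Aa + Bb = 0, where A and B hold the values of F^*θ^α + (φ^α_γ̄ ∘ F) F^*θ^γ̄ on the two halves of the
frame. If A is invertible this is the graph equation a + A⁻¹B b = 0, so F^*φ exists, is unique, and
has matrix A⁻¹B = B + A⁻¹(I − A)B. The form Q^α is what remains of B after θ^α, φ ∘ F and L_X θ^α
are removed. Since θ^α kills H_(0,1), Cartan's formula gives (L_X θ^α)(Z̄) = θ^α([Z̄, X]), which is
the component of ∂̄_b X; since X is contact, η([Z̄, X]) = 0, so ∂̄_b X takes values in H_ℂ/H_(0,1).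
The chart formulas are congruences modulo H_(0,1), hence survive averaging by the partition of unity
(`pullback_formula`).

A is invertible because it is close to the identity, once F is C¹-close to the identity and φ is
uniformly small. This comes from a Sobolev inequality on the Heisenberg model: integrating along the
transverse direction and then along the 2n horizontal ones bounds a test function by a derivative of
weight 2n + 2, the transverse derivative being a commutator of two horizontal ones; two further
horizontal derivatives control the full gradient, whence the order 2n + 4 (`exists_sobolev`). The
norms see a function only through the cut-off ρ_ℓ, so the bounds hold where ρ_ℓ is bounded below.
Every point has such an index, and invertibility of A has a frame-free meaning (`isUnit_pullA_iff`),
so it passes to all other indices.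

For the derivative in part (b) the exponential map must be understood to second order. In an adapted
chart the contact form is standard and the adapted metric is smooth, symmetric (by integrability)
and positive (by pseudoconvexity), so geodesics solve c'' = spray(c, c'), and Hausdorffness makes
them unique. Integrating this equation twice and using Grönwall's inequality shows that exp(y, a) −
y − a is of size s² for |a| ≤ s, with a correspondingly small Lipschitz constant
(`exists_exp_estimate`). The derivative of exp ∘ Y − id − Y is then O(s²) without ever
differentiating exp. Consequently F^*θ − θ − L_Y θ, the contribution of Ψ(X) − X = B(X)(X, X), the
difference φ ∘ F − φ and the correction A⁻¹B − B are all quadratic in ‖X‖ + ‖φ‖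
(`exists_quadratic_bound`). The resulting bound B·N² is transported between frames with bounded
coefficients and implies Fréchet differentiability. -/

theorem two_le_infty : (2 : WithTop ℕ∞) ≤ (∞ : WithTop ℕ∞) := by
  exact WithTop.coe_le_coe.2 (le_top : (2 : ℕ∞) ≤ ⊤)

theorem one_add_one_le_infty : (1 : WithTop ℕ∞) + 1 ≤ (∞ : WithTop ℕ∞) := by
  rw [one_add_one_eq_two]; exact two_le_infty

section ChartCalculus

variable {n : ℕ} {M : Type*} [TopologicalSpace M] [ChartedSpace (Model n) M]

/-- The differential of the chart `e` at `x`. -/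
def dChart (e : OpenPartialHomeomorph M (Model n)) (x : M) : TS n x →L[ℝ] Model n :=
  mfderiv (𝓡 (2 * n + 1)) 𝓘(ℝ, Model n) e x

/-- The differential of the inverse of the chart `e` at `y`. -/
def dSymm (e : OpenPartialHomeomorph M (Model n)) (y : Model n) : Model n →L[ℝ] TS n (e.symm y) :=
  mfderiv 𝓘(ℝ, Model n) (𝓡 (2 * n + 1)) e.symm y

/-- The coordinate expression of a one-form in the chart `e`. -/
def formIn {F : Type*} [NormedAddCommGroup F] [NormedSpace ℝ F]
    (e : OpenPartialHomeomorph M (Model n)) (θ : OneForm n M F) (y : Model n) : Model n →L[ℝ] F :=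
  (θ (e.symm y)).comp (dSymm e y)

/-- The coordinate expression of a vector field in the chart `e`. -/
def vfIn (e : OpenPartialHomeomorph M (Model n)) (X : VF n M) (y : Model n) : Model n :=
  dChart e (e.symm y) (X (e.symm y))

variable [IsManifold (𝓡 (2 * n + 1)) ∞ M]
  {e e' : OpenPartialHomeomorph M (Model n)}

/-- The maximal smooth atlas. -/
abbrev IsSmoothChart (e : OpenPartialHomeomorph M (Model n)) : Prop :=
  e ∈ IsManifold.maximalAtlas (𝓡 (2 * n + 1)) ∞ M

theorem IsSmoothChart.of_one (he : IsSmoothChart e) :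
    e ∈ IsManifold.maximalAtlas (𝓡 (2 * n + 1)) 1 M :=
  IsManifold.maximalAtlas_subset_of_le (by simp) he

theorem isSmoothChart_chartAt (x : M) : IsSmoothChart (chartAt (Model n) x) :=
  IsManifold.chart_mem_maximalAtlas x

theorem IsSmoothChart.mdifferentiable (he : IsSmoothChart e) :
    e.MDifferentiable (𝓡 (2 * n + 1)) (𝓡 (2 * n + 1)) :=
  ⟨fun _ hx => (mdifferentiableAt_of_mem_maximalAtlas he.of_one hx).mdifferentiableWithinAt,
    fun _ hx => (mdifferentiableAt_symm_of_mem_maximalAtlas he.of_one hx).mdifferentiableWithinAt⟩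

theorem dSymm_dChart (he : IsSmoothChart e) {x : M} (hx : x ∈ e.source) (v : TS n x) :
    dSymm e (e x) (dChart e x v) = (v : Model n) := by
  have := he.mdifferentiable.symm_comp_deriv hx
  exact congrArg (fun L : TS n x →L[ℝ] TS n x => (L v : Model n)) this

theorem dChart_dSymm (he : IsSmoothChart e) {y : Model n} (hy : y ∈ e.target) (v : Model n) :
    dChart e (e.symm y) (dSymm e y v) = v := by
  have := he.mdifferentiable.comp_symm_deriv hy
  exact congrArg (fun L : Model n →L[ℝ] Model n => L v) this

theorem dChart_injective (he : IsSmoothChart e) {x : M} (hx : x ∈ e.source) :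
    Function.Injective (dChart e x) :=
  he.mdifferentiable.mfderiv_injective hx

theorem dChart_surjective (he : IsSmoothChart e) {x : M} (hx : x ∈ e.source) :
    Function.Surjective (dChart e x) :=
  he.mdifferentiable.mfderiv_surjective hx

theorem formIn_apply {F : Type*} [NormedAddCommGroup F] [NormedSpace ℝ F] (he : IsSmoothChart e)
    (θ : OneForm n M F) {x : M} (hx : x ∈ e.source) (v : TS n x) :
    formIn e θ (e x) (dChart e x v) = θ x v := by
  -- The points `e.symm (e x)` and `x` are equal but their tangent spaces are different types, so
  -- the claim is generalized to any `x' = x` and to vectors compared in the model space.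
  have h : ∀ x' : M, ∀ hx' : x' = x, ∀ w : TS n x', (w : Model n) = v → θ x' w = θ x v := by
    rintro x' rfl w hw
    exact congrArg (θ x') hw
  exact h _ (e.left_inv hx) _ (dSymm_dChart he hx v)

theorem vfIn_apply (X : VF n M) {x : M} (hx : x ∈ e.source) :
    vfIn e X (e x) = dChart e x (X x) := by
  have h : ∀ x' : M, x' = x → dChart e x' (X x') = dChart e x (X x) := by
    rintro x' rfl; rfl
  exact h _ (e.left_inv hx)

/-- The coordinate change. -/
theorem contDiffOn_transition (he : IsSmoothChart e) (he' : IsSmoothChart e') :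
    ContDiffOn ℝ ∞ (e' ∘ e.symm) (e.target ∩ e.symm ⁻¹' e'.source) := by
  have h : ContMDiffOn (𝓡 (2 * n + 1)) (𝓡 (2 * n + 1)) ∞ (e' ∘ e.symm)
      (e.target ∩ e.symm ⁻¹' e'.source) :=
    (contMDiffOn_of_mem_maximalAtlas he').comp
      ((contMDiffOn_symm_of_mem_maximalAtlas he).mono inter_subset_left) inter_subset_right
  exact h.contDiffOn

theorem isOpen_transition_dom :
    IsOpen (e.target ∩ e.symm ⁻¹' e'.source) :=
  e.symm.isOpen_inter_preimage e'.open_source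

theorem contDiffAt_transition (he : IsSmoothChart e) (he' : IsSmoothChart e') {x : M}
    (hx : x ∈ e.source) (hx' : x ∈ e'.source) : ContDiffAt ℝ ∞ (e' ∘ e.symm) (e x) :=
  (contDiffOn_transition he he').contDiffAt
    (isOpen_transition_dom.mem_nhds ⟨e.map_source hx, by simpa [e.left_inv hx] using hx'⟩)

theorem fderiv_transition (he : IsSmoothChart e) (he' : IsSmoothChart e') {y : Model n}
    (hy : y ∈ e.target) (hy' : e.symm y ∈ e'.source) (v : Model n) :
    fderiv ℝ (e' ∘ e.symm) y v = dChart e' (e.symm y) (dSymm e y v) := by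
  have := mfderiv_comp (I := 𝓡 (2 * n + 1)) (I' := 𝓡 (2 * n + 1)) (I'' := 𝓡 (2 * n + 1)) y
    (mdifferentiableAt_of_mem_maximalAtlas he'.of_one hy')
    (mdifferentiableAt_symm_of_mem_maximalAtlas he.of_one hy)
  rw [mfderiv_eq_fderiv] at this
  exact congrArg (fun L : Model n →L[ℝ] Model n => L v) this

theorem fderiv_transition_dChart (he : IsSmoothChart e) (he' : IsSmoothChart e') {x : M}
    (hx : x ∈ e.source) (hx' : x ∈ e'.source) (v : TS n x) :
    fderiv ℝ (e' ∘ e.symm) (e x) (dChart e x v) = dChart e' x v := by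
  rw [fderiv_transition he he' (e.map_source hx) (by simpa [e.left_inv hx] using hx')]
  have h : ∀ x' : M, ∀ hx' : x' = x, ∀ w : TS n x', (w : Model n) = v →
      dChart e' x' w = dChart e' x v := by
    rintro x' rfl w hw
    exact congrArg (dChart e' x') hw
  exact h _ (e.left_inv hx) _ (dSymm_dChart he hx v)

theorem eventually_transition_dom {x : M} (hx : x ∈ e.source) (hx' : x ∈ e'.source) :
    ∀ᶠ y in 𝓝 (e x), y ∈ e.target ∧ e.symm y ∈ e'.source :=
  isOpen_transition_dom.mem_nhds ⟨e.map_source hx, by simpa [e.left_inv hx] using hx'⟩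

section Forms

variable {F : Type*} [NormedAddCommGroup F] [NormedSpace ℝ F]

theorem formIn_transition (he : IsSmoothChart e) (he' : IsSmoothChart e') (θ : OneForm n M F)
    {y : Model n} (hy : y ∈ e.target) (hy' : e.symm y ∈ e'.source) :
    formIn e θ y = (formIn e' θ ((e' ∘ e.symm) y)).comp (fderiv ℝ (e' ∘ e.symm) y) := by
  ext v
  rw [ContinuousLinearMap.comp_apply, fderiv_transition he he' hy hy']
  exact (formIn_apply he' θ hy' (dSymm e y v)).symm

theorem formInChart_eq (x : M) (θ : OneForm n M F) :
    formInChart x θ = formIn (chartAt (Model n) x) θ := rfl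

theorem formIn_contDiffAt (he : IsSmoothChart e) {θ : OneForm n M F} {U : Set M}
    (hθ : FormSmoothOn θ U) {x : M} (hxU : x ∈ U) (hx : x ∈ e.source) :
    ContDiffAt ℝ ∞ (formIn e θ) (e x) := by
  have hx' : x ∈ (chartAt (Model n) x).source := mem_chart_source _ x
  have he' := isSmoothChart_chartAt (n := n) x
  have h1 : formIn e θ =ᶠ[𝓝 (e x)] fun y =>
      (formIn (chartAt (Model n) x) θ ((chartAt (Model n) x ∘ e.symm) y)).comp
        (fderiv ℝ (chartAt (Model n) x ∘ e.symm) y) := by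
    filter_upwards [eventually_transition_dom hx hx'] with y hy
    exact formIn_transition he he' θ hy.1 hy.2
  refine ContDiffAt.congr_of_eventuallyEq ?_ h1
  have ht := contDiffAt_transition he he' hx hx'
  refine ContDiffAt.clm_comp (g := fun y => formIn (chartAt (Model n) x) θ ((chartAt (Model n) x ∘ e.symm) y)) ?_ (ht.fderiv_right (m := (∞ : WithTop ℕ∞)) (by simp))
  refine ContDiffAt.comp (g := formIn (chartAt (Model n) x) θ) (e x) ?_ ht
  have := hθ x hxU
  rw [formInChart_eq] at this
  have h2 : (chartAt (Model n) x ∘ e.symm) (e x) = extChartAt (𝓡 (2 * n + 1)) x x := by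
    simp [e.left_inv hx]
  rw [h2]; exact this

/-- The antisymmetrized derivative of a one-form on the model space. -/
def dForm (β : Model n → Model n →L[ℝ] F) (y a b : Model n) : F :=
  fderiv ℝ β y a b - fderiv ℝ β y b a

/-- Naturality of d under pull-back: differentiating β(τ)∘Dτ produces one term with D²τ, which is
symmetric and disappears on antisymmetrization. -/
theorem dForm_pullback {β : Model n → Model n →L[ℝ] F} {τ : Model n → Model n} {y : Model n}
    (hτ : ContDiffAt ℝ ∞ τ y) (hβ : DifferentiableAt ℝ β (τ y)) (a b : Model n) :
    dForm (fun z => (β (τ z)).comp (fderiv ℝ τ z)) y a b =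
      dForm β (τ y) (fderiv ℝ τ y a) (fderiv ℝ τ y b) := by
  have hd : DifferentiableAt ℝ (fderiv ℝ τ) y :=
    (hτ.fderiv_right (m := ∞) (by simp)).differentiableAt (by simp)
  have hτ1 : DifferentiableAt ℝ τ y := hτ.differentiableAt (by simp)
  have hc : HasFDerivAt (fun z => β (τ z)) ((fderiv ℝ β (τ y)).comp (fderiv ℝ τ y)) y :=
    hβ.hasFDerivAt.comp y hτ1.hasFDerivAt
  have key := (hc.clm_comp hd.hasFDerivAt).fderiv
  have hs : IsSymmSndFDerivAt ℝ τ y := hτ.isSymmSndFDerivAt (by simpa using two_le_infty)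
  unfold dForm
  rw [key]
  simp [hs.eq b a]

/-- `extD` is tied to the preferred chart at each point. Naturality under the coordinate change
frees it from that choice, so that every later computation can take place in one adapted chart. -/
theorem extD_eq (he : IsSmoothChart e) {θ : OneForm n M F} {U : Set M} (hθ : FormSmoothOn θ U)
    {x : M} (hxU : x ∈ U) (hx : x ∈ e.source) (v w : TS n x) :
    extD θ x v w = dForm (formIn e θ) (e x) (dChart e x v) (dChart e x w) := by
  have hx' : x ∈ (chartAt (Model n) x).source := mem_chart_source _ x
  have he' := isSmoothChart_chartAt (n := n) x
  set c := chartAt (Model n) x with hc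
  have hL : extD θ x v w = dForm (formIn c θ) (c x) (dChart c x v) (dChart c x w) := rfl
  rw [hL]
  have hev : formIn c θ =ᶠ[𝓝 (c x)] fun y =>
      (formIn e θ ((e ∘ c.symm) y)).comp (fderiv ℝ (e ∘ c.symm) y) := by
    filter_upwards [eventually_transition_dom hx' hx] with y hy
    exact formIn_transition he' he θ hy.1 hy.2
  have h1 : dForm (formIn c θ) (c x) (dChart c x v) (dChart c x w) = dForm (fun y =>
      (formIn e θ ((e ∘ c.symm) y)).comp (fderiv ℝ (e ∘ c.symm) y)) (c x)
        (dChart c x v) (dChart c x w) := by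
    unfold dForm; rw [hev.fderiv_eq]
  have h3 : (e ∘ c.symm) (c x) = e x := by simp [c.left_inv hx']
  rw [h1, dForm_pullback (contDiffAt_transition he' he hx' hx)
    (by rw [h3]; exact (formIn_contDiffAt he hθ hxU hx).differentiableAt (by simp)), h3,
    fderiv_transition_dChart he' he hx' hx, fderiv_transition_dChart he' he hx' hx]

end Forms

theorem vfIn_contDiffAt (he : IsSmoothChart e) {X : VF n M} {k : WithTop ℕ∞} {U : Set M}
    (hk : k + 1 ≤ (∞ : WithTop ℕ∞)) (hX : VFSmoothOn k X U) (hU : IsOpen U) {x : M} (hxU : x ∈ U)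
    (hx : x ∈ e.source) : ContDiffAt ℝ k (vfIn e X) (e x) := by
  have h1 : ContMDiffOn (𝓡 (2 * n + 1)).tangent (𝓡 (2 * n + 1)).tangent k
      (tangentMapWithin (𝓡 (2 * n + 1)) (𝓡 (2 * n + 1)) e e.source)
      (Bundle.TotalSpace.proj ⁻¹' e.source) :=
    ContMDiffOn.contMDiffOn_tangentMapWithin (contMDiffOn_of_mem_maximalAtlas he)
      hk e.open_source.uniqueMDiffOn
  have h2 := h1.comp (hX.mono inter_subset_left) (s := U ∩ e.source) (by
    rintro z ⟨_, hz⟩; exact hz)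
  have h3 : ContMDiffAt (𝓡 (2 * n + 1)) (𝓡 (2 * n + 1)).tangent k
      ((tangentMapWithin (𝓡 (2 * n + 1)) (𝓡 (2 * n + 1)) e e.source) ∘
        fun x => (⟨x, X x⟩ : TangentBundle (𝓡 (2 * n + 1)) M)) x :=
    h2.contMDiffAt ((hU.inter e.open_source).mem_nhds ⟨hxU, hx⟩)
  have h4 := (contMDiff_snd_tangentBundle_modelSpace (Model n) (𝓡 (2 * n + 1)) (n := k)).contMDiffAt.comp x h3
  have h5 : ContDiffAt ℝ k ((fun x => dChart e x (X x)) ∘ e.symm) (e x) := by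
    have h6 : ContMDiffAt (𝓡 (2 * n + 1)) 𝓘(ℝ, Model n) k (fun x => dChart e x (X x)) x := by
      refine h4.congr_of_eventuallyEq ?_
      filter_upwards [e.open_source.mem_nhds hx] with z hz
      simp only [Function.comp, tangentMapWithin]
      rw [mfderivWithin_of_isOpen e.open_source hz]
      rfl
    have h7 : ContMDiffAt (𝓡 (2 * n + 1)) (𝓡 (2 * n + 1)) k e.symm (e x) :=
      (contMDiffAt_symm_of_mem_maximalAtlas he (e.map_source hx)).of_le (le_trans le_self_add hk)
    exact (ContMDiffAt.comp_of_eq h6 h7 (e.left_inv hx)).contDiffAt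
  exact h5

theorem VFSmoothOn.mdifferentiableAt {X : VF n M} {k : WithTop ℕ∞} {U : Set M} (hk : k ≠ 0)
    (hX : VFSmoothOn k X U) (hU : IsOpen U) {x : M} (hxU : x ∈ U) :
    MDifferentiableAt (𝓡 (2 * n + 1)) (𝓡 (2 * n + 1)).tangent
      (fun x => (⟨x, X x⟩ : TangentBundle (𝓡 (2 * n + 1)) M)) x :=
  (ContMDiffOn.contMDiffAt hX (hU.mem_nhds hxU)).mdifferentiableAt hk

theorem mpullback_symm_eq (he : IsSmoothChart e) (X : VF n M) {y : Model n} (hy : y ∈ e.target) :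
    VectorField.mpullback 𝓘(ℝ, Model n) (𝓡 (2 * n + 1)) e.symm X y = vfIn e X y := by
  have hinv : (mfderiv 𝓘(ℝ, Model n) (𝓡 (2 * n + 1)) e.symm y).IsInvertible :=
    ⟨he.mdifferentiable.symm.mfderiv hy, rfl⟩
  rw [VectorField.mpullback_apply]
  have h := dChart_dSymm he hy
    ((mfderiv 𝓘(ℝ, Model n) (𝓡 (2 * n + 1)) e.symm y).inverse (X (e.symm y)))
  rw [← h]
  unfold vfIn
  congr 1
  exact hinv.self_apply_inverse _

theorem mlieBracket_model (V W : Model n → Model n) (y : Model n) :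
    (VectorField.mlieBracket 𝓘(ℝ, Model n) V W y : Model n) =
      fderiv ℝ W y (V y) - fderiv ℝ V y (W y) := by
  exact (congrFun (VectorField.mlieBracketWithin_univ (I := 𝓘(ℝ, Model n))).symm y).trans
    ((congrFun VectorField.mlieBracketWithin_eq_lieBracketWithin y).trans
      (congrFun VectorField.lieBracketWithin_univ y))

theorem dChart_mlieBracket (he : IsSmoothChart e) {X Y : VF n M} {U : Set M} (hU : IsOpen U)
    (hX : VFSmoothOn 1 X U) (hY : VFSmoothOn 1 Y U) {x : M} (hxU : x ∈ U) (hx : x ∈ e.source) :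
    dChart e x (VectorField.mlieBracket (𝓡 (2 * n + 1)) X Y x) =
      fderiv ℝ (vfIn e Y) (e x) (dChart e x (X x)) -
        fderiv ℝ (vfIn e X) (e x) (dChart e x (Y x)) := by
  have hm : ∀ Z : VF n M, VectorField.mpullback 𝓘(ℝ, Model n) (𝓡 (2 * n + 1)) e.symm Z
      =ᶠ[𝓝 (e x)] vfIn e Z := fun Z => by
    filter_upwards [e.open_target.mem_nhds (e.map_source hx)] with y hy
    exact mpullback_symm_eq he Z hy
  have : IsManifold (𝓡 (2 * n + 1)) (minSmoothness ℝ 2) M :=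
    IsManifold.of_le (n := ∞) (by simpa using two_le_infty)
  have h := VectorField.mpullback_mlieBracket (I := 𝓘(ℝ, Model n)) (I' := 𝓡 (2 * n + 1))
    (f := e.symm) (V := X) (W := Y) (x₀ := e x) (n := ∞)
    (by rw [e.left_inv hx]; exact hX.mdifferentiableAt one_ne_zero hU hxU)
    (by rw [e.left_inv hx]; exact hY.mdifferentiableAt one_ne_zero hU hxU)
    (contMDiffAt_symm_of_mem_maximalAtlas he (e.map_source hx)) (by simpa using two_le_infty)
  rw [mpullback_symm_eq he _ (e.map_source hx), vfIn_apply _ hx] at h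
  rw [h, Filter.EventuallyEq.mlieBracket_vectorField_eq (hm X) (hm Y),
    mlieBracket_model, vfIn_apply _ hx, vfIn_apply _ hx]

theorem mfderiv_eq_chart {F : Type*} [NormedAddCommGroup F] [NormedSpace ℝ F]
    (he : IsSmoothChart e) {g : M → F} {x : M} (hx : x ∈ e.source)
    (hg : DifferentiableAt ℝ (g ∘ e.symm) (e x)) (v : TS n x) :
    (mfderiv (𝓡 (2 * n + 1)) 𝓘(ℝ, F) g x v : F) =
      fderiv ℝ (g ∘ e.symm) (e x) (dChart e x v) := by
  have h1 : g =ᶠ[𝓝 x] (g ∘ e.symm) ∘ e := by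
    filter_upwards [e.open_source.mem_nhds hx] with z hz
    simp [e.left_inv hz]
  rw [h1.mfderiv_eq]
  have := mfderiv_comp (I := 𝓡 (2 * n + 1)) (I' := 𝓘(ℝ, Model n)) (I'' := 𝓘(ℝ, F)) x
    (g := g ∘ e.symm) (f := e) hg.mdifferentiableAt
    (mdifferentiableAt_of_mem_maximalAtlas he.of_one hx)
  rw [this, mfderiv_eq_fderiv]
  rfl

section Lie

variable {F : Type*} [NormedAddCommGroup F] [NormedSpace ℝ F]

theorem form_vf_comp_symm (he : IsSmoothChart e) (θ : OneForm n M F) (X : VF n M) {x : M}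
    (hx : x ∈ e.source) :
    ((fun y => θ y (X y)) ∘ e.symm) =ᶠ[𝓝 (e x)] fun y => formIn e θ y (vfIn e X y) := by
  filter_upwards [e.open_target.mem_nhds (e.map_source hx)] with y hy
  have := formIn_apply he θ (e.map_target hy) (X (e.symm y))
  rw [e.right_inv hy] at this
  exact this.symm

/-- The part of d(θ(X)) that differentiates θ cancels the second half of X ⌟ dθ. What is left
involves θ and X only up to first order, so a C¹ field suffices. -/
theorem lieD_eq (he : IsSmoothChart e) {θ : OneForm n M F} {U : Set M} (hθ : FormSmoothOn θ U)
    (hU : IsOpen U) {X : VF n M} (hX : VFSmoothOn 1 X U) {x : M} (hxU : x ∈ U)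
    (hx : x ∈ e.source) (v : TS n x) :
    lieD X θ x v = fderiv ℝ (formIn e θ) (e x) (vfIn e X (e x)) (dChart e x v) +
      formIn e θ (e x) (fderiv ℝ (vfIn e X) (e x) (dChart e x v)) := by
  have h1 : DifferentiableAt ℝ (formIn e θ) (e x) :=
    (formIn_contDiffAt he hθ hxU hx).differentiableAt (by simp)
  have h2 : DifferentiableAt ℝ (vfIn e X) (e x) :=
    (vfIn_contDiffAt he one_add_one_le_infty hX hU hxU hx).differentiableAt (by simp)
  have h3 := form_vf_comp_symm he θ X hx
  have h4 : DifferentiableAt ℝ ((fun y => θ y (X y)) ∘ e.symm) (e x) :=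
    (h1.clm_apply h2).congr_of_eventuallyEq h3
  have h5 : ∀ d : F, d = mfderiv (𝓡 (2 * n + 1)) 𝓘(ℝ, F) (fun y => θ y (X y)) x v →
      lieD X θ x v = extD θ x (X x) v + d := by
    rintro d rfl; rfl
  rw [h5 _ (mfderiv_eq_chart he hx h4 v).symm, h3.fderiv_eq, extD_eq he hθ hxU hx,
    (h1.hasFDerivAt.clm_apply h2.hasFDerivAt).fderiv, vfIn_apply X hx]
  simp [dForm]

/-- Cartan's formula L_X θ(W) = θ([W, X]) + X(θ(W)). It turns a Lie derivative into a bracket as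
soon as θ(W) vanishes identically. -/
theorem lieD_apply_vf (he : IsSmoothChart e) {θ : OneForm n M F} {U : Set M}
    (hθ : FormSmoothOn θ U) (hU : IsOpen U) {X W : VF n M} (hX : VFSmoothOn 1 X U)
    (hW : VFSmoothOn 1 W U) {x : M} (hxU : x ∈ U) (hx : x ∈ e.source) :
    lieD X θ x (W x) = θ x (VectorField.mlieBracket (𝓡 (2 * n + 1)) W X x) +
      fderiv ℝ (fun y => formIn e θ y (vfIn e W y)) (e x) (vfIn e X (e x)) := by
  have h1 : DifferentiableAt ℝ (formIn e θ) (e x) :=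
    (formIn_contDiffAt he hθ hxU hx).differentiableAt (by simp)
  have h2 : DifferentiableAt ℝ (vfIn e W) (e x) :=
    (vfIn_contDiffAt he one_add_one_le_infty hW hU hxU hx).differentiableAt (by simp)
  rw [lieD_eq he hθ hU hX hxU hx, ← formIn_apply he θ hx, dChart_mlieBracket he hU hW hX hxU hx,
    (h1.hasFDerivAt.clm_apply h2.hasFDerivAt).fderiv, vfIn_apply X hx, vfIn_apply W hx]
  simp
  abel

theorem dChart_mfderiv (he : IsSmoothChart e) {f : M → M} {x : M}
    (hf : MDifferentiableAt (𝓡 (2 * n + 1)) (𝓡 (2 * n + 1)) f x) (hx : x ∈ e.source)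
    (hfx : f x ∈ e.source) (v : TS n x) :
    dChart e (f x) (mfderiv (𝓡 (2 * n + 1)) (𝓡 (2 * n + 1)) f x v) =
      fderiv ℝ (e ∘ f ∘ e.symm) (e x) (dChart e x v) := by
  have hef : MDifferentiableAt (𝓡 (2 * n + 1)) 𝓘(ℝ, Model n) (e ∘ f) x :=
    MDifferentiableAt.comp x (mdifferentiableAt_of_mem_maximalAtlas he.of_one hfx) hf
  have h1 := mfderiv_comp (I := 𝓡 (2 * n + 1)) (I' := 𝓡 (2 * n + 1)) (I'' := 𝓘(ℝ, Model n)) x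
    (g := e) (f := f) (mdifferentiableAt_of_mem_maximalAtlas he.of_one hfx) hf
  have h2 : DifferentiableAt ℝ ((e ∘ f) ∘ e.symm) (e x) := by
    refine MDifferentiableAt.differentiableAt ?_
    refine MDifferentiableAt.comp (I' := 𝓡 (2 * n + 1)) (e x) ?_
      (mdifferentiableAt_symm_of_mem_maximalAtlas he.of_one (e.map_source hx))
    rw [e.left_inv hx]; exact hef
  have h3 := mfderiv_eq_chart he hx h2 v
  rw [h1] at h3
  exact h3

theorem differentiableAt_chart_comp (he : IsSmoothChart e) {f : M → M} {x : M}
    (hf : MDifferentiableAt (𝓡 (2 * n + 1)) (𝓡 (2 * n + 1)) f x) (hx : x ∈ e.source)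
    (hfx : f x ∈ e.source) : DifferentiableAt ℝ (e ∘ f ∘ e.symm) (e x) := by
  have hef : MDifferentiableAt (𝓡 (2 * n + 1)) 𝓘(ℝ, Model n) (e ∘ f) x :=
    MDifferentiableAt.comp x (mdifferentiableAt_of_mem_maximalAtlas he.of_one hfx) hf
  refine MDifferentiableAt.differentiableAt ?_
  refine MDifferentiableAt.comp (I' := 𝓡 (2 * n + 1)) (g := e ∘ f) (e x) ?_
    (mdifferentiableAt_symm_of_mem_maximalAtlas he.of_one (e.map_source hx))
  rw [e.left_inv hx]; exact hef

theorem pullForm_eq (he : IsSmoothChart e) (θ : OneForm n M F) {f : M → M} {x : M}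
    (hf : MDifferentiableAt (𝓡 (2 * n + 1)) (𝓡 (2 * n + 1)) f x) (hx : x ∈ e.source)
    (hfx : f x ∈ e.source) (v : TS n x) :
    pullForm f θ x v =
      formIn e θ (e (f x)) (fderiv ℝ (e ∘ f ∘ e.symm) (e x) (dChart e x v)) := by
  rw [← dChart_mfderiv he hf hx hfx, formIn_apply he θ hfx]
  rfl

end Lie

end ChartCalculus

end CRDef

end

open scoped Manifold ContDiff TensorProduct ENNReal Topology
noncomputable section
namespace CRDef
open Set Filter
set_option linter.unusedSectionVars false

/-! ### Linear algebra of complexified tangent spaces -/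

section ComplexAlgebra

variable {n : ℕ} {M : Type*} [TopologicalSpace M] [ChartedSpace (Model n) M] {x : M}

@[simp] theorem reT_tmul (c : ℂ) (v : TS n x) : reT (c ⊗ₜ[ℝ] v) = c.re • v := by simp [reT]

@[simp] theorem imT_tmul (c : ℂ) (v : TS n x) : imT (c ⊗ₜ[ℝ] v) = c.im • v := by simp [imT]

@[simp] theorem conjT_tmul (c : ℂ) (v : TS n x) :
    conjT (c ⊗ₜ[ℝ] v) = (starRingEnd ℂ c) ⊗ₜ[ℝ] v := by simp [conjT]

theorem reT_add_imT (z : CT n x) : (1 : ℂ) ⊗ₜ[ℝ] reT z + Complex.I ⊗ₜ[ℝ] imT z = z := by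
  induction z using TensorProduct.induction_on with
  | zero => simp
  | tmul a v =>
    rw [reT_tmul, imT_tmul, ← TensorProduct.smul_tmul, ← TensorProduct.smul_tmul,
      ← TensorProduct.add_tmul]
    congr 1
    apply Complex.ext <;> simp
  | add a b ha hb =>
    rw [map_add, map_add, TensorProduct.tmul_add, TensorProduct.tmul_add]
    nth_rewrite 3 [← ha]
    nth_rewrite 3 [← hb]
    abel

theorem CT_ext {z w : CT n x} (h1 : reT z = reT w) (h2 : imT z = imT w) : z = w := by
  rw [← reT_add_imT z, ← reT_add_imT w, h1, h2]

theorem reT_smul (c : ℂ) (z : CT n x) : reT (c • z) = c.re • reT z - c.im • imT z := by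
  induction z using TensorProduct.induction_on with
  | zero => simp
  | tmul a v => simp [TensorProduct.smul_tmul', sub_smul, mul_smul]
  | add a b ha hb => simp only [smul_add, map_add, ha, hb]; abel

theorem imT_smul (c : ℂ) (z : CT n x) : imT (c • z) = c.re • imT z + c.im • reT z := by
  induction z using TensorProduct.induction_on with
  | zero => simp
  | tmul a v => simp [TensorProduct.smul_tmul', add_smul, mul_smul]
  | add a b ha hb => simp only [smul_add, map_add, ha, hb]; abel

@[simp] theorem reT_conjT (z : CT n x) : reT (conjT z) = reT z := by
  induction z using TensorProduct.induction_on with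
  | zero => simp
  | tmul a v => simp
  | add a b ha hb => simp only [map_add, ha, hb]

@[simp] theorem imT_conjT (z : CT n x) : imT (conjT z) = -imT z := by
  induction z using TensorProduct.induction_on with
  | zero => simp
  | tmul a v => simp
  | add a b ha hb => simp only [map_add, ha, hb]; abel

@[simp] theorem conjT_conjT (z : CT n x) : conjT (conjT z) = z :=
  CT_ext (by simp) (by simp)

/-- The complex linear extension of a real linear map, as a linear map. -/
def cEvalL (L : TS n x →ₗ[ℝ] ℂ) : CT n x →ₗ[ℂ] ℂ where
  toFun := cEval L
  map_add' a b := by simp only [cEval, map_add]; ring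
  map_smul' c a := by
    simp only [cEval, reT_smul, imT_smul, map_add, map_sub, map_smul, Complex.real_smul,
      RingHom.id_apply, smul_eq_mul]
    nth_rewrite 5 [← Complex.re_add_im c]
    linear_combination (-(c.im : ℂ) * L (imT a)) * Complex.I_mul_I

theorem cEval_eq (L : TS n x →ₗ[ℝ] ℂ) (z : CT n x) : cEval L z = cEvalL L z := rfl

theorem cEval_conj (L : TS n x →ₗ[ℝ] ℂ) (z : CT n x) :
    cEval (fun v => starRingEnd ℂ (L v)) z = starRingEnd ℂ (cEval L (conjT z)) := by
  simp [cEval]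

theorem cEval_conjForm (θ : OneForm n M ℂ) (z : CT n x) :
    cEval (conjForm θ x) z = starRingEnd ℂ (cEval (θ x) (conjT z)) :=
  cEval_conj (θ x).toLinearMap z

theorem cEval_real_eq_zero (L : TS n x →L[ℝ] ℝ) (z : CT n x) :
    cEval (fun v => (L v : ℂ)) z = 0 ↔ L (reT z) = 0 ∧ L (imT z) = 0 := by
  simp [cEval, Complex.ext_iff]

theorem reT_pushC (f : M → M) (z : CT n x) :
    reT (pushC f x z) = mfderiv (𝓡 (2 * n + 1)) (𝓡 (2 * n + 1)) f x (reT z) := by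
  induction z using TensorProduct.induction_on with
  | zero => simp
  | tmul a v => simp [pushC]
  | add a b ha hb => simp only [map_add, ha, hb]

theorem imT_pushC (f : M → M) (z : CT n x) :
    imT (pushC f x z) = mfderiv (𝓡 (2 * n + 1)) (𝓡 (2 * n + 1)) f x (imT z) := by
  induction z using TensorProduct.induction_on with
  | zero => simp
  | tmul a v => simp [pushC]
  | add a b ha hb => simp only [map_add, ha, hb]

theorem cEval_pullForm (f : M → M) (θ : OneForm n M ℂ) (z : CT n x) :
    cEval (pullForm f θ x) z = cEval (θ (f x)) (pushC f x z) := by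
  simp only [cEval, pullForm, reT_pushC, imT_pushC]

instance : FiniteDimensional ℝ (TS n x) := inferInstanceAs (FiniteDimensional ℝ (Model n))

instance : FiniteDimensional ℂ (CT n x) := inferInstance

end ComplexAlgebra

/-! ### The adapted frames -/

namespace AdaptedAtlas

variable {n : ℕ} {M : Type*} [TopologicalSpace M] [ChartedSpace (Model n) M]
  [IsManifold (𝓡 (2 * n + 1)) ∞ M]
  {C : CRStructure n M} {ι : Type*} [Fintype ι] (A : AdaptedAtlas C ι)

/-- The component `θ^α(z)`. -/
def ev (l : ι) (α : Fin n) (x : M) : CT n x →ₗ[ℂ] ℂ := cEvalL (A.θ l α x).toLinearMap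

/-- The component `θ^ᾱ(z)`. -/
def evBar (l : ι) (α : Fin n) (x : M) : CT n x →ₗ[ℂ] ℂ :=
  cEvalL (conjForm (A.θ l α) x).toLinearMap

variable (C) in
/-- The component `η(z)`. -/
def evη (x : M) : CT n x →ₗ[ℂ] ℂ :=
  cEvalL (Complex.ofRealCLM.comp (C.η x)).toLinearMap

theorem evBar_apply (l : ι) (α : Fin n) {x : M} (z : CT n x) :
    A.evBar l α x z = starRingEnd ℂ (A.ev l α x (conjT z)) :=
  cEval_conjForm _ _

theorem evη_conj {x : M} (z : CT n x) : evη C x (conjT z) = starRingEnd ℂ (evη C x z) := by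
  simp [evη, ← cEval_eq, cEval]

variable {l : ι} {x : M}

theorem mem_antihol_iff (hx : x ∈ (A.chart l).source) (z : CT n x) :
    z ∈ C.antihol x ↔ evη C x z = 0 ∧ ∀ α, A.ev l α x z = 0 := A.annihilator l x hx z

theorem mem_antihol_iff_conj (z : CT n x) : z ∈ C.antihol x ↔ conjT z ∈ C.hol x := Iff.rfl

theorem mem_hol_iff_conj (z : CT n x) : z ∈ C.hol x ↔ conjT z ∈ C.antihol x := by
  rw [mem_antihol_iff_conj, conjT_conjT]

theorem mem_hol_iff (hx : x ∈ (A.chart l).source) (z : CT n x) :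
    z ∈ C.hol x ↔ evη C x z = 0 ∧ ∀ α, A.evBar l α x z = 0 := by
  rw [mem_hol_iff_conj, A.mem_antihol_iff hx, evη_conj]
  simp only [evBar_apply, map_eq_zero]

theorem mem_H_iff (z : CT n x) : z ∈ C.hol x ⊔ C.antihol x ↔ evη C x z = 0 := C.contact x z

theorem Z_mem_hol (hx : x ∈ (A.chart l).source) (α : Fin n) : A.Z l α x ∈ C.hol x :=
  A.Z_mem l α x hx

theorem Zbar_mem (hx : x ∈ (A.chart l).source) (α : Fin n) : A.Zbar l α x ∈ C.antihol x := by
  rw [mem_antihol_iff_conj]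
  simpa [Zbar] using A.Z_mem_hol hx α

theorem ev_Z (hx : x ∈ (A.chart l).source) (α β : Fin n) :
    A.ev l α x (A.Z l β x) = if α = β then 1 else 0 := A.dual l α β x hx

theorem ev_Zbar (hx : x ∈ (A.chart l).source) (α β : Fin n) :
    A.ev l α x (A.Zbar l β x) = 0 :=
  ((A.mem_antihol_iff hx _).1 (A.Zbar_mem hx β)).2 α

theorem evBar_Z (hx : x ∈ (A.chart l).source) (α β : Fin n) :
    A.evBar l α x (A.Z l β x) = 0 :=
  ((A.mem_hol_iff hx _).1 (A.Z_mem_hol hx β)).2 α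

theorem evBar_Zbar (hx : x ∈ (A.chart l).source) (α β : Fin n) :
    A.evBar l α x (A.Zbar l β x) = if α = β then 1 else 0 := by
  rw [evBar_apply, Zbar, conjT_conjT, A.ev_Z hx]
  split_ifs <;> simp

/-- Duality with the forms θ^α makes the n vectors Z_α independent, and since the fibre has
dimension n they are a basis. -/
theorem hol_eq_sum (hx : x ∈ (A.chart l).source) {z : CT n x} (hz : z ∈ C.hol x) :
    z = ∑ α, A.ev l α x z • A.Z l α x := by
  have hli : LinearIndependent ℂ fun α => (⟨A.Z l α x, A.Z_mem_hol hx α⟩ : C.hol x) := by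
    rw [Fintype.linearIndependent_iff]
    intro g hg α
    have h := congrArg (fun w : C.hol x => A.ev l α x (w : CT n x)) hg
    simpa [A.ev_Z hx] using h
  have hspan := hli.span_eq_top_of_card_eq_finrank' (by simp [C.rank x])
  have hmem : (⟨z, hz⟩ : C.hol x) ∈ Submodule.span ℂ
      (Set.range fun α => (⟨A.Z l α x, A.Z_mem_hol hx α⟩ : C.hol x)) := by
    rw [hspan]; trivial
  obtain ⟨c, hc⟩ := (Submodule.mem_span_range_iff_exists_fun ℂ).1 hmem
  have hc' := congrArg (fun w : C.hol x => (w : CT n x)) hc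
  simp only [Submodule.coe_sum, Submodule.coe_smul] at hc'
  have hcoef : ∀ α, A.ev l α x z = c α := fun α => by
    rw [← hc']; simp [A.ev_Z hx]
  simp only [hcoef, hc']

theorem antihol_eq_sum (hx : x ∈ (A.chart l).source) {z : CT n x} (hz : z ∈ C.antihol x) :
    z = ∑ α, A.evBar l α x z • A.Zbar l α x := by
  have h := congrArg conjT (A.hol_eq_sum hx hz)
  rw [conjT_conjT, map_sum] at h
  simpa only [conjT_smul, evBar_apply, Zbar] using h

theorem H_eq_sum (hx : x ∈ (A.chart l).source) {z : CT n x} (hz : evη C x z = 0) :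
    z = ∑ α, A.ev l α x z • A.Z l α x + ∑ α, A.evBar l α x z • A.Zbar l α x := by
  obtain ⟨a, ha, b, hb, rfl⟩ := Submodule.mem_sup.1 ((mem_H_iff z).2 hz)
  have h1 : ∀ α, A.ev l α x b = 0 := ((A.mem_antihol_iff hx _).1 hb).2
  have h2 : ∀ α, A.evBar l α x a = 0 := ((A.mem_hol_iff hx _).1 ha).2
  simp only [map_add, h1, h2, add_zero, zero_add]
  rw [← A.hol_eq_sum hx ha, ← A.antihol_eq_sum hx hb]

/-! ### Components of deformation tensors -/

theorem coef_eq (φ : C.Deform) (hx : x ∈ (A.chart l).source) (α β : Fin n) :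
    A.coef φ l α β x = A.ev l α x (φ x ⟨A.Zbar l β x, A.Zbar_mem hx β⟩ : CT n x) := by
  rw [coef, dif_pos (A.Zbar_mem hx β)]; rfl

theorem ev_deform (φ : C.Deform) (hx : x ∈ (A.chart l).source) (z : C.antihol x) (α : Fin n) :
    A.ev l α x (φ x z : CT n x) = ∑ β, A.coef φ l α β x * A.evBar l β x (z : CT n x) := by
  have hz : z = ∑ β, A.evBar l β x (z : CT n x) •
      (⟨A.Zbar l β x, A.Zbar_mem hx β⟩ : C.antihol x) := by
    apply Subtype.ext
    simpa only [Submodule.coe_sum, Submodule.coe_smul] using A.antihol_eq_sum hx z.2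
  conv_lhs => rw [hz]
  simp only [map_sum, map_smul, Submodule.coe_sum, Submodule.coe_smul, A.coef_eq φ hx, smul_eq_mul]
  exact Finset.sum_congr rfl fun β _ => mul_comm _ _

theorem deform_eq_sum (φ : C.Deform) (hx : x ∈ (A.chart l).source) (z : C.antihol x) :
    (φ x z : CT n x) =
      ∑ α, (∑ β, A.coef φ l α β x * A.evBar l β x (z : CT n x)) • A.Z l α x := by
  rw [A.hol_eq_sum hx (φ x z).2]
  simp only [A.ev_deform φ hx]

/-- The deformed bundle as a common kernel inside H_ℂ. The minus sign in Z̄ − φ(Z̄) becomes the plus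
sign in θ^α + φ^α_β̄ θ^β̄. A description by equations is the one that pulls back directly along a
map. -/
theorem mem_deformed_iff (φ : C.Deform) (hx : x ∈ (A.chart l).source) (w : CT n x) :
    w ∈ CRStructure.deformed φ x ↔ evη C x w = 0 ∧
      ∀ α, A.ev l α x w + ∑ β, A.coef φ l α β x * A.evBar l β x w = 0 := by
  constructor
  · rintro ⟨z, rfl⟩
    have hz := (A.mem_antihol_iff hx _).1 z.2
    have hφ := (A.mem_hol_iff hx _).1 (φ x z).2
    refine ⟨by rw [map_sub, hz.1, hφ.1, sub_zero], fun α => ?_⟩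
    simp only [map_sub, hz.2, hφ.2, sub_zero, zero_sub, A.ev_deform φ hx]
    ring
  · rintro ⟨h1, h2⟩
    have hb : ∑ α, A.evBar l α x w • A.Zbar l α x ∈ C.antihol x :=
      Submodule.sum_mem _ fun α _ => Submodule.smul_mem _ _ (A.Zbar_mem hx α)
    refine ⟨⟨_, hb⟩, ?_⟩
    have h3 : ∀ β, A.evBar l β x (∑ α, A.evBar l α x w • A.Zbar l α x) = A.evBar l β x w :=
      fun β => by simp [A.evBar_Zbar hx]
    rw [A.deform_eq_sum φ hx]
    simp only [h3]
    nth_rewrite 1 [A.H_eq_sum hx h1]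
    rw [sub_eq_add_neg, add_comm, ← Finset.sum_neg_distrib]
    congr 1
    refine Finset.sum_congr rfl fun α _ => ?_
    rw [eq_neg_of_add_eq_zero_left (h2 α), neg_smul]

/-- The deformation tensor with prescribed components at every point. -/
def ofCoef (k : M → ι) (hk : ∀ x, x ∈ (A.chart (k x)).source)
    (c : ∀ _ : M, Matrix (Fin n) (Fin n) ℂ) : C.Deform := fun x =>
  LinearMap.codRestrict (C.hol x)
    (∑ α, ∑ β, (c x α β) • ((A.evBar (k x) β x).comp (C.antihol x).subtype).smulRight
      (A.Z (k x) α x)) (fun z => by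
        simp only [LinearMap.sum_apply, LinearMap.smul_apply, LinearMap.smulRight_apply]
        exact Submodule.sum_mem _ fun α _ => Submodule.sum_mem _ fun β _ =>
          Submodule.smul_mem _ _ (Submodule.smul_mem _ _ (A.Z_mem_hol (hk x) α)))

theorem coef_ofCoef (k : M → ι) (hk : ∀ x, x ∈ (A.chart (k x)).source)
    (c : ∀ _ : M, Matrix (Fin n) (Fin n) ℂ) (x : M) (α β : Fin n) :
    A.coef (A.ofCoef k hk c) (k x) α β x = c x α β := by
  rw [A.coef_eq _ (hk x)]
  simp [ofCoef, A.ev_Z (hk x), A.evBar_Zbar (hk x)]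

theorem deform_ext (φ ψ : C.Deform) (hx : x ∈ (A.chart l).source)
    (h : ∀ α β, A.coef φ l α β x = A.coef ψ l α β x) : φ x = ψ x := by
  ext z
  rw [A.deform_eq_sum φ hx, A.deform_eq_sum ψ hx]
  simp only [h]

/-- The matrix of components of a deformation tensor. -/
def coefMat (φ : C.Deform) (l : ι) (x : M) : Matrix (Fin n) (Fin n) ℂ :=
  Matrix.of fun α β => A.coef φ l α β x

end AdaptedAtlas

end CRDef

end

open scoped Manifold ContDiff TensorProduct ENNReal Topology
noncomputable section
namespace CRDef
open Set Filter
set_option linter.unusedSectionVars false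

/-! ### Sections -/

section Sections

variable {n : ℕ} {M : Type*} [TopologicalSpace M] [ChartedSpace (Model n) M]
  [IsManifold (𝓡 (2 * n + 1)) ∞ M]

theorem VFSmoothOn.sub {X Y : VF n M} {U : Set M} {k : WithTop ℕ∞} (hX : VFSmoothOn k X U)
    (hY : VFSmoothOn k Y U) : VFSmoothOn k (X - Y) U :=
  ContMDiffOn.sub_section (V := (TangentSpace (𝓡 (2 * n + 1)) : M → Type _)) hX hY

theorem VFSmoothOn.add {X Y : VF n M} {U : Set M} {k : WithTop ℕ∞} (hX : VFSmoothOn k X U)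
    (hY : VFSmoothOn k Y U) : VFSmoothOn k (X + Y) U :=
  ContMDiffOn.add_section (V := (TangentSpace (𝓡 (2 * n + 1)) : M → Type _)) hX hY

theorem VFSmoothOn.const_smul {X : VF n M} {U : Set M} {k : WithTop ℕ∞} (hX : VFSmoothOn k X U)
    (a : ℝ) : VFSmoothOn k (a • X) U :=
  ContMDiffOn.const_smul_section (V := (TangentSpace (𝓡 (2 * n + 1)) : M → Type _)) hX

theorem VFSmoothOn.smul_of_tsupport {X : VF n M} {U : Set M} (hX : VFSmoothOn ∞ X U)
    (hU : IsOpen U) {ρ : M → ℝ} (hρ : ContMDiff (𝓡 (2 * n + 1)) 𝓘(ℝ, ℝ) ∞ ρ)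
    (hs : tsupport ρ ⊆ U) : VFSmoothOn ∞ (fun x => ρ x • X x) univ :=
  (ContMDiffOn.smul_section_of_tsupport (V := (TangentSpace (𝓡 (2 * n + 1)) : M → Type _))
    hρ.contMDiffOn hU hs hX).contMDiffOn

theorem VFSmoothOn.of_le {X : VF n M} {U : Set M} {k m : WithTop ℕ∞} (hX : VFSmoothOn k X U)
    (h : m ≤ k) : VFSmoothOn m X U := ContMDiffOn.of_le hX h

theorem VFSmoothOn.mono {X : VF n M} {U V : Set M} {k : WithTop ℕ∞} (hX : VFSmoothOn k X U)
    (h : V ⊆ U) : VFSmoothOn k X V := ContMDiffOn.mono hX h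

theorem VFSmoothOn.zero {U : Set M} {k : WithTop ℕ∞} (hk : k ≤ (∞ : WithTop ℕ∞)) :
    VFSmoothOn k (0 : VF n M) U :=
  ((Bundle.contMDiff_zeroSection (n := (∞ : WithTop ℕ∞)) ℝ
    (TangentSpace (𝓡 (2 * n + 1)) : M → Type _)).contMDiffOn).of_le hk

theorem CVFSmoothOn.zero {U : Set M} : CVFSmoothOn (0 : CVF n M) U := by
  have h1 : (fun x => reT ((0 : CVF n M) x)) = 0 := by ext1 x; simp
  have h2 : (fun x => imT ((0 : CVF n M) x)) = 0 := by ext1 x; simp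
  exact ⟨by rw [h1]; exact VFSmoothOn.zero le_rfl, by rw [h2]; exact VFSmoothOn.zero le_rfl⟩

theorem CVFSmoothOn.add {Z W : CVF n M} {U : Set M} (hZ : CVFSmoothOn Z U)
    (hW : CVFSmoothOn W U) : CVFSmoothOn (Z + W) U := by
  refine ⟨?_, ?_⟩
  · have h := hZ.1.add hW.1
    have h2 : (fun x => reT ((Z + W) x)) = (fun x => reT (Z x)) + fun x => reT (W x) := by
      ext1 x; simp
    rwa [h2]
  · have h := hZ.2.add hW.2
    have h2 : (fun x => imT ((Z + W) x)) = (fun x => imT (Z x)) + fun x => imT (W x) := by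
      ext1 x; simp
    rwa [h2]

theorem CVFSmoothOn.const_smul {Z : CVF n M} {U : Set M} (hZ : CVFSmoothOn Z U) (c : ℂ) :
    CVFSmoothOn (c • Z) U := by
  refine ⟨?_, ?_⟩
  · have h := (hZ.1.const_smul c.re).sub (hZ.2.const_smul c.im)
    have h2 : (fun x => reT ((c • Z) x)) =
        c.re • (fun x => reT (Z x)) - c.im • fun x => imT (Z x) := by
      ext1 x; simp [reT_smul]
    rwa [h2]
  · have h := (hZ.2.const_smul c.re).add (hZ.1.const_smul c.im)
    have h2 : (fun x => imT ((c • Z) x)) =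
        c.re • (fun x => imT (Z x)) + c.im • fun x => reT (Z x) := by
      ext1 x; simp [imT_smul]
    rwa [h2]

theorem CVFSmoothOn.conj {Z : CVF n M} {U : Set M} (hZ : CVFSmoothOn Z U) :
    CVFSmoothOn (fun x => conjT (Z x)) U := by
  refine ⟨by simpa using hZ.1, ?_⟩
  have h := hZ.2.const_smul (-1)
  have h2 : (fun x => imT (conjT (Z x))) = (-1 : ℝ) • fun x => imT (Z x) := by
    ext1 x; simp
  rwa [h2]

theorem CVFSmoothOn.smul_of_tsupport {Z : CVF n M} {U : Set M} (hZ : CVFSmoothOn Z U)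
    (hU : IsOpen U) {ρ : M → ℝ} (hρ : ContMDiff (𝓡 (2 * n + 1)) 𝓘(ℝ, ℝ) ∞ ρ)
    (hs : tsupport ρ ⊆ U) : CVFSmoothOn (fun x => ρ x • Z x) univ := by
  refine ⟨?_, ?_⟩
  · simpa only [map_smul] using hZ.1.smul_of_tsupport hU hρ hs
  · simpa only [map_smul] using hZ.2.smul_of_tsupport hU hρ hs

/-- The Lie derivative as a linear map in the last argument. -/
def lieDL {F : Type*} [NormedAddCommGroup F] [NormedSpace ℝ F] (X : VF n M) (θ : OneForm n M F)
    (x : M) : TS n x →L[ℝ] F :=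
  let c := chartAt (Model n) x
  let D := fderiv ℝ (formIn c θ) (c x)
  let g : TS n x →L[ℝ] F := mfderiv (𝓡 (2 * n + 1)) 𝓘(ℝ, F) (fun y => θ y (X y)) x
  (D (dChart c x (X x))).comp (dChart c x) - (D.flip (dChart c x (X x))).comp (dChart c x) + g

theorem lieD_sub {F : Type*} [NormedAddCommGroup F] [NormedSpace ℝ F]
    {e : OpenPartialHomeomorph M (Model n)} (he : IsSmoothChart e) {θ : OneForm n M F} {U : Set M}
    (hθ : FormSmoothOn θ U) (hU : IsOpen U) {X Y : VF n M} (hX : VFSmoothOn 1 X U)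
    (hY : VFSmoothOn 1 Y U) {x : M} (hxU : x ∈ U) (hx : x ∈ e.source) (v : TS n x) :
    lieD (Y - X) θ x v = lieD Y θ x v - lieD X θ x v := by
  have h : vfIn e (Y - X) = vfIn e Y - vfIn e X := by
    ext1 y; simp [vfIn]
  have h1 := (vfIn_contDiffAt he one_add_one_le_infty hX hU hxU hx).differentiableAt (by simp)
  have h2 := (vfIn_contDiffAt he one_add_one_le_infty hY hU hxU hx).differentiableAt (by simp)
  rw [lieD_eq he hθ hU hX hxU hx, lieD_eq he hθ hU hY hxU hx, lieD_eq he hθ hU (hY.sub hX) hxU hx,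
    h, fderiv_sub h2 h1]
  simp
  abel

theorem reT_cBracket (W : CVF n M) (X : VF n M) (x : M) :
    reT (cBracket W (toC X) x) =
      VectorField.mlieBracket (𝓡 (2 * n + 1)) (fun y => reT (W y)) X x := by
  have h : ∀ V : VF n M, VectorField.mlieBracket (𝓡 (2 * n + 1)) V (fun _ => 0) x = 0 :=
    fun V => congrFun VectorField.mlieBracket_zero_right x
  simp [cBracket, toC, h]

theorem imT_cBracket (W : CVF n M) (X : VF n M) (x : M) :
    imT (cBracket W (toC X) x) =
      VectorField.mlieBracket (𝓡 (2 * n + 1)) (fun y => imT (W y)) X x := by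
  have h : ∀ V : VF n M, VectorField.mlieBracket (𝓡 (2 * n + 1)) V (fun _ => 0) x = 0 :=
    fun V => congrFun VectorField.mlieBracket_zero_right x
  simp [cBracket, toC, h]

/-- Cartan's formula for a complex vector field annihilated by the form. -/
theorem cEval_lieD_of_annihilated {e : OpenPartialHomeomorph M (Model n)} (he : IsSmoothChart e)
    {θ : OneForm n M ℂ} {U : Set M} (hθ : FormSmoothOn θ U) (hU : IsOpen U) {X : VF n M}
    (hX : VFSmoothOn 1 X U) {W : CVF n M} (hW : CVFSmoothOn W U)
    (h0 : ∀ y ∈ U, cEval (θ y) (W y) = 0) {x : M} (hxU : x ∈ U) (hx : x ∈ e.source) :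
    cEval (lieD X θ x) (W x) = cEval (θ x) (cBracket W (toC X) x) := by
  have hone : (1 : WithTop ℕ∞) ≤ (∞ : WithTop ℕ∞) := by simp
  have h1 : DifferentiableAt ℝ (formIn e θ) (e x) :=
    (formIn_contDiffAt he hθ hxU hx).differentiableAt (by simp)
  have hr := hW.1.of_le hone
  have hi := hW.2.of_le hone
  have h2 := (vfIn_contDiffAt he one_add_one_le_infty hr hU hxU hx).differentiableAt (by simp)
  have h3 := (vfIn_contDiffAt he one_add_one_le_infty hi hU hxU hx).differentiableAt (by simp)
  have hd1 := h1.clm_apply h2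
  have hd2 := h1.clm_apply h3
  have hz : (fun y => formIn e θ y (vfIn e (fun z => reT (W z)) y) +
      Complex.I * formIn e θ y (vfIn e (fun z => imT (W z)) y)) =ᶠ[𝓝 (e x)] fun _ => 0 := by
    have hUe : e.target ∩ e.symm ⁻¹' U ∈ 𝓝 (e x) :=
      (e.symm.isOpen_inter_preimage hU).mem_nhds
        ⟨e.map_source hx, by simpa [e.left_inv hx] using hxU⟩
    filter_upwards [hUe] with y hy
    have ha := formIn_apply he θ (e.map_target hy.1) (reT (W (e.symm y)))
    have hb := formIn_apply he θ (e.map_target hy.1) (imT (W (e.symm y)))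
    rw [e.right_inv hy.1] at ha hb
    have := h0 _ hy.2
    unfold cEval at this
    rw [← ha, ← hb] at this
    exact this
  -- The complex function θ(W) vanishes near the point, so the two derivative terms left by Cartan's
  -- formula for Re W and Im W cancel in the combination defining `cEval`.
  have hz' := hz.fderiv_eq (𝕜 := ℝ)
  rw [fderiv_fun_add hd1 (hd2.const_mul _), fderiv_const_mul hd2] at hz'
  have hz2 := congrArg (fun L : Model n →L[ℝ] ℂ => L (vfIn e X (e x))) hz'
  simp at hz2
  unfold cEval
  rw [reT_cBracket, imT_cBracket, lieD_apply_vf he hθ hU hX hr hxU hx,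
    lieD_apply_vf he hθ hU hX hi hxU hx]
  linear_combination hz2

end Sections

namespace AdaptedAtlas

variable {n : ℕ} {M : Type*} [TopologicalSpace M] [ChartedSpace (Model n) M]
  [IsManifold (𝓡 (2 * n + 1)) ∞ M]
  {C : CRStructure n M} {ι : Type*} [Fintype ι] (A : AdaptedAtlas C ι)

theorem mem_source_of_mem_V {l : ι} {x : M} (hx : x ∈ A.V l) : x ∈ (A.chart l).source :=
  A.V_sub l (subset_closure hx)

theorem mem_V_of_ρ_ne_zero {l : ι} {x : M} (hx : A.ρ l x ≠ 0) : x ∈ A.V l :=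
  A.ρ_supp l (subset_tsupport _ hx)

theorem exists_ρ_ne_zero (x : M) : ∃ l, A.ρ l x ≠ 0 := by
  by_contra! h
  have := A.ρ_sum x
  simp [h] at this

/-- The operator ∂̄_b is tested on global smooth sections only. Cutting off the local frame with ρ_l
shows that such sections attain every value at a point, so pointwise information can be extracted.
-/
theorem exists_antiholSection (A : AdaptedAtlas C ι) (x : M) (z : C.antihol x) :
    ∃ W : CVF n M, C.IsAntiholSection W ∧ W x = z := by
  obtain ⟨l, hl⟩ := A.exists_ρ_ne_zero x
  have hx := A.mem_source_of_mem_V (A.mem_V_of_ρ_ne_zero hl)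
  have hs : ∀ β, C.IsAntiholSection (fun y => A.ρ l y • A.Zbar l β y) := fun β => by
    refine ⟨(A.Z_smooth l β).conj.smul_of_tsupport (A.chart l).open_source (A.ρ_smooth l)
      ((A.ρ_supp l).trans fun y hy => A.mem_source_of_mem_V hy), fun y => ?_⟩
    by_cases hy : A.ρ l y = 0
    · simp [hy]
    · exact Submodule.smul_of_tower_mem _ _
        (A.Zbar_mem (A.mem_source_of_mem_V (A.mem_V_of_ρ_ne_zero hy)) β)
  have hadd : ∀ (s : Finset (Fin n)) (c : Fin n → ℂ),
      C.IsAntiholSection (∑ β ∈ s, c β • fun y => A.ρ l y • A.Zbar l β y) := by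
    intro s c
    induction s using Finset.induction_on with
    | empty => exact ⟨by simpa using CVFSmoothOn.zero, fun y => by simp⟩
    | insert a s ha ih =>
      rw [Finset.sum_insert ha]
      exact ⟨((hs a).1.const_smul _).add ih.1,
        fun y => Submodule.add_mem _ (Submodule.smul_mem _ _ ((hs a).2 y)) (ih.2 y)⟩
  -- The coefficients are divided by ρ_l(x) to undo the cut-off at the point x.
  refine ⟨_, hadd Finset.univ (fun β => A.evBar l β x (z : CT n x) * (A.ρ l x : ℂ)⁻¹), ?_⟩
  have hl' : (A.ρ l x : ℂ) ≠ 0 := by exact_mod_cast hl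
  conv_rhs => rw [A.antihol_eq_sum hx z.2]
  rw [Finset.sum_apply]
  refine Finset.sum_congr rfl fun β _ => ?_
  have h1 : A.ρ l x • A.Zbar l β x = (A.ρ l x : ℂ) • A.Zbar l β x :=
    (algebraMap_smul ℂ (A.ρ l x) (A.Zbar l β x)).symm
  rw [Pi.smul_apply, h1, smul_smul, mul_assoc, inv_mul_cancel₀ hl', mul_one]

/-! ### The linearized action -/

variable {X : VF n M} {l : ι} {x : M}

theorem η_cast_smooth : FormSmoothOn (fun x => Complex.ofRealCLM.comp (C.η x)) univ := by
  intro x _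
  have h := C.η_smooth x (mem_univ x)
  exact (contDiffAt_const (c := Complex.ofRealCLM)).clm_comp h

theorem lieD_ofReal (hX : VFSmoothOn 1 X univ) (v : TS n x) :
    lieD X (fun x => Complex.ofRealCLM.comp (C.η x)) x v = ((lieD X C.η x v : ℝ) : ℂ) := by
  have he := isSmoothChart_chartAt (n := n) x
  have hx := mem_chart_source (Model n) x
  have h1 : DifferentiableAt ℝ (formIn (chartAt (Model n) x) C.η) (chartAt (Model n) x x) :=
    (formIn_contDiffAt he C.η_smooth (mem_univ _) hx).differentiableAt (by simp)
  have h2 : formIn (chartAt (Model n) x) (fun x => Complex.ofRealCLM.comp (C.η x)) =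
      fun y => Complex.ofRealCLM.comp (formIn (chartAt (Model n) x) C.η y) := rfl
  rw [lieD_eq he η_cast_smooth isOpen_univ hX (mem_univ x) hx,
    lieD_eq he C.η_smooth isOpen_univ hX (mem_univ x) hx, h2,
    fderiv_clm_comp (differentiableAt_const _) h1]
  simp

/-- For W in H_(0,1), η([W, X]) = (L_X η)(W), which vanishes because X is contact. This is the
reason why ∂̄_b X takes values in H_ℂ/H_(0,1) and can be read as a deformation tensor. -/
theorem evη_cBracket (hX : VFSmoothOn 1 X univ) (hc : C.IsContactVF X) {W : CVF n M}
    (hW : C.IsAntiholSection W) (x : M) : evη C x (cBracket W (toC X) x) = 0 := by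
  have h0 : ∀ y, evη C y (W y) = 0 := fun y =>
    (mem_H_iff (W y)).1 (Submodule.mem_sup_right (hW.2 y))
  have h := cEval_lieD_of_annihilated (isSmoothChart_chartAt (n := n) x) (η_cast_smooth (C := C))
    isOpen_univ hX hW.1 (fun y _ => h0 y) (mem_univ x) (mem_chart_source (Model n) x)
  have h2 : evη C x (cBracket W (toC X) x) =
    cEval (lieD X (fun x => Complex.ofRealCLM.comp (C.η x)) x) (W x) := h.symm
  obtain ⟨h3, h4⟩ := (cEval_real_eq_zero (C.η x) (W x)).1 (h0 x)
  rw [h2, cEval, lieD_ofReal hX, lieD_ofReal hX, hc x _ h3, hc x _ h4]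
  simp

theorem ev_cBracket (hX : VFSmoothOn 1 X univ) {W : CVF n M}
    (hW : C.IsAntiholSection W) (hx : x ∈ (A.chart l).source) (α : Fin n) :
    A.ev l α x (cBracket W (toC X) x) = cEval (lieD X (A.θ l α) x) (W x) :=
  (cEval_lieD_of_annihilated (A.chart_mem l) (A.θ_smooth l α) (A.chart l).open_source
    (hX.mono (subset_univ _)) ⟨hW.1.1.mono (subset_univ _), hW.1.2.mono (subset_univ _)⟩
    (fun _ hy => ((A.mem_antihol_iff hy _).1 (hW.2 _)).2 α) hx hx).symm

theorem cEval_lieD_antihol (hx : x ∈ (A.chart l).source) (θ : OneForm n M ℂ) {z : CT n x}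
    (hz : z ∈ C.antihol x) : cEval (lieD X θ x) z =
      ∑ β, cEval (lieD X θ x) (A.Zbar l β x) * A.evBar l β x z := by
  have h : ∀ w, cEval (lieD X θ x) w = cEvalL (lieDL X θ x).toLinearMap w := fun _ => rfl
  rw [h]
  conv_lhs => rw [A.antihol_eq_sum hx hz]
  simp only [map_sum, map_smul, smul_eq_mul, h]
  exact Finset.sum_congr rfl fun β _ => mul_comm _ _

/-- On H_ℂ the class modulo H_(0,1) is determined by the n numbers θ^α, since H_(0,1) is the joint
kernel of η and the θ^α. -/
theorem mkQ_eq_add_iff (hx : x ∈ (A.chart l).source) {a b c : CT n x} (ha : evη C x a = 0)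
    (hb : evη C x b = 0) (hc : evη C x c = 0) :
    (C.antihol x).mkQ a = (C.antihol x).mkQ b + (C.antihol x).mkQ c ↔
      ∀ α, A.ev l α x a = A.ev l α x b + A.ev l α x c := by
  rw [← map_add, ← sub_eq_zero, ← map_sub, Submodule.mkQ_apply,
    Submodule.Quotient.mk_eq_zero, A.mem_antihol_iff hx]
  simp only [map_sub, map_add, ha, hb, hc, sub_eq_zero, add_zero, true_and]

theorem evη_deform (φ : C.Deform) (z : C.antihol x) : evη C x (φ x z : CT n x) = 0 :=
  (mem_H_iff _).1 (Submodule.mem_sup_left (φ x z).2)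

theorem isLinearized_at_iff (hX : VFSmoothOn 1 X univ) (hc : C.IsContactVF X) (ψ ν : C.Deform)
    {W : CVF n M} (hW : C.IsAntiholSection W) (hx : x ∈ (A.chart l).source) :
    (C.antihol x).mkQ (ν x ⟨W x, hW.2 x⟩ : CT n x) =
        C.dbarb X W x + (C.antihol x).mkQ (ψ x ⟨W x, hW.2 x⟩ : CT n x) ↔
      ∀ α, ∑ β, A.coef ν l α β x * A.evBar l β x (W x) = ∑ β,
        (cEval (lieD X (A.θ l α) x) (A.Zbar l β x) + A.coef ψ l α β x) *
          A.evBar l β x (W x) := by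
  refine (A.mkQ_eq_add_iff hx (evη_deform ν _) (evη_cBracket hX hc hW x)
    (evη_deform ψ _)).trans (forall_congr' fun α => ?_)
  rw [A.ev_deform ν hx, A.ev_cBracket hX hW hx, A.ev_deform ψ hx,
    A.cEval_lieD_antihol hx _ (hW.2 x), ← Finset.sum_add_distrib]
  simp only [add_mul]

/-- In an adapted frame ∂̄_b X has the components (L_X θ^α)(Z_β̄); a test section can be chosen to
equal Z_β̄ at a prescribed point. -/
theorem isLinearized_iff (hX : VFSmoothOn 1 X univ) (hc : C.IsContactVF X) (ψ ν : C.Deform) :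
    C.IsLinearized X ψ ν ↔ ∀ l, ∀ x ∈ (A.chart l).source, ∀ α β, A.coef ν l α β x =
      cEval (lieD X (A.θ l α) x) (A.Zbar l β x) + A.coef ψ l α β x := by
  constructor
  · intro h l x hx α β
    obtain ⟨W, hW, hWx⟩ := A.exists_antiholSection x ⟨A.Zbar l β x, A.Zbar_mem hx β⟩
    have := (A.isLinearized_at_iff hX hc ψ ν hW hx).1 (h W hW x) α
    simpa [hWx, A.evBar_Zbar hx] using this
  · intro h W hW x
    obtain ⟨l, hl⟩ := A.exists_ρ_ne_zero x
    have hx := A.mem_source_of_mem_V (A.mem_V_of_ρ_ne_zero hl)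
    refine (A.isLinearized_at_iff hX hc ψ ν hW hx).2 fun α => ?_
    simp only [h l x hx]

/-- A chart index whose partition function does not vanish at the point. -/
def idx (x : M) : ι := (A.exists_ρ_ne_zero x).choose

theorem idx_mem_V (x : M) : x ∈ A.V (A.idx x) :=
  A.mem_V_of_ρ_ne_zero (A.exists_ρ_ne_zero x).choose_spec

theorem idx_mem (x : M) : x ∈ (A.chart (A.idx x)).source := A.mem_source_of_mem_V (A.idx_mem_V x)

theorem existsUnique_isLinearized (A : AdaptedAtlas C ι) (hX : VFSmoothOn 1 X univ) (hc : C.IsContactVF X)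
    (ψ : C.Deform) : ∃! ν : C.Deform, C.IsLinearized X ψ ν := by
  -- Deformation tensors carry no regularity and the defining equation is pointwise, so the
  -- components may be prescribed with one index per point, with no compatibility to check.
  let c : ∀ _ : M, Matrix (Fin n) (Fin n) ℂ := fun x => Matrix.of fun α β =>
    cEval (lieD X (A.θ (A.idx x) α) x) (A.Zbar (A.idx x) β x) + A.coef ψ (A.idx x) α β x
  refine ⟨A.ofCoef A.idx A.idx_mem c, ?_, ?_⟩
  · intro W hW x
    refine (A.isLinearized_at_iff hX hc ψ _ hW (A.idx_mem x)).2 fun α =>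
      Finset.sum_congr rfl fun β _ => ?_
    rw [A.coef_ofCoef A.idx A.idx_mem _ x α β]
    rfl
  · intro ν' hν'
    funext x
    refine A.deform_ext _ _ (A.idx_mem x) fun α β => ?_
    rw [(A.isLinearized_iff hX hc ψ ν').1 hν' _ x (A.idx_mem x) α β]
    exact (A.coef_ofCoef A.idx A.idx_mem c x α β).symm

end AdaptedAtlas

end CRDef

end

open scoped Manifold ContDiff TensorProduct ENNReal Topology
noncomputable section
namespace CRDef
open Set Filter
set_option linter.unusedSectionVars false

namespace AdaptedAtlas

variable {n : ℕ} {M : Type*} [TopologicalSpace M] [ChartedSpace (Model n) M]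
  [IsManifold (𝓡 (2 * n + 1)) ∞ M]
  {C : CRStructure n M} {ι : Type*} [Fintype ι] (A : AdaptedAtlas C ι)
  {F : M → M} {φ μ : C.Deform} {l : ι} {x : M}

/-! ### The action of contact maps on deformation tensors -/

/-- The form `F^* θ^α + (φ^α_γ̄ ∘ F) F^* θ^γ̄`. -/
def pulled (F : M → M) (φ : C.Deform) (l : ι) (α : Fin n) (x : M) : CT n x →ₗ[ℂ] ℂ :=
  (A.ev l α (F x)).comp (pushC F x) +
    ∑ γ, A.coef φ l α γ (F x) • (A.evBar l γ (F x)).comp (pushC F x)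

/-- The values of `F^* θ^α + (φ^α_γ̄ ∘ F) F^* θ^γ̄` on the frame of `H_(1,0)`. -/
def pullA (F : M → M) (φ : C.Deform) (l : ι) (x : M) : Matrix (Fin n) (Fin n) ℂ :=
  Matrix.of fun α β => A.pulled F φ l α x (A.Z l β x)

/-- The values of `F^* θ^α + (φ^α_γ̄ ∘ F) F^* θ^γ̄` on the frame of `H_(0,1)`. -/
def pullB (F : M → M) (φ : C.Deform) (l : ι) (x : M) : Matrix (Fin n) (Fin n) ℂ :=
  Matrix.of fun α β => A.pulled F φ l α x (A.Zbar l β x)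

theorem cEval_pulledForm (Ψ : VF n M → VF n M) (X : VF n M) (φ : C.Deform) (l : ι) (α : Fin n)
    (x : M) (z : CT n x) : cEval (A.pulledForm Ψ X X φ l α x) z =
      A.pulled (C.flowExp (Ψ X)) φ l α x z := by
  simp only [pulled, LinearMap.add_apply, LinearMap.comp_apply, LinearMap.sum_apply,
    LinearMap.smul_apply, smul_eq_mul]
  have h1 : A.ev l α (C.flowExp (Ψ X) x) (pushC (C.flowExp (Ψ X)) x z) =
      cEval (pullForm (C.flowExp (Ψ X)) (A.θ l α) x) z := (cEval_pullForm _ _ z).symm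
  have h2 : ∀ γ, A.evBar l γ (C.flowExp (Ψ X) x) (pushC (C.flowExp (Ψ X)) x z) =
      cEval (pullForm (C.flowExp (Ψ X)) (conjForm (A.θ l γ)) x) z :=
    fun γ => (cEval_pullForm _ _ z).symm
  rw [h1]
  simp only [h2]
  simp only [cEval, pulledForm, coefComp, mul_add, Finset.sum_add_distrib, Finset.mul_sum]
  have h3 : ∀ γ, Complex.I * (A.coef φ l α γ (C.flowExp (Ψ X) x) *
      pullForm (C.flowExp (Ψ X)) (conjForm (A.θ l γ)) x (imT z)) =
      A.coef φ l α γ (C.flowExp (Ψ X) x) * (Complex.I *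
        pullForm (C.flowExp (Ψ X)) (conjForm (A.θ l γ)) x (imT z)) := fun γ => by ring
  simp only [h3]
  ring

theorem matA_eq (Ψ : VF n M → VF n M) (X : VF n M) (φ : C.Deform) (l : ι) (x : M) :
    A.matA Ψ X X φ l x = A.pullA (C.flowExp (Ψ X)) φ l x := by
  ext α β; exact A.cEval_pulledForm Ψ X φ l α x _

theorem matB_eq (Ψ : VF n M → VF n M) (X : VF n M) (φ : C.Deform) (l : ι) (x : M) :
    A.matB Ψ X X φ l x = A.pullB (C.flowExp (Ψ X)) φ l x := by
  ext α β; exact A.cEval_pulledForm Ψ X φ l α x _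

/-- The map preserves the contact distribution. -/
def PreservesContact (C : CRStructure n M) (F : M → M) : Prop :=
  ∀ x (v : TS n x), C.η x v = 0 → pullForm F C.η x v = 0

theorem evη_pushC (hF : PreservesContact C F) {z : CT n x} (hz : evη C x z = 0) :
    evη C (F x) (pushC F x z) = 0 := by
  obtain ⟨h1, h2⟩ := (cEval_real_eq_zero (C.η x) z).1 hz
  refine (cEval_real_eq_zero (C.η (F x)) _).2 ?_
  rw [reT_pushC, imT_pushC]
  exact ⟨hF x _ h1, hF x _ h2⟩

theorem pushC_mem_deformed_iff (hF : PreservesContact C F) (hFx : F x ∈ (A.chart l).source)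
    {z : CT n x} (hz : evη C x z = 0) :
    pushC F x z ∈ CRStructure.deformed φ (F x) ↔ ∀ α, A.pulled F φ l α x z = 0 := by
  rw [A.mem_deformed_iff φ hFx]
  simp only [evη_pushC hF hz, true_and]
  simp [pulled]

theorem pulled_eq_mulVec (hx : x ∈ (A.chart l).source) {z : CT n x} (hz : evη C x z = 0)
    (α : Fin n) : A.pulled F φ l α x z =
      ((A.pullA F φ l x).mulVec (fun β => A.ev l β x z) +
        (A.pullB F φ l x).mulVec fun β => A.evBar l β x z) α := by
  conv_lhs => rw [A.H_eq_sum hx hz]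
  simp only [map_add, map_sum, map_smul, smul_eq_mul, Pi.add_apply, Matrix.mulVec, dotProduct,
    pullA, pullB, Matrix.of_apply]
  congr 1 <;> exact Finset.sum_congr rfl fun _ _ => mul_comm _ _

theorem mem_deformed_iff_mulVec (hx : x ∈ (A.chart l).source) (w : CT n x) :
    w ∈ CRStructure.deformed μ x ↔ evη C x w = 0 ∧
      (fun β => A.ev l β x w) + (A.coefMat μ l x).mulVec (fun β => A.evBar l β x w) = 0 := by
  rw [A.mem_deformed_iff μ hx, funext_iff]
  rfl

/-- The kernel of A consists of the components of the vectors of H_(1,0) that are pushed into the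
deformed bundle. The right-hand side mentions no frame, so invertibility can be proved in one chart
and used in another. -/
theorem isUnit_pullA_iff (hF : PreservesContact C F) (hx : x ∈ (A.chart l).source)
    (hFx : F x ∈ (A.chart l).source) : IsUnit (A.pullA F φ l x).det ↔
      ∀ z ∈ C.hol x, pushC F x z ∈ CRStructure.deformed φ (F x) → z = 0 := by
  have key : ∀ z ∈ C.hol x, pushC F x z ∈ CRStructure.deformed φ (F x) ↔
      (A.pullA F φ l x).mulVec (fun β => A.ev l β x z) = 0 := by
    intro z hz
    obtain ⟨h1, h2⟩ := (A.mem_hol_iff hx z).1 hz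
    rw [A.pushC_mem_deformed_iff hF hFx h1, funext_iff]
    refine forall_congr' fun α => ?_
    rw [A.pulled_eq_mulVec hx h1]
    have : (fun β => A.evBar l β x z) = 0 := funext h2
    simp [this]
  rw [isUnit_iff_ne_zero, ← not_iff_not, not_not, ← Matrix.exists_mulVec_eq_zero_iff]
  push Not
  constructor
  · rintro ⟨v, hv, hv0⟩
    have hz : ∑ β, v β • A.Z l β x ∈ C.hol x :=
      Submodule.sum_mem _ fun β _ => Submodule.smul_mem _ _ (A.Z_mem_hol hx β)
    have hev : (fun β => A.ev l β x (∑ γ, v γ • A.Z l γ x)) = v := by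
      ext β; simp [A.ev_Z hx]
    refine ⟨_, hz, (key _ hz).2 (by rw [hev, hv0]), fun h0 => hv ?_⟩
    rw [← hev, h0]
    ext β; simp
  · rintro ⟨z, hz, h1, h2⟩
    refine ⟨_, fun h0 => h2 ?_, (key z hz).1 h1⟩
    rw [A.hol_eq_sum hx hz]
    simp [funext_iff.1 h0]

/-- Multiplication by A⁻¹ turns Aa + Bb = 0 into a + A⁻¹B b = 0, and the bundle of μ is given by the
same equation with the matrix of μ in place of A⁻¹B. -/
theorem pullback_at_iff (hF : PreservesContact C F) (hx : x ∈ (A.chart l).source)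
    (hFx : F x ∈ (A.chart l).source) (hA : IsUnit (A.pullA F φ l x).det) :
    {z : CT n x | z ∈ C.hol x ⊔ C.antihol x ∧ pushC F x z ∈ CRStructure.deformed φ (F x)} =
      CRStructure.deformed μ x ↔
      A.coefMat μ l x = (A.pullA F φ l x)⁻¹ * A.pullB F φ l x := by
  have h1 : ∀ z, z ∈ C.hol x ⊔ C.antihol x ∧ pushC F x z ∈ CRStructure.deformed φ (F x) ↔
      evη C x z = 0 ∧ (fun β => A.ev l β x z) +
        ((A.pullA F φ l x)⁻¹ * A.pullB F φ l x).mulVec (fun β => A.evBar l β x z) = 0 := by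
    intro z
    rw [mem_H_iff]
    refine and_congr_right fun hz => ?_
    rw [A.pushC_mem_deformed_iff hF hFx hz]
    have h2 : (∀ α, A.pulled F φ l α x z = 0) ↔
        (A.pullA F φ l x).mulVec (fun β => A.ev l β x z) +
        (A.pullB F φ l x).mulVec (fun β => A.evBar l β x z) = 0 := by
      rw [funext_iff]
      exact forall_congr' fun α => by rw [A.pulled_eq_mulVec hx hz]; rfl
    rw [h2]
    constructor
    · intro h
      have := congrArg ((A.pullA F φ l x)⁻¹).mulVec h
      rwa [Matrix.mulVec_add, Matrix.mulVec_mulVec, Matrix.mulVec_mulVec,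
        Matrix.nonsing_inv_mul _ hA, Matrix.one_mulVec, Matrix.mulVec_zero] at this
    · intro h
      have := congrArg (A.pullA F φ l x).mulVec h
      rwa [Matrix.mulVec_add, Matrix.mulVec_mulVec, ← Matrix.mul_assoc,
        Matrix.mul_nonsing_inv _ hA, Matrix.one_mul, Matrix.mulVec_zero] at this
  constructor
  · intro h
    ext α β
    -- The vector Z_β̄ − μ(Z_β̄) lies in both bundles and its barred components form the β-th unit
    -- vector, so comparing the two equations reads off column β.
    have hmem : A.Zbar l β x - (μ x ⟨_, A.Zbar_mem hx β⟩ : CT n x) ∈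
        CRStructure.deformed μ x := ⟨⟨_, A.Zbar_mem hx β⟩, rfl⟩
    have h3 := ((h1 _).1 (h ▸ hmem)).2
    have h4 := ((A.mem_deformed_iff_mulVec hx _).1 hmem).2
    have h5 : (fun γ => A.evBar l γ x (A.Zbar l β x - (μ x ⟨_, A.Zbar_mem hx β⟩ : CT n x))) =
        Pi.single β 1 := by
      ext γ
      have := ((A.mem_hol_iff hx _).1 (μ x ⟨_, A.Zbar_mem hx β⟩).2).2 γ
      simp [A.evBar_Zbar hx, this, Pi.single_apply]
    rw [h5] at h3 h4
    have h6 := congrFun (add_left_cancel (h4.trans h3.symm)) α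
    simpa using h6
  · intro h
    ext z
    rw [mem_ofPred_eq, h1 z, A.mem_deformed_iff_mulVec hx, h]

theorem coefMat_of_isPullback (hF : PreservesContact C F) (hx : x ∈ (A.chart l).source)
    (hFx : F x ∈ (A.chart l).source) (hA : IsUnit (A.pullA F φ l x).det)
    (h : CRStructure.IsPullback F φ μ) :
    A.coefMat μ l x = (A.pullA F φ l x)⁻¹ * A.pullB F φ l x :=
  (A.pullback_at_iff hF hx hFx hA).1 (h x)

theorem existsUnique_isPullback (A : AdaptedAtlas C ι) (hF : PreservesContact C F) (k : M → ι)
    (hk : ∀ x, x ∈ (A.chart (k x)).source ∧ F x ∈ (A.chart (k x)).source ∧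
      IsUnit (A.pullA F φ (k x) x).det) : ∃! μ : C.Deform, CRStructure.IsPullback F φ μ := by
  have hk1 := fun x => (hk x).1
  refine ⟨A.ofCoef k hk1 fun x => (A.pullA F φ (k x) x)⁻¹ * A.pullB F φ (k x) x, ?_, ?_⟩
  · intro x
    refine (A.pullback_at_iff hF (hk x).1 (hk x).2.1 (hk x).2.2).2 ?_
    ext α β
    exact A.coef_ofCoef k hk1 _ x α β
  · intro μ hμ
    funext x
    refine A.deform_ext _ _ (hk x).1 fun α β => ?_
    rw [A.coef_ofCoef k hk1 _ x α β,
      ← A.coefMat_of_isPullback hF (hk x).1 (hk x).2.1 (hk x).2.2 hμ]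
    rfl

/-! ### The formula for the action -/

/-- A⁻¹B = B + A⁻¹(I − A)B. The second term is part of E; the first, on removing L_X θ^α and φ ∘ F,
leaves exactly the value of Q^α on Z_β̄. -/
theorem inv_mul_pullB (Ψ : VF n M → VF n M) {X : VF n M} (hX : VFSmoothOn 1 X univ)
    (hΨX : VFSmoothOn 1 (Ψ X) univ) (φ : C.Deform) (hx : x ∈ (A.chart l).source)
    (hA : IsUnit (A.pullA (C.flowExp (Ψ X)) φ l x).det) (α β : Fin n) :
    ((A.pullA (C.flowExp (Ψ X)) φ l x)⁻¹ * A.pullB (C.flowExp (Ψ X)) φ l x) α β =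
      cEval (lieD X (A.θ l α) x) (A.Zbar l β x) + A.coefComp Ψ X φ l α β x
        + A.coefE Ψ X X φ l α β x := by
  -- The Lie derivatives along Ψ(X) cancel: those in `quadPart` are subtracted, those in the first
  -- two terms of Q^α are added. Only −L_X θ^α survives.
  have h1 : ∀ v, A.quadForm Ψ X X φ l α x v = A.pulledForm Ψ X X φ l α x v - A.θ l α x v
      - ∑ γ, A.coefComp Ψ X φ l α γ x * conjForm (A.θ l γ) x v - lieD X (A.θ l α) x v := by
    intro v
    have hsub := lieD_sub (A.chart_mem l) (A.θ_smooth l α) (A.chart l).open_source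
      (hX.mono (subset_univ _)) (hΨX.mono (subset_univ _)) hx hx v
    simp only [quadForm, pulledForm, quadPart, hsub, mul_sub, Finset.sum_sub_distrib]
    ring
  have h2 : cEval (A.quadForm Ψ X X φ l α x) (A.Zbar l β x) =
      cEval (A.pulledForm Ψ X X φ l α x) (A.Zbar l β x) - A.ev l α x (A.Zbar l β x)
      - ∑ γ, A.coefComp Ψ X φ l α γ x * A.evBar l γ x (A.Zbar l β x)
      - cEval (lieD X (A.θ l α) x) (A.Zbar l β x) := by
    have h3 : ∀ γ, A.evBar l γ x (A.Zbar l β x) =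
      conjForm (A.θ l γ) x (reT (A.Zbar l β x)) +
        Complex.I * conjForm (A.θ l γ) x (imT (A.Zbar l β x)) := fun γ => rfl
    have h4 : A.ev l α x (A.Zbar l β x) =
      A.θ l α x (reT (A.Zbar l β x)) + Complex.I * A.θ l α x (imT (A.Zbar l β x)) := rfl
    rw [h4]
    simp only [h3, cEval, h1, mul_add, Finset.sum_add_distrib, mul_sub, Finset.mul_sum]
    have h5 : ∀ γ, Complex.I * (A.coefComp Ψ X φ l α γ x *
        conjForm (A.θ l γ) x (imT (A.Zbar l β x))) = A.coefComp Ψ X φ l α γ x *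
          (Complex.I * conjForm (A.θ l γ) x (imT (A.Zbar l β x))) := fun γ => by ring
    simp only [h5]
    ring
  have h6 : ∑ γ, A.coefComp Ψ X φ l α γ x * A.evBar l γ x (A.Zbar l β x) =
      A.coefComp Ψ X φ l α β x := by simp [A.evBar_Zbar hx]
  have h7 : cEval (A.pulledForm Ψ X X φ l α x) (A.Zbar l β x) =
      A.pullB (C.flowExp (Ψ X)) φ l x α β := A.cEval_pulledForm Ψ X φ l α x _
  rw [coefE, h2, h6, h7, A.matA_eq, A.matB_eq, A.ev_Zbar hx, Matrix.mul_sub, Matrix.mul_one,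
    Matrix.nonsing_inv_mul _ hA, Matrix.sub_mul, Matrix.one_mul, Matrix.sub_apply]
  ring

/-- The local summand of the tensor `φ ∘ F + E`. -/
def localTensor (Ψ : VF n M → VF n M) (X : VF n M) (φ : C.Deform) (l : ι) (x : M) (z : CT n x) :
    CT n x :=
  ∑ α, ∑ β, ((A.coefComp Ψ X φ l α β x + A.coefE Ψ X X φ l α β x) * A.evBar l β x z) • A.Z l α x

theorem compTensor_add_tensorE (Ψ : VF n M → VF n M) (X : VF n M) (φ : C.Deform) (x : M)
    (z : CT n x) : A.compTensor Ψ X φ x z + A.tensorE Ψ X X φ x z =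
      ∑ l, (A.ρ l x : ℂ) • A.localTensor Ψ X φ l x z := by
  rw [compTensor, tensorE, assemble, assemble, ← Finset.sum_add_distrib]
  refine Finset.sum_congr rfl fun l _ => ?_
  rw [← smul_add, ← Finset.sum_add_distrib]
  congr 1
  refine Finset.sum_congr rfl fun α _ => ?_
  rw [← Finset.sum_add_distrib]
  refine Finset.sum_congr rfl fun β _ => ?_
  rw [← add_smul, ← add_mul]
  rfl

theorem localTensor_mem_hol (Ψ : VF n M → VF n M) (X : VF n M) (φ : C.Deform)
    (hx : x ∈ (A.chart l).source) (z : CT n x) : A.localTensor Ψ X φ l x z ∈ C.hol x :=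
  Submodule.sum_mem _ fun α _ => Submodule.sum_mem _ fun _ _ =>
    Submodule.smul_mem _ _ (A.Z_mem_hol hx α)

theorem ev_localTensor (Ψ : VF n M → VF n M) (X : VF n M) (φ : C.Deform)
    (hx : x ∈ (A.chart l).source) (z : CT n x) (α : Fin n) :
    A.ev l α x (A.localTensor Ψ X φ l x z) =
      ∑ β, (A.coefComp Ψ X φ l α β x + A.coefE Ψ X X φ l α β x) * A.evBar l β x z := by
  simp only [localTensor, map_sum, map_smul, smul_eq_mul, A.ev_Z hx]
  rw [Finset.sum_eq_single α] <;> simp +contextual [eq_comm]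

/-- Since the weights sum to one, m − ∑ρ_l T_l is the weighted sum of the differences m − T_l; terms
of weight zero may be arbitrary. -/
theorem sub_sum_ρ_mem {S : Submodule ℂ (CT n x)} {m : CT n x} {T : ι → CT n x}
    (h : ∀ l, A.ρ l x ≠ 0 → m - T l ∈ S) : m - ∑ l, (A.ρ l x : ℂ) • T l ∈ S := by
  have hρ : ∑ l, (A.ρ l x : ℂ) = 1 := by exact_mod_cast A.ρ_sum x
  have hmem : ∀ l ∈ Finset.univ, (A.ρ l x : ℂ) • (m - T l) ∈ S := by
    intro l _
    by_cases hl : A.ρ l x = 0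
    · simp [hl]
    · exact Submodule.smul_mem _ _ (h l hl)
  have h := Submodule.sum_mem S hmem
  simpa only [smul_sub, Finset.sum_sub_distrib, ← Finset.sum_smul, hρ, one_smul] using h

/-- Wherever ρ_l ≠ 0, μ(W) − [W, X] and the l-th summand of φ ∘ F + E agree modulo H_(0,1), by
comparing η and the θ^α. Averaging these memberships in H_(0,1) with the weights ρ_l gives the
global formula. -/
theorem pullback_formula (Ψ : VF n M → VF n M) {X : VF n M} (hX : VFSmoothOn 1 X univ)
    (hc : C.IsContactVF X) (hΨX : VFSmoothOn 1 (Ψ X) univ)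
    (hF : PreservesContact C (C.flowExp (Ψ X)))
    (hV : ∀ l, ∀ x ∈ A.V l, C.flowExp (Ψ X) x ∈ (A.chart l).source)
    (hA : ∀ l, ∀ x ∈ A.V l, IsUnit (A.pullA (C.flowExp (Ψ X)) φ l x).det)
    (hμ : CRStructure.IsPullback (C.flowExp (Ψ X)) φ μ) {W : CVF n M}
    (hW : C.IsAntiholSection W) (x : M) :
    (C.antihol x).mkQ (μ x ⟨W x, hW.2 x⟩ : CT n x) =
      C.dbarb X W x + (C.antihol x).mkQ (A.compTensor Ψ X φ x (W x))
        + (C.antihol x).mkQ (A.tensorE Ψ X X φ x (W x)) := by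
  have hmem : ∀ l, A.ρ l x ≠ 0 → (μ x ⟨W x, hW.2 x⟩ : CT n x) - cBracket W (toC X) x -
      A.localTensor Ψ X φ l x (W x) ∈ C.antihol x := by
    intro l hl
    have hxV := A.mem_V_of_ρ_ne_zero hl
    have hx := A.mem_source_of_mem_V hxV
    refine (A.mem_antihol_iff hx _).2 ⟨?_, fun α => ?_⟩
    · have hTη : evη C x (A.localTensor Ψ X φ l x (W x)) = 0 :=
        (mem_H_iff _).1 (Submodule.mem_sup_left (A.localTensor_mem_hol Ψ X φ hx _))
      rw [map_sub, map_sub, hTη, evη_deform, evη_cBracket hX hc hW x]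
      simp
    · have hco : ∀ β, A.coef μ l α β x = cEval (lieD X (A.θ l α) x) (A.Zbar l β x) +
          A.coefComp Ψ X φ l α β x + A.coefE Ψ X X φ l α β x := fun β => by
        rw [← A.inv_mul_pullB Ψ hX hΨX φ hx (hA l x hxV),
          ← A.coefMat_of_isPullback hF hx (hV l x hxV) (hA l x hxV) hμ]
        rfl
      rw [map_sub, map_sub, A.ev_localTensor Ψ X φ hx, A.ev_cBracket hX hW hx,
        A.cEval_lieD_antihol hx _ (hW.2 x), A.ev_deform μ hx, ← Finset.sum_sub_distrib,
        ← Finset.sum_sub_distrib]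
      refine Finset.sum_eq_zero fun β _ => ?_
      rw [hco]
      ring
  have htot := A.sub_sum_ρ_mem hmem
  rw [← A.compTensor_add_tensorE] at htot
  have hgoal := (Submodule.Quotient.mk_eq_zero (C.antihol x)).2 htot
  rw [sub_sub, ← Submodule.mkQ_apply, map_sub, sub_eq_zero, map_add, map_add, ← add_assoc] at hgoal
  exact hgoal

end AdaptedAtlas

end CRDef

end

open scoped Manifold ContDiff TensorProduct ENNReal Topology
noncomputable section
namespace CRDef
open Set Filter MeasureTheory
set_option linter.unusedSectionVars false

/-! ### A Sobolev inequality for horizontal derivatives -/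

section Sobolev

variable {n : ℕ} {F : Type*} [NormedAddCommGroup F] [NormedSpace ℝ F]

/-- The standard basis vectors. -/
abbrev basisVec (n : ℕ) (i : Fin (2 * n + 1)) : Model n := EuclideanSpace.single i (1 : ℝ)

/-- The coefficient of `∂_(2n+1)` in the horizontal frame. -/
def horizCoef (n : ℕ) (j : Fin (2 * n)) : Model n →L[ℝ] ℝ :=
  if h : (j : ℕ) < n then EuclideanSpace.proj (⟨n + j, by omega⟩ : Fin (2 * n + 1)) else 0

theorem horizVec_eq (j : Fin (2 * n)) (x : Model n) :
    horizVec n j x = basisVec n j.castSucc + horizCoef n j x • basisVec n (Fin.last (2 * n)) := by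
  unfold horizVec horizCoef
  split_ifs with h
  · rfl
  · simp

theorem horizVec_eq_clm (j : Fin (2 * n)) : horizVec n j = fun x =>
    basisVec n j.castSucc + (horizCoef n j).smulRight (basisVec n (Fin.last (2 * n))) x := by
  ext1 x; rw [horizVec_eq]; rfl

theorem horizCoef_horizVec (j : Fin (2 * n)) (x : Model n) :
    horizCoef n j (horizVec n j x) = 0 := by
  unfold horizCoef
  split_ifs with h
  · rw [horizVec_eq]
    have h1 : (⟨n + j, by omega⟩ : Fin (2 * n + 1)) ≠ j.castSucc := by
      intro h2; have := congrArg Fin.val h2; simp at this; omega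
    have h2 : (⟨n + j, by omega⟩ : Fin (2 * n + 1)) ≠ Fin.last (2 * n) := by
      intro h2; have := congrArg Fin.val h2; simp at this; omega
    simp [h1, h2]
  · rfl

theorem horizVec_ne_zero (j : Fin (2 * n)) (x : Model n) : horizVec n j x ≠ 0 := by
  intro h
  have h1 := congrArg (fun v : Model n => v j.castSucc) h
  rw [horizVec_eq] at h1
  simp [Fin.castSucc_ne_last] at h1

/-- The coefficient of ∂_(2n+1) in X_j depends only on a coordinate that X_j does not move. Hence
the integral curves of X_j are straight lines along which X_j is constant, and line integrals
replace flows. -/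
theorem horizVec_line (j : Fin (2 * n)) (x : Model n) (t : ℝ) :
    horizVec n j (x + t • horizVec n j x) = horizVec n j x := by
  rw [horizVec_eq j (x + _), map_add, map_smul, horizCoef_horizVec, smul_zero, add_zero,
    ← horizVec_eq]

theorem contDiff_horizVec (j : Fin (2 * n)) : ContDiff ℝ ∞ (horizVec n j) := by
  rw [horizVec_eq_clm]; fun_prop

theorem contDiff_horizDeriv (I : List (Fin (2 * n))) {u : Model n → F} (hu : ContDiff ℝ ∞ u) :
    ContDiff ℝ ∞ (horizDeriv I u) := by
  induction I with
  | nil => exact hu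
  | cons j I ih => exact (ih.fderiv_right (m := ∞) (by simp)).clm_apply (contDiff_horizVec j)

theorem hasCompactSupport_horizDeriv (I : List (Fin (2 * n))) {u : Model n → F}
    (hu : HasCompactSupport u) : HasCompactSupport (horizDeriv I u) := by
  induction I with
  | nil => exact hu
  | cons j I ih =>
    refine (ih.fderiv (𝕜 := ℝ)).mono fun x hx h0 => hx ?_
    simp only [horizDeriv, h0, zero_apply]

theorem horizDeriv_append (I J : List (Fin (2 * n))) (u : Model n → F) :
    horizDeriv (I ++ J) u = horizDeriv I (horizDeriv J u) := by
  induction I with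
  | nil => rfl
  | cons j I ih => simp only [List.cons_append, horizDeriv, ih]

/-- A compactly supported function is bounded by the integral of its derivative along a line. -/
theorem enorm_le_lintegral_line {u : Model n → F} (hu : ContDiff ℝ ∞ u)
    (hc : HasCompactSupport u) (p : Model n) {v : Model n} (hv : v ≠ 0) :
    ‖u p‖ₑ ≤ ∫⁻ t : ℝ, ‖fderiv ℝ u (p + t • v) v‖ₑ := by
  have hl : ContDiff ℝ 1 (fun t : ℝ => u (p + t • v)) := by
    refine (hu.of_le (by simp)).comp (by fun_prop)
  -- As v ≠ 0, the line is a closed embedding, so the restriction of u to it still has compact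
  -- support.
  have hemb : Topology.IsClosedEmbedding fun t : ℝ => p + t • v :=
    (Homeomorph.addLeft p).isClosedEmbedding.comp (isClosedEmbedding_smul_left hv)
  have h := (hc.comp_isClosedEmbedding hemb).enorm_le_lintegral_Ici_deriv hl 0
  simp only [zero_smul, add_zero] at h
  refine h.trans ((lintegral_mono' Measure.restrict_le_self fun t => ?_))
  have hd : HasDerivAt (fun t : ℝ => p + t • v) v t := by
    simpa using ((hasDerivAt_id t).smul_const v).const_add p
  have h2 : HasFDerivAt u (fderiv ℝ u (p + t • v)) (p + t • v) :=
    ((hu.differentiable (by simp)) _).hasFDerivAt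
  have h3 := (h2.comp_hasDerivAt t hd).deriv
  exact le_of_eq (by rw [← h3]; rfl)

/-- Iterated line integrals along the horizontal frame. -/
def lineIter : List (Fin (2 * n)) → (Model n → ℝ≥0∞) → Model n → ℝ≥0∞
  | [], g => g
  | j :: I, g => lineIter I fun p => ∫⁻ t : ℝ, g (p + t • horizVec n j p)

theorem lineIter_mono (I : List (Fin (2 * n))) {g g' : Model n → ℝ≥0∞} (h : ∀ p, g p ≤ g' p)
    (p : Model n) : lineIter I g p ≤ lineIter I g' p := by
  induction I generalizing g g' with
  | nil => exact h p
  | cons j I ih => exact ih fun p => lintegral_mono fun t => h _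

theorem enorm_le_lineIter (I : List (Fin (2 * n))) {u : Model n → F} (hu : ContDiff ℝ ∞ u)
    (hc : HasCompactSupport u) (p : Model n) :
    ‖u p‖ₑ ≤ lineIter I (fun q => ‖horizDeriv I u q‖ₑ) p := by
  induction I with
  | nil => exact le_rfl
  | cons j I ih =>
    refine ih.trans (lineIter_mono I (fun q => ?_) p)
    refine (enorm_le_lintegral_line (contDiff_horizDeriv I hu)
      (hasCompactSupport_horizDeriv I hc) q (horizVec_ne_zero j q)).trans (le_of_eq ?_)
    refine lintegral_congr fun t => ?_
    simp only [horizDeriv, horizVec_line]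

/-- The marginal integral over a set of coordinates. -/
def marg (G : Model n → ℝ≥0∞) (s : Finset (Fin (2 * n + 1))) (p : Model n) : ℝ≥0∞ :=
  lmarginal (fun _ => volume) s (fun y => G (WithLp.toLp 2 y)) (WithLp.ofLp p)

/-- Translation invariance of Lebesgue measure removes the dependence on the starting point, so
integrating along the i-th axis adds i to the set of integrated coordinates. -/
theorem marg_line {G : Model n → ℝ≥0∞} (hG : Measurable G) {s : Finset (Fin (2 * n + 1))}
    {i : Fin (2 * n + 1)} (hi : i ∉ s) (p : Model n) :
    ∫⁻ t : ℝ, marg G s (p + t • basisVec n i) = marg G (insert i s) p := by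
  have hG' : Measurable fun y : Fin (2 * n + 1) → ℝ => G (WithLp.toLp 2 y) :=
    hG.comp (WithLp.measurable_toLp 2 _)
  unfold marg
  rw [lmarginal_insert _ hG' hi]
  have h : ∀ t : ℝ, WithLp.ofLp (p + t • basisVec n i) =
      Function.update (WithLp.ofLp p) i (t + p i) := by
    intro t
    ext k
    by_cases hk : k = i
    · subst hk; simp [add_comm]
    · simp [hk]
  simp only [h]
  exact lintegral_add_right_eq_self (fun t => lmarginal (fun _ => volume) s
    (fun y => G (WithLp.toLp 2 y)) (Function.update (WithLp.ofLp p) i t)) (p i)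

/-- Once the last coordinate has been integrated out, the ∂_(2n+1)-component of X_j is invisible:
integration along X_j becomes integration along the j-th coordinate axis. This reduces
`lineIter_marg` to Tonelli's theorem. -/
theorem marg_add_last (G : Model n → ℝ≥0∞) {s : Finset (Fin (2 * n + 1))}
    (hs : Fin.last (2 * n) ∈ s) (p : Model n) (c : ℝ) :
    marg G s (p + c • basisVec n (Fin.last (2 * n))) = marg G s p := by
  unfold marg
  refine lmarginal_congr _ _ fun i hi => ?_
  have : i ≠ Fin.last (2 * n) := fun h => hi (h ▸ hs)
  simp [this]

theorem lineIter_marg {G : Model n → ℝ≥0∞} (hG : Measurable G) (I : List (Fin (2 * n)))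
    (hI : I.Nodup) (s : Finset (Fin (2 * n + 1))) (hs : Fin.last (2 * n) ∈ s)
    (hIs : ∀ j ∈ I, j.castSucc ∉ s) (p : Model n) :
    lineIter I (marg G s) p = marg G (s ∪ (I.map Fin.castSucc).toFinset) p := by
  induction I generalizing s with
  | nil => simp [lineIter]
  | cons j I ih =>
    have h1 : (fun p => ∫⁻ t : ℝ, marg G s (p + t • horizVec n j p)) =
        marg G (insert j.castSucc s) := by
      ext p
      rw [← marg_line hG (hIs j (by simp)) p]
      refine lintegral_congr fun t => ?_
      rw [horizVec_eq, smul_add, smul_smul, ← add_assoc, marg_add_last G hs]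
    rw [lineIter, h1, ih (List.nodup_cons.1 hI).2 _ (Finset.mem_insert_of_mem hs)]
    · congr 1
      ext k
      simp only [Finset.mem_union, Finset.mem_insert, List.mem_toFinset, List.map_cons,
        List.mem_cons]
      tauto
    · intro k hk
      rw [Finset.mem_insert, not_or]
      refine ⟨fun h => (List.nodup_cons.1 hI).1 ?_, hIs k (by simp [hk])⟩
      rwa [← Fin.castSucc_injective _ h]

theorem marg_univ (G : Model n → ℝ≥0∞) (p : Model n) :
    marg G Finset.univ p = ∫⁻ x, G x := by
  unfold marg
  rw [lmarginal_univ]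
  exact (PiLp.volume_preserving_toLp (Fin (2 * n + 1))).lintegral_comp_emb
    (MeasurableEquiv.toLp 2 (Fin (2 * n + 1) → ℝ)).measurableEmbedding G

/-- The fundamental estimate: a test function is bounded by the integral of a derivative of
weight `2n + 2`. -/
theorem enorm_le_lintegral {u : Model n → F} (hu : ContDiff ℝ ∞ u) (hc : HasCompactSupport u)
    (p : Model n) : ‖u p‖ₑ ≤ ∫⁻ x, ‖fderiv ℝ (horizDeriv (List.finRange (2 * n)) u) x
      (basisVec n (Fin.last (2 * n)))‖ₑ := by
  set w := horizDeriv (List.finRange (2 * n)) u with hw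
  have hwd : ContDiff ℝ ∞ w := contDiff_horizDeriv _ hu
  set G : Model n → ℝ≥0∞ := fun x => ‖fderiv ℝ w x (basisVec n (Fin.last (2 * n)))‖ₑ with hG
  have hGm : Measurable G := by
    have : Continuous fun x => fderiv ℝ w x (basisVec n (Fin.last (2 * n))) :=
      (hwd.continuous_fderiv (by simp)).clm_apply continuous_const
    exact this.enorm.measurable
  refine (enorm_le_lineIter (List.finRange (2 * n)) hu hc p).trans ?_
  -- The transverse integration is placed innermost, so that its coordinate is already integrated
  -- out when the horizontal line integrals are taken.
  have h1 : ∀ q, ‖w q‖ₑ ≤ marg G {Fin.last (2 * n)} q := by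
    intro q
    refine (enorm_le_lintegral_line hwd (hasCompactSupport_horizDeriv _ hc) q
      (v := basisVec n (Fin.last (2 * n))) (by
        intro h
        have := congrArg (fun v : Model n => v (Fin.last (2 * n))) h
        simp at this)).trans (le_of_eq ?_)
    have h2 := marg_line hGm (s := ∅) (i := Fin.last (2 * n)) (by simp) q
    rw [insert_empty_eq] at h2
    rw [← h2]
    refine lintegral_congr fun t => ?_
    simp [marg, hG]
  refine (lineIter_mono _ h1 p).trans (le_of_eq ?_)
  rw [lineIter_marg hGm _ (List.nodup_finRange _) _ (by simp)
    (by simp [Fin.castSucc_ne_last]), ← marg_univ G p]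
  congr 1
  ext k
  simp only [Finset.mem_union, Finset.mem_singleton, List.mem_toFinset, List.mem_map,
    List.mem_finRange, true_and, Finset.mem_univ, iff_true]
  rcases Fin.eq_castSucc_or_eq_last k with ⟨j, rfl⟩ | rfl
  · exact Or.inr ⟨j, rfl⟩
  · exact Or.inl rfl

/-- The transverse derivative is a commutator of horizontal ones. -/
theorem fderiv_last_eq (hn : 1 ≤ n) {w : Model n → F} (hw : ContDiff ℝ ∞ w) (x : Model n) :
    fderiv ℝ w x (basisVec n (Fin.last (2 * n))) =
      horizDeriv [⟨n, by omega⟩, ⟨0, by omega⟩] w x -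
        horizDeriv [⟨0, by omega⟩, ⟨n, by omega⟩] w x := by
  have hd : DifferentiableAt ℝ (fderiv ℝ w) x :=
    (hw.fderiv_right (m := ∞) (by simp)).differentiable (by simp) x
  have hs : IsSymmSndFDerivAt ℝ w x :=
    hw.contDiffAt.isSymmSndFDerivAt (by simpa using two_le_infty)
  -- X_i X_j w is the Hessian on (X_i, X_j) plus a multiple of ∂_(2n+1) w. The Hessian cancels in
  -- the commutator; with zero-based indices, n stands for ∂_(n+1) and 0 for X_1, and the
  -- coefficients are 1 and 0.
  have key : ∀ i j : Fin (2 * n), horizDeriv [i, j] w x =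
      fderiv ℝ (fderiv ℝ w) x (horizVec n i x) (horizVec n j x) +
        horizCoef n j (horizVec n i x) • fderiv ℝ w x (basisVec n (Fin.last (2 * n))) := by
    intro i j
    have hv : HasFDerivAt (horizVec n j)
        ((horizCoef n j).smulRight (basisVec n (Fin.last (2 * n)))) x := by
      rw [horizVec_eq_clm]
      exact ((horizCoef n j).smulRight (basisVec n (Fin.last (2 * n)))).hasFDerivAt.const_add _
    simp only [horizDeriv]
    rw [(hd.hasFDerivAt.clm_apply hv).fderiv]
    simp [add_comm]
  rw [key, key, hs.eq]
  have h1 : horizCoef n (⟨0, by omega⟩ : Fin (2 * n))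
      (horizVec n (⟨n, by omega⟩ : Fin (2 * n)) x) = 1 := by
    unfold horizCoef
    rw [dif_pos (show ((⟨0, by omega⟩ : Fin (2 * n)) : ℕ) < n from hn)]
    unfold horizVec
    rw [dif_neg (show ¬ ((⟨n, by omega⟩ : Fin (2 * n)) : ℕ) < n from lt_irrefl n)]
    simp
  have h2 : horizCoef n (⟨n, by omega⟩ : Fin (2 * n))
      (horizVec n (⟨0, by omega⟩ : Fin (2 * n)) x) = 0 := by
    unfold horizCoef
    rw [dif_neg (show ¬ ((⟨n, by omega⟩ : Fin (2 * n)) : ℕ) < n from lt_irrefl n)]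
    rfl
  rw [h1, h2]
  simp

end Sobolev

end CRDef

end

open scoped Manifold ContDiff TensorProduct ENNReal Topology
noncomputable section
namespace CRDef
open Set Filter MeasureTheory
set_option linter.unusedSectionVars false

/-! ### Horizontal L² norms and the passage from test functions to Folland-Stein classes. -/

section SobolevNorm

variable {n : ℕ} {F : Type*} [NormedAddCommGroup F] [NormedSpace ℝ F]

/-- The largest `L²(D)`-norm of a horizontal derivative of order at most `m`. -/
def horizSup (D : Set (Model n)) (m : ℕ) (u : Model n → F) : ℝ≥0∞ :=
  ⨆ (I : List (Fin (2 * n))) (_ : I.length ≤ m), eLpNorm (horizDeriv I u) 2 (volume.restrict D)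

theorem le_horizSup (D : Set (Model n)) {m : ℕ} (u : Model n → F) {I : List (Fin (2 * n))}
    (hI : I.length ≤ m) :
    eLpNorm (horizDeriv I u) 2 (volume.restrict D) ≤ horizSup D m u :=
  le_iSup₂ (f := fun (I : List (Fin (2 * n))) (_ : I.length ≤ m) =>
    eLpNorm (horizDeriv I u) 2 (volume.restrict D)) I hI

theorem horizSup_mono (D : Set (Model n)) {m m' : ℕ} (h : m ≤ m') (u : Model n → F) :
    horizSup D m u ≤ horizSup D m' u :=
  iSup₂_le fun _ hI => le_horizSup D u (hI.trans h)

theorem horizSup_horizDeriv (D : Set (Model n)) (m : ℕ) (u : Model n → F)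
    (J : List (Fin (2 * n))) : horizSup D m (horizDeriv J u) ≤ horizSup D (m + J.length) u :=
  iSup₂_le fun I hI => by
    rw [← horizDeriv_append]
    exact le_horizSup D u (by simp; omega)

theorem horizDeriv_add (I : List (Fin (2 * n))) {u v : Model n → F} (hu : ContDiff ℝ ∞ u)
    (hv : ContDiff ℝ ∞ v) : horizDeriv I (u + v) = horizDeriv I u + horizDeriv I v := by
  induction I with
  | nil => rfl
  | cons j I ih =>
    ext x
    simp only [horizDeriv, ih, Pi.add_apply]
    rw [fderiv_add ((contDiff_horizDeriv I hu).differentiable (by simp) x)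
      ((contDiff_horizDeriv I hv).differentiable (by simp) x)]
    rfl

theorem horizDeriv_smul_singleton (j : Fin (2 * n)) {χ : Model n → ℝ} {u : Model n → F}
    (hχ : ContDiff ℝ ∞ χ) (hu : ContDiff ℝ ∞ u) :
    horizDeriv [j] (fun x => χ x • u x) =
      (fun x => horizDeriv [j] χ x • u x) + fun x => χ x • horizDeriv [j] u x := by
  ext x
  simp only [horizDeriv, Pi.add_apply]
  rw [fderiv_fun_smul (hχ.differentiable (by simp) x) (hu.differentiable (by simp) x)]
  simp [add_comm]

/-- Induction on the innermost derivative, using X_j(χu) = (X_jχ)u + χ X_ju. The cut-off is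
quantified inside the induction because the hypothesis is applied both to χ and to X_jχ. -/
theorem exists_leibniz_bound (D : Set (Model n)) (I : List (Fin (2 * n))) :
    ∀ {χ : Model n → ℝ}, ContDiff ℝ ∞ χ → HasCompactSupport χ → ∃ C : NNReal,
      ∀ u : Model n → F, ContDiff ℝ ∞ u →
        eLpNorm (horizDeriv I fun x => χ x • u x) 2 (volume.restrict D) ≤
          C * horizSup D I.length u := by
  induction I using List.reverseRecOn with
  | nil =>
    intro χ hχ hc
    obtain ⟨C, hC⟩ := hχ.continuous.bounded_above_of_compact_support hc
    have hC0 : 0 ≤ C := (norm_nonneg _).trans (hC 0)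
    lift C to NNReal using hC0
    refine ⟨C, fun u hu => ?_⟩
    have h := eLpNorm_le_nnreal_smul_eLpNorm_of_ae_le_mul (μ := volume.restrict D)
      (f := fun x => χ x • u x) (g := u) (c := C) (Eventually.of_forall fun x => ?_) 2
    · refine h.trans ?_
      rw [ENNReal.smul_def, smul_eq_mul]
      gcongr
      exact le_horizSup D u (I := []) le_rfl
    · rw [nnnorm_smul]
      gcongr
      exact hC x
  | append_singleton I j ih =>
    intro χ hχ hc
    obtain ⟨C1, h1⟩ := ih (contDiff_horizDeriv [j] hχ) (hasCompactSupport_horizDeriv [j] hc)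
    obtain ⟨C2, h2⟩ := ih hχ hc
    refine ⟨C1 + C2, fun u hu => ?_⟩
    have hju := contDiff_horizDeriv [j] hu
    have ha : ContDiff ℝ ∞ fun x => horizDeriv [j] χ x • u x :=
      (contDiff_horizDeriv [j] hχ).smul hu
    have hb : ContDiff ℝ ∞ fun x => χ x • horizDeriv [j] u x := hχ.smul hju
    rw [horizDeriv_append, horizDeriv_smul_singleton j hχ hu, horizDeriv_add I ha hb]
    refine (eLpNorm_add_le (contDiff_horizDeriv I ha).continuous.aestronglyMeasurable
      (contDiff_horizDeriv I hb).continuous.aestronglyMeasurable (by norm_num)).trans ?_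
    rw [ENNReal.coe_add, add_mul, List.length_append]
    refine add_le_add ((h1 u hu).trans ?_) ((h2 _ hju).trans ?_)
    · gcongr; exact horizSup_mono D (by simp) u
    · gcongr; exact horizSup_horizDeriv D _ u [j]

theorem exists_horizSup_smul_le (D : Set (Model n)) (m : ℕ) {χ : Model n → ℝ}
    (hχ : ContDiff ℝ ∞ χ) (hc : HasCompactSupport χ) : ∃ C : NNReal,
      ∀ u : Model n → F, ContDiff ℝ ∞ u →
        horizSup D m (fun x => χ x • u x) ≤ C * horizSup D m u := by
  choose C hC using fun I : List (Fin (2 * n)) => exists_leibniz_bound (F := F) D I hχ hc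
  have hfin : {I : List (Fin (2 * n)) | I.length ≤ m}.Finite := List.finite_length_le _ _
  obtain ⟨B, hB⟩ := (hfin.image C).bddAbove
  refine ⟨B, fun u hu => iSup₂_le fun I hI => (hC I u hu).trans ?_⟩
  have := hB (mem_image_of_mem C hI)
  gcongr
  exact horizSup_mono D hI u

theorem horizDeriv_eq_zero {K : Set (Model n)} (hK : IsClosed K) (I : List (Fin (2 * n)))
    {u : Model n → F} (hu : ∀ x ∉ K, u x = 0) : ∀ x ∉ K, horizDeriv I u x = 0 := by
  induction I with
  | nil => exact hu
  | cons j I ih =>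
    intro x hx
    have h : horizDeriv I u =ᶠ[𝓝 x] fun _ => 0 := by
      filter_upwards [hK.isOpen_compl.mem_nhds hx] with y hy using ih y hy
    simp only [horizDeriv]
    rw [h.fderiv_eq]
    simp

/-- The derivative vanishes off K ⊆ D, so its L¹ norm is an integral over D, and Cauchy–Schwarz
supplies the factor |D|^(1/2). -/
theorem lintegral_le_horizSup {D K : Set (Model n)} (hK : IsClosed K) (hKD : K ⊆ D)
    (hD : MeasurableSet D) {m : ℕ} {u : Model n → F} (hu : ContDiff ℝ ∞ u)
    (h0 : ∀ x ∉ K, u x = 0) {I : List (Fin (2 * n))} (hI : I.length ≤ m) :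
    ∫⁻ x, ‖horizDeriv I u x‖ₑ ≤ volume D ^ (1 / 2 : ℝ) * horizSup D m u := by
  have h1 : ∫⁻ x, ‖horizDeriv I u x‖ₑ = ∫⁻ x in D, ‖horizDeriv I u x‖ₑ := by
    rw [← lintegral_indicator hD]
    refine lintegral_congr fun x => ?_
    by_cases hx : x ∈ D
    · simp [hx]
    · simp [hx, horizDeriv_eq_zero hK I h0 x fun h => hx (hKD h)]
  rw [h1, ← eLpNorm_one_eq_lintegral_enorm]
  have h2 := eLpNorm_le_eLpNorm_mul_rpow_measure_univ (μ := volume.restrict D) (p := 1) (q := 2)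
    (by norm_num) (contDiff_horizDeriv I hu).continuous.aestronglyMeasurable
  refine h2.trans ?_
  rw [Measure.restrict_apply_univ, mul_comm]
  have h3 : (1 / (1 : ℝ≥0∞).toReal - 1 / (2 : ℝ≥0∞).toReal) = 1 / 2 := by norm_num
  rw [h3]
  gcongr
  exact le_horizSup D u hI

/-- The 2n horizontal derivatives and the transverse one together cost 2n + 2 horizontal
derivatives; the factor 2 counts the two terms of the commutator. -/
theorem enorm_horizDeriv_le (hn : 1 ≤ n) {D K : Set (Model n)} (hK : IsCompact K) (hKD : K ⊆ D)
    (hD : MeasurableSet D) {m : ℕ} {u : Model n → F} (hu : ContDiff ℝ ∞ u)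
    (h0 : ∀ x ∉ K, u x = 0) {J : List (Fin (2 * n))} (hJ : J.length + (2 * n + 2) ≤ m)
    (p : Model n) :
    ‖horizDeriv J u p‖ₑ ≤ 2 * volume D ^ (1 / 2 : ℝ) * horizSup D m u := by
  have hJu := contDiff_horizDeriv J hu
  have hc : HasCompactSupport (horizDeriv J u) :=
    HasCompactSupport.intro hK (horizDeriv_eq_zero hK.isClosed J h0)
  refine (enorm_le_lintegral hJu hc p).trans ?_
  have hw := contDiff_horizDeriv (List.finRange (2 * n)) hJu
  have h1 : ∀ i j : Fin (2 * n),
      ∫⁻ x, ‖horizDeriv [i, j] (horizDeriv (List.finRange (2 * n)) (horizDeriv J u)) x‖ₑ ≤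
        volume D ^ (1 / 2 : ℝ) * horizSup D m u := by
    intro i j
    rw [← horizDeriv_append, ← horizDeriv_append]
    exact lintegral_le_horizSup hK.isClosed hKD hD hu h0 (by simp; omega)
  simp only [fderiv_last_eq hn hw]
  calc _ ≤ ∫⁻ x, (‖horizDeriv [⟨n, by omega⟩, ⟨0, by omega⟩]
        (horizDeriv (List.finRange (2 * n)) (horizDeriv J u)) x‖ₑ +
      ‖horizDeriv [⟨0, by omega⟩, ⟨n, by omega⟩]
        (horizDeriv (List.finRange (2 * n)) (horizDeriv J u)) x‖ₑ) :=
        lintegral_mono fun x => enorm_sub_le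
    _ ≤ volume D ^ (1 / 2 : ℝ) * horizSup D m u + volume D ^ (1 / 2 : ℝ) * horizSup D m u := by
        rw [lintegral_add_left (contDiff_horizDeriv _ hw).continuous.enorm.measurable]
        exact add_le_add (h1 _ _) (h1 _ _)
    _ = _ := by ring

theorem norm_horizCoef_le (j : Fin (2 * n)) (p : Model n) : ‖horizCoef n j p‖ ≤ ‖p‖ := by
  unfold horizCoef
  split_ifs
  · exact PiLp.norm_apply_le p _
  · simp

theorem opNorm_le_sum_basis (L : Model n →L[ℝ] F) : ‖L‖ ≤ ∑ i, ‖L (basisVec n i)‖ := by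
  refine L.opNorm_le_bound (Finset.sum_nonneg fun _ _ => norm_nonneg _) fun v => ?_
  have hv : v = ∑ i, v i • basisVec n i := by
    ext k
    simp [Finset.sum_apply, Pi.single_apply]
  conv_lhs => rw [hv]
  rw [map_sum, Finset.sum_mul]
  refine (norm_sum_le _ _).trans (Finset.sum_le_sum fun i _ => ?_)
  rw [map_smul, norm_smul, mul_comm]
  gcongr
  exact PiLp.norm_apply_le v i

/-- Beyond the 2n + 2 derivatives spent on a sup bound, two more control the commutator ∂_(2n+1)u.
The remaining partial derivatives follow from ∂_j = X_j − (coefficient)·∂_(2n+1), whose coefficients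
are bounded on the bounded set D. -/
theorem exists_sobolev_smooth (hn : 1 ≤ n) {D K : Set (Model n)} (hK : IsCompact K)
    (hKD : K ⊆ D) (hD : MeasurableSet D) (hDb : Bornology.IsBounded D) :
    ∃ C : NNReal, ∀ u : Model n → F, ContDiff ℝ ∞ u → (∀ x ∉ K, u x = 0) → ∀ p,
      ‖u p‖ₑ ≤ C * horizSup D (2 * n + 4) u ∧ ‖fderiv ℝ u p‖ₑ ≤ C * horizSup D (2 * n + 4) u := by
  obtain ⟨R, hR⟩ := hDb.exists_norm_le
  have hvol : volume D ≠ ⊤ := hDb.measure_lt_top.ne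
  set a : ℝ≥0∞ := 2 * volume D ^ (1 / 2 : ℝ) with ha
  have hafin : a ≠ ⊤ := ENNReal.mul_ne_top (by simp)
    (ENNReal.rpow_ne_top_of_nonneg (by norm_num) hvol)
  have haC : ((a.toNNReal : NNReal) : ℝ≥0∞) = a := ENNReal.coe_toNNReal hafin
  set R' : NNReal := Real.toNNReal R with hR'
  -- One bound valid for each of the 2n + 1 basis directions: `a` for X_j, `R' * (2 * a)` for the
  -- correction by the transverse derivative, `2 * a` for the transverse derivative itself.
  set B : NNReal := (2 * n + 1 : ℕ) * (a.toNNReal + R' * (2 * a.toNNReal) + 2 * a.toNNReal) with hB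
  refine ⟨a.toNNReal + B, fun u hu h0 p => ?_⟩
  set N := horizSup D (2 * n + 4) u
  have hJ : ∀ (J : List (Fin (2 * n))) (_ : J.length ≤ 2), ‖horizDeriv J u p‖ₑ ≤ a * N :=
    fun J hJ => enorm_horizDeriv_le hn hK hKD hD hu h0 (by omega) p
  have hlast : ‖fderiv ℝ u p (basisVec n (Fin.last (2 * n)))‖ₑ ≤ 2 * a * N := by
    rw [fderiv_last_eq hn hu]
    refine enorm_sub_le.trans ((add_le_add (hJ _ (by simp)) (hJ _ (by simp))).trans
      (le_of_eq (by ring)))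
  constructor
  · refine (hJ [] (by simp)).trans ?_
    rw [ENNReal.coe_add, haC]
    gcongr
    exact le_self_add
  · by_cases hp : p ∈ D
    swap
    · have h : u =ᶠ[𝓝 p] fun _ => 0 := by
        filter_upwards [hK.isClosed.isOpen_compl.mem_nhds fun h => hp (hKD h)] with y hy
          using h0 y hy
      rw [h.fderiv_eq, fderiv_fun_const]
      simp only [Pi.zero_apply, ← ofReal_norm, norm_zero, ENNReal.ofReal_zero, zero_le]
    have hi : ∀ i, ‖fderiv ℝ u p (basisVec n i)‖ₑ ≤ (a + R' * (2 * a) + 2 * a) * N := by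
      intro i
      rcases Fin.eq_castSucc_or_eq_last i with ⟨j, rfl⟩ | rfl
      · have h1 : basisVec n j.castSucc = horizVec n j p -
            horizCoef n j p • basisVec n (Fin.last (2 * n)) := by
          rw [horizVec_eq]; simp
        have h2 : ‖horizCoef n j p‖ₑ ≤ R' := by
          rw [← ofReal_norm]
          exact ENNReal.ofReal_le_ofReal ((norm_horizCoef_le j p).trans (hR p hp))
        rw [h1, map_sub, map_smul]
        refine enorm_sub_le.trans ?_
        rw [enorm_smul]
        calc _ ≤ a * N + R' * (2 * a * N) :=
              add_le_add (hJ [j] (by simp)) (mul_le_mul' h2 hlast)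
          _ = (a + R' * (2 * a)) * N := by ring
          _ ≤ _ := mul_le_mul' le_self_add le_rfl
      · refine hlast.trans ?_
        gcongr
        exact le_add_self
    have hop : ‖fderiv ℝ u p‖ₑ ≤ ∑ i, ‖fderiv ℝ u p (basisVec n i)‖ₑ := by
      have h := ENNReal.ofReal_le_ofReal (opNorm_le_sum_basis (fderiv ℝ u p))
      rw [ENNReal.ofReal_sum_of_nonneg fun _ _ => norm_nonneg _] at h
      simpa only [ofReal_norm] using h
    refine hop.trans ((Finset.sum_le_sum fun i _ => hi i).trans ?_)
    rw [Finset.sum_const, Finset.card_univ, Fintype.card_fin, nsmul_eq_mul, ← mul_assoc]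
    gcongr
    rw [ENNReal.coe_add, hB]
    push_cast
    rw [haC]
    exact le_add_self

/-- The norm is an infimum over the possible families of derivatives; dividing by the constant,
which must be neither 0 nor ∞, reduces a bound by it to a bound for each family. -/
theorem le_mul_fsNorm {D : Set (Model n)} {s : ℕ} {f : Model n → F} {a c : ℝ≥0∞} (hc0 : c ≠ 0)
    (hc : c ≠ ⊤) (h : ∀ g, IsFSDerivs D s f g → a ≤ c *
      (∑ t ∈ Finset.range (s + 1), ∑ I : Fin t → Fin (2 * n),
        eLpNorm (g (List.ofFn I)) 2 (volume.restrict D) ^ 2) ^ (1 / 2 : ℝ)) :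
    a ≤ c * fsNorm D s f := by
  unfold fsNorm
  rw [mul_comm, ← ENNReal.div_le_iff_le_mul (Or.inl hc0) (Or.inl hc)]
  refine le_iInf₂ fun g hg => ?_
  rw [ENNReal.div_le_iff_le_mul (Or.inl hc0) (Or.inl hc), mul_comm]
  exact h g hg

theorem eLpNorm_le_fsSum (D : Set (Model n)) {s : ℕ} (g : List (Fin (2 * n)) → Model n → F)
    {I : List (Fin (2 * n))} (hI : I.length ≤ s) :
    eLpNorm (g I) 2 (volume.restrict D) ≤
      (∑ t ∈ Finset.range (s + 1), ∑ I : Fin t → Fin (2 * n),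
        eLpNorm (g (List.ofFn I)) 2 (volume.restrict D) ^ 2) ^ (1 / 2 : ℝ) := by
  have h1 : eLpNorm (g I) 2 (volume.restrict D) ^ 2 ≤
      ∑ t ∈ Finset.range (s + 1), ∑ I : Fin t → Fin (2 * n),
        eLpNorm (g (List.ofFn I)) 2 (volume.restrict D) ^ 2 := by
    refine le_trans ?_ (Finset.single_le_sum (f := fun t => ∑ I : Fin t → Fin (2 * n),
      eLpNorm (g (List.ofFn I)) 2 (volume.restrict D) ^ 2) (fun _ _ => zero_le)
      (Finset.mem_range.2 (Nat.lt_succ_of_le hI)))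
    have h2 := Finset.single_le_sum (f := fun I : Fin I.length → Fin (2 * n) =>
      eLpNorm (g (List.ofFn I)) 2 (volume.restrict D) ^ 2) (s := Finset.univ)
      (fun _ _ => zero_le) (Finset.mem_univ I.get)
    simpa using h2
  calc eLpNorm (g I) 2 (volume.restrict D)
      = (eLpNorm (g I) 2 (volume.restrict D) ^ 2) ^ (1 / 2 : ℝ) := by
        rw [← ENNReal.rpow_natCast, ← ENNReal.rpow_mul]; norm_num
    _ ≤ _ := ENNReal.rpow_le_rpow h1 (by norm_num)

/-- The Sobolev inequality for the Folland-Stein norms. -/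
theorem exists_sobolev (hn : 1 ≤ n) {D K : Set (Model n)} (hK : IsCompact K)
    (hKD : K ⊆ D) (hD : IsOpen D) (hDb : Bornology.IsBounded D) :
    ∃ C : NNReal, ∀ s, 2 * n + 4 ≤ s → ∀ f : Model n → F, Continuous f → (∀ x ∉ K, f x = 0) →
      (∀ p, ‖f p‖ₑ ≤ C * fsNorm D s f) ∧
      ∀ p q, ‖f p - f q‖ₑ ≤ C * fsNorm D s f * ‖p - q‖ₑ := by
  -- The approximating functions need not be supported near K. Multiplication by a cut-off equal to
  -- 1 on K and supported in K' ⊆ D makes them test functions without changing the limit f.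
  obtain ⟨K', hK', hKK', hK'D⟩ := exists_compact_between hK hD hKD
  obtain ⟨χ, hχs, -, hχ, hχ1⟩ :=
    exists_contMDiff_support_eq_eq_one_iff (𝓘(ℝ, Model n)) (isOpen_interior (s := K'))
      hK.isClosed hKK' (n := (⊤ : ℕ∞))
  have hχ0 : ∀ x ∉ K', χ x = 0 := fun x hx => by
    by_contra h
    have h' : x ∈ Function.support χ := h
    rw [hχ] at h'
    exact hx (interior_subset h')
  have hχd : ContDiff ℝ ∞ χ := hχs.contDiff
  have hχc : HasCompactSupport χ := HasCompactSupport.intro hK' hχ0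
  obtain ⟨C1, hC1⟩ := exists_horizSup_smul_le (F := F) D (2 * n + 4) hχd hχc
  obtain ⟨C2, hC2⟩ := exists_sobolev_smooth (F := F) hn hK' hK'D hD.measurableSet hDb
  -- The strict inequality leaves room: the norms of the approximants only converge to those of g,
  -- and for L strictly larger they are eventually at most L.
  have main : ∀ s, 2 * n + 4 ≤ s → ∀ f : Model n → F, Continuous f → (∀ x ∉ K, f x = 0) →
      ∀ g, IsFSDerivs D s f g → ∀ L : ℝ≥0∞, (∑ t ∈ Finset.range (s + 1),
        ∑ I : Fin t → Fin (2 * n),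
          eLpNorm (g (List.ofFn I)) 2 (volume.restrict D) ^ 2) ^ (1 / 2 : ℝ) < L → L ≠ ⊤ →
      (∀ p, ‖f p‖ₑ ≤ (C2 * C1) * L) ∧ ∀ p q, ‖f p - f q‖ₑ ≤ (C2 * C1) * L * ‖p - q‖ₑ := by
    intro s hs f hf h0 g hg L hNL hL
    obtain ⟨u, hu, hug⟩ := hg.approx
    set w : ℕ → Model n → F := fun k x => χ x • u k x with hw
    have hwd : ∀ k, ContDiff ℝ ∞ (w k) := fun k => hχd.smul (hu k)
    have hw0 : ∀ k, ∀ x ∉ K', w k x = 0 := fun k x hx => by simp [hw, hχ0 x hx]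
    have hev : ∀ᶠ k in atTop, ∀ I ∈ {I : List (Fin (2 * n)) | I.length ≤ 2 * n + 4},
        eLpNorm (horizDeriv I (u k)) 2 (volume.restrict D) ≤ L := by
      rw [eventually_all_finite (List.finite_length_le _ _)]
      intro I hI
      have hIs : I.length ≤ s := le_trans hI hs
      have ht := (hug I hIs).add_const (eLpNorm (g I) 2 (volume.restrict D))
      rw [zero_add] at ht
      filter_upwards [ht.eventually_lt_const ((eLpNorm_le_fsSum D g hIs).trans_lt hNL)] with k hk
      refine le_trans ?_ hk.le
      have h3 := eLpNorm_add_le (p := 2) (μ := volume.restrict D)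
        (f := fun x => horizDeriv I (u k) x - g I x) (g := g I)
        ((contDiff_horizDeriv I (hu k)).continuous.aestronglyMeasurable.sub
          (hg.memLp I hIs).aestronglyMeasurable) (hg.memLp I hIs).aestronglyMeasurable
        (by norm_num)
      refine le_of_eq_of_le ?_ h3
      congr 1
      ext x
      simp
    have hsup : ∀ᶠ k in atTop, horizSup D (2 * n + 4) (w k) ≤ C1 * L := by
      filter_upwards [hev] with k hk
      refine (hC1 _ (hu k)).trans ?_
      gcongr
      exact iSup₂_le hk
    have hsob : ∀ᶠ k in atTop, (∀ p, ‖w k p‖ₑ ≤ (C2 * C1) * L) ∧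
        ∀ p q, ‖w k p - w k q‖ₑ ≤ (C2 * C1) * L * ‖p - q‖ₑ := by
      filter_upwards [hsup] with k hk
      have hb : C2 * horizSup D (2 * n + 4) (w k) ≤ (C2 * C1) * L := by
        rw [mul_assoc]; gcongr
      refine ⟨fun p => ((hC2 _ (hwd k) (hw0 k) p).1).trans hb, fun p q => ?_⟩
      have hfin : (C2 * C1 : ℝ≥0∞) * L ≠ ⊤ :=
        ENNReal.mul_ne_top (ENNReal.mul_ne_top ENNReal.coe_ne_top ENNReal.coe_ne_top) hL
      have hlip : LipschitzWith ((C2 * C1 : ℝ≥0∞) * L).toNNReal (w k) := by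
        refine lipschitzWith_of_nnnorm_fderiv_le ((hwd k).differentiable (by simp)) fun x => ?_
        rw [← ENNReal.coe_le_coe, ENNReal.coe_toNNReal hfin]
        exact ((hC2 _ (hwd k) (hw0 k) x).2).trans hb
      have := hlip p q
      rwa [ENNReal.coe_toNNReal hfin, edist_eq_enorm_sub, edist_eq_enorm_sub] at this
    -- Convergence in L² gives convergence in measure, hence almost everywhere along a subsequence.
    have hmeas : TendstoInMeasure (volume.restrict D) u atTop (g []) :=
      tendstoInMeasure_of_tendsto_eLpNorm (p := 2) (by norm_num)
        (fun k => (hu k).continuous.aestronglyMeasurable)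
        (hg.memLp [] (by simp)).aestronglyMeasurable (hug [] (by simp))
    obtain ⟨ns, hns, hae⟩ := hmeas.exists_seq_tendsto_ae
    have hae2 : ∀ᵐ x, Tendsto (fun k => w (ns k) x) atTop (𝓝 (f x)) := by
      have h4 := (ae_restrict_iff' hD.measurableSet).1 (hae.and hg.eq)
      filter_upwards [h4] with x hx
      by_cases hxK : x ∈ K
      · obtain ⟨h5, h6⟩ := hx (hKD hxK)
        have h7 := h5.const_smul (χ x)
        rw [h6, (hχ1 x).1 hxK, one_smul] at h7
        simpa [hw, (hχ1 x).1 hxK] using h7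
      · by_cases hxD : x ∈ D
        · obtain ⟨h5, h6⟩ := hx hxD
          have h7 := h5.const_smul (χ x)
          rw [h6, h0 x hxK, smul_zero] at h7
          rw [h0 x hxK]
          exact h7
        · rw [h0 x hxK]
          simp only [hw0 _ x fun h => hxD (hK'D h)]
          exact tendsto_const_nhds
    -- A set of full measure is dense, and f is continuous, so the bounds extend from the points of
    -- convergence to all points.
    have hdense : Dense {x | Tendsto (fun k => w (ns k) x) atTop (𝓝 (f x))} :=
      Measure.dense_of_ae hae2
    have hsob' := hns.tendsto_atTop.eventually hsob
    constructor
    · refine hdense.induction (fun p hp => ?_) ?_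
      · exact le_of_tendsto hp.enorm (hsob'.mono fun k hk => hk.1 p)
      · exact isClosed_le hf.enorm continuous_const
    · have h8 : ∀ z : Model n × Model n, ‖f z.1 - f z.2‖ₑ ≤ (C2 * C1) * L * ‖z.1 - z.2‖ₑ := by
        refine (hdense.prod hdense).induction (fun z hz => ?_) ?_
        · exact le_of_tendsto (hz.1.sub hz.2).enorm (hsob'.mono fun k hk => hk.2 z.1 z.2)
        · have hfin : (C2 * C1 : ℝ≥0∞) * L ≠ ⊤ :=
            ENNReal.mul_ne_top (ENNReal.mul_ne_top ENNReal.coe_ne_top ENNReal.coe_ne_top) hL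
          refine isClosed_le (by fun_prop) ?_
          exact (ENNReal.continuous_const_mul hfin).comp (by fun_prop)
      exact fun p q => h8 (p, q)
  -- The summand 1 keeps the constant nonzero, as `le_mul_fsNorm` requires.
  refine ⟨C2 * C1 + 1, fun s hs f hf h0 => ?_⟩
  have hle : (C2 * C1 : ℝ≥0∞) ≤ ((C2 * C1 + 1 : NNReal) : ℝ≥0∞) := by
    push_cast; exact le_self_add
  have h1 : ((C2 * C1 + 1 : NNReal) : ℝ≥0∞) ≠ 0 := by positivity
  have key : ∀ g, IsFSDerivs D s f g → ∀ a b : ℝ≥0∞, b ≠ ⊤ → (∀ L : ℝ≥0∞,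
      (∑ t ∈ Finset.range (s + 1), ∑ I : Fin t → Fin (2 * n),
          eLpNorm (g (List.ofFn I)) 2 (volume.restrict D) ^ 2) ^ (1 / 2 : ℝ) < L → L ≠ ⊤ →
        a ≤ b * L) → a ≤ b * (∑ t ∈ Finset.range (s + 1), ∑ I : Fin t → Fin (2 * n),
          eLpNorm (g (List.ofFn I)) 2 (volume.restrict D) ^ 2) ^ (1 / 2 : ℝ) := by
    intro g hg a b hb h
    set N := (∑ t ∈ Finset.range (s + 1), ∑ I : Fin t → Fin (2 * n),
          eLpNorm (g (List.ofFn I)) 2 (volume.restrict D) ^ 2) ^ (1 / 2 : ℝ) with hN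
    have hNfin : N < ⊤ := by
      refine ENNReal.rpow_lt_top_of_nonneg (by norm_num) (ENNReal.sum_lt_top.2 fun t ht =>
        ENNReal.sum_lt_top.2 fun I _ => ENNReal.pow_lt_top (hg.memLp _ ?_).2).ne
      simpa [Nat.lt_succ_iff] using ht
    -- The slack is removed by letting L decrease to N, which is finite because the g I are in L².
    have ht : Tendsto (fun L => b * L) (𝓝[>] N) (𝓝 (b * N)) :=
      (ENNReal.continuous_const_mul hb).continuousWithinAt
    have : (𝓝[>] N).NeBot := nhdsGT_neBot_of_exists_gt ⟨⊤, hNfin⟩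
    refine ge_of_tendsto ht ?_
    filter_upwards [self_mem_nhdsWithin, mem_nhdsWithin_of_mem_nhds (Iio_mem_nhds hNfin)]
      with L hL hL' using h L hL hL'.ne
  constructor
  · refine fun p => le_mul_fsNorm h1 ENNReal.coe_ne_top fun g hg => ?_
    exact key g hg _ _ ENNReal.coe_ne_top fun L hL hL' =>
      ((main s hs f hf h0 g hg L hL hL').1 p).trans (mul_le_mul' hle le_rfl)
  · intro p q
    -- For p ≠ q the factor ‖p − q‖ is nonzero and can be absorbed in the constant before passing to
    -- the infimum.
    rcases eq_or_ne p q with rfl | hpq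
    · rw [sub_self]; simp
    have h9 : ‖p - q‖ₑ ≠ 0 := by simpa [sub_eq_zero] using hpq
    rw [mul_right_comm]
    refine le_mul_fsNorm (mul_ne_zero h1 h9) (ENNReal.mul_ne_top ENNReal.coe_ne_top
      enorm_ne_top) fun g hg => ?_
    refine key g hg _ _ (ENNReal.mul_ne_top ENNReal.coe_ne_top enorm_ne_top) fun L hL hL' => ?_
    refine ((main s hs f hf h0 g hg L hL hL').2 p q).trans ?_
    rw [mul_right_comm]
    exact mul_le_mul' (mul_le_mul' hle le_rfl) le_rfl

theorem IsFSDerivs.mono {D : Set (Model n)} {s s' : ℕ} (h : s ≤ s') {f : Model n → F}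
    {g : List (Fin (2 * n)) → Model n → F} (hg : IsFSDerivs D s' f g) : IsFSDerivs D s f g where
  memLp I hI := hg.memLp I (hI.trans h)
  eq := hg.eq
  approx := by
    obtain ⟨u, hu, hug⟩ := hg.approx
    exact ⟨u, hu, fun I hI => hug I (hI.trans h)⟩

theorem fsNorm_mono (D : Set (Model n)) {s s' : ℕ} (h : s ≤ s') (f : Model n → F) :
    fsNorm D s f ≤ fsNorm D s' f := by
  refine le_iInf₂ fun g hg => (iInf₂_le g (hg.mono h)).trans ?_
  refine ENNReal.rpow_le_rpow ?_ (by norm_num)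
  exact Finset.sum_le_sum_of_subset (Finset.range_subset_range.2 (by omega))

theorem fsNorm_congr {D : Set (Model n)} (hD : MeasurableSet D) (s : ℕ) {f f' : Model n → F}
    (h : ∀ x ∈ D, f x = f' x) : fsNorm D s f = fsNorm D s f' := by
  have h1 : f =ᵐ[volume.restrict D] f' := (ae_restrict_iff' hD).2 (Eventually.of_forall h)
  have h2 : ∀ g, IsFSDerivs D s f g ↔ IsFSDerivs D s f' g := fun g =>
    ⟨fun hg => ⟨hg.memLp, hg.eq.trans h1, hg.approx⟩,
      fun hg => ⟨hg.memLp, hg.eq.trans h1.symm, hg.approx⟩⟩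
  simp only [fsNorm, h2]

end SobolevNorm

end CRDef

end

open scoped Manifold ContDiff TensorProduct ENNReal Topology
noncomputable section
namespace CRDef
open Set Filter
set_option linter.unusedSectionVars false

/-! ### The adapted metric in adapted charts -/

section StdForm

variable {n : ℕ}

/-- The standard contact form as a continuous linear map depending on the point. -/
def stdForm (n : ℕ) (x : Model n) : Model n →L[ℝ] ℝ :=
  EuclideanSpace.proj (Fin.last (2 * n)) -
    ∑ j : Fin n, x ⟨n + j, by omega⟩ •
      (EuclideanSpace.proj (⟨j, by omega⟩ : Fin (2 * n + 1)) : Model n →L[ℝ] ℝ)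

theorem stdForm_apply (x v : Model n) : stdForm n x v = stdContact n x v := by
  simp [stdForm, stdContact]

theorem contDiff_stdForm : ContDiff ℝ ∞ (stdForm n) := by
  unfold stdForm
  exact contDiff_const.sub (ContDiff.sum fun j _ =>
    (EuclideanSpace.proj (𝕜 := ℝ) (⟨n + j, by omega⟩ : Fin (2 * n + 1))).contDiff.smul
      contDiff_const)

theorem fderiv_stdForm (y a b : Model n) :
    fderiv ℝ (stdForm n) y a b = -∑ j : Fin n, a ⟨n + j, by omega⟩ * b ⟨j, by omega⟩ := by
  have h : HasFDerivAt (fun x => stdForm n x b)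
      (-∑ j : Fin n, b ⟨j, by omega⟩ •
        (EuclideanSpace.proj (⟨n + j, by omega⟩ : Fin (2 * n + 1)) : Model n →L[ℝ] ℝ)) y := by
    simp only [stdForm_apply, stdContact]
    rw [← zero_sub]
    exact (hasFDerivAt_const _ _).sub (HasFDerivAt.fun_sum fun j _ =>
      (EuclideanSpace.proj (𝕜 := ℝ) (⟨n + j, by omega⟩ : Fin (2 * n + 1))).hasFDerivAt.mul_const _)
  have h2 := ((contDiff_stdForm (n := n)).differentiable (by simp) y).hasFDerivAt.clm_apply
    (hasFDerivAt_const b y)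
  have h3 := congrArg (fun L : Model n →L[ℝ] ℝ => L a) (h2.unique h)
  simp only [add_apply, ContinuousLinearMap.comp_apply,
    ContinuousLinearMap.flip_apply, zero_apply, map_zero, zero_add] at h3
  simpa [mul_comm] using h3

/-- The exterior derivative of the standard contact form. -/
def stdOmega (n : ℕ) : Model n →L[ℝ] Model n →L[ℝ] ℝ :=
  fderiv ℝ (stdForm n) 0 - (fderiv ℝ (stdForm n) 0).flip

theorem dForm_stdForm (y a b : Model n) : dForm (stdForm n) y a b = stdOmega n a b := by
  simp [dForm, stdOmega, fderiv_stdForm]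

theorem stdOmega_apply (a b : Model n) : stdOmega n a b =
    ∑ j : Fin n, (b ⟨n + j, by omega⟩ * a ⟨j, by omega⟩ - a ⟨n + j, by omega⟩ * b ⟨j, by omega⟩) := by
  simp only [stdOmega, sub_apply, ContinuousLinearMap.flip_apply,
    fderiv_stdForm, Finset.sum_sub_distrib]
  ring

theorem stdOmega_last (b : Model n) : stdOmega n (basisVec n (Fin.last (2 * n))) b = 0 := by
  rw [stdOmega_apply]
  refine Finset.sum_eq_zero fun j _ => ?_
  have h1 : (⟨j, by omega⟩ : Fin (2 * n + 1)) ≠ Fin.last (2 * n) := by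
    have := j.2; intro h; simp [Fin.ext_iff] at h; omega
  have h2 : (⟨n + j, by omega⟩ : Fin (2 * n + 1)) ≠ Fin.last (2 * n) := by
    have := j.2; intro h; simp [Fin.ext_iff] at h; omega
  simp [basisVec, h1, h2]

theorem stdForm_last (y : Model n) : stdForm n y (basisVec n (Fin.last (2 * n))) = 1 := by
  rw [stdForm_apply, stdContact, Finset.sum_eq_zero, sub_zero]
  · simp [basisVec]
  · intro j _
    have h1 : (⟨j, by omega⟩ : Fin (2 * n + 1)) ≠ Fin.last (2 * n) := by
      have := j.2; intro h; simp [Fin.ext_iff] at h; omega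
    simp [basisVec, h1]

/-- Nondegeneracy of dη on ker η: pairing with the basis vectors of the first 2n coordinates reads
off those components one by one, and then the contact form gives the last one. -/
theorem eq_zero_of_stdOmega_eq_zero {y a : Model n} (h1 : stdForm n y a = 0)
    (h2 : ∀ b, stdOmega n a b = 0) : a = 0 := by
  have hlo : ∀ j : Fin n, a ⟨j, by omega⟩ = 0 := by
    intro j
    have h := h2 (basisVec n ⟨n + j, by omega⟩)
    rw [stdOmega_apply, Finset.sum_eq_single j] at h
    · have h4 : n ≠ 0 := by have := j.2; omega
      simpa [basisVec, Fin.ext_iff, h4] using h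
    · intro k _ hk
      have h3 : ¬ (k : ℕ) = j := fun h => hk (Fin.ext h)
      have h4 : ¬ (k : ℕ) = n + j := by have := k.2; omega
      simp [basisVec, Fin.ext_iff, h3, h4]
    · simp
  have hhi : ∀ j : Fin n, a ⟨n + j, by omega⟩ = 0 := by
    intro j
    have h := h2 (basisVec n ⟨j, by omega⟩)
    rw [stdOmega_apply, Finset.sum_eq_single j] at h
    · have h4 : n ≠ 0 := by have := j.2; omega
      simpa [basisVec, Fin.ext_iff, h4] using h
    · intro k _ hk
      have h3 : ¬ (k : ℕ) = j := fun h => hk (Fin.ext h)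
      have h4 : ¬ n + (k : ℕ) = j := by have := j.2; omega
      simp [basisVec, Fin.ext_iff, h3, h4]
    · simp
  have hl : a (Fin.last (2 * n)) = 0 := by
    rw [stdForm_apply, stdContact] at h1
    simpa [hlo] using h1
  ext i
  rcases Fin.eq_castSucc_or_eq_last i with ⟨k, rfl⟩ | rfl
  · by_cases hk : (k : ℕ) < n
    · exact hlo ⟨k, hk⟩
    · have h := hhi ⟨k - n, by have := k.2; omega⟩
      have h5 : (⟨n + (k - n : ℕ), by have := k.2; omega⟩ : Fin (2 * n + 1)) = k.castSucc := by
        ext; simp; omega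
      simp only [h5] at h
      exact h
  · exact hl

end StdForm

namespace AdaptedAtlas

variable {n : ℕ} {M : Type*} [TopologicalSpace M] [ChartedSpace (Model n) M]
  [IsManifold (𝓡 (2 * n + 1)) ∞ M]
  {C : CRStructure n M} {ι : Type*} [Fintype ι] (A : AdaptedAtlas C ι) {l : ι} {x : M}

theorem η_eq (hx : x ∈ (A.chart l).source) (v : TS n x) :
    C.η x v = stdForm n (A.chart l x) (dChart (A.chart l) x v) := by
  rw [stdForm_apply]; exact A.chart_contact l x hx v

theorem formIn_η {y : Model n} (hy : y ∈ (A.chart l).target) :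
    formIn (A.chart l) C.η y = stdForm n y := by
  ext a
  have h := A.η_eq ((A.chart l).map_target hy) (dSymm (A.chart l) y a)
  rw [(A.chart l).right_inv hy, dChart_dSymm (A.chart_mem l) hy] at h
  exact h

theorem extD_η (hx : x ∈ (A.chart l).source) (v w : TS n x) :
    extD C.η x v w =
      stdOmega n (dChart (A.chart l) x v) (dChart (A.chart l) x w) := by
  rw [extD_eq (A.chart_mem l) C.η_smooth (mem_univ x) hx, ← dForm_stdForm (A.chart l x)]
  have h : formIn (A.chart l) C.η =ᶠ[𝓝 (A.chart l x)] stdForm n := by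
    filter_upwards [(A.chart l).open_target.mem_nhds ((A.chart l).map_source hx)] with y hy
      using A.formIn_η hy
  simp only [dForm, h.fderiv_eq]

/-- The vector over ∂_(2n+1) satisfies the conditions that define the Reeb field, so the chosen one
does too; nondegeneracy makes the two equal. -/
theorem dChart_reeb (hx : x ∈ (A.chart l).source) :
    dChart (A.chart l) x (C.reeb x) = basisVec n (Fin.last (2 * n)) := by
  obtain ⟨T, hT⟩ := dChart_surjective (A.chart_mem l) hx (basisVec n (Fin.last (2 * n)))
  have hex : ∃ v : TS n x, C.η x v = 1 ∧ ∀ w, extD C.η x v w = 0 := by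
    refine ⟨T, ?_, fun w => ?_⟩
    · rw [A.η_eq hx, hT, stdForm_last]
    · rw [A.extD_η hx, hT, stdOmega_last]
  obtain ⟨h1, h2⟩ := Classical.epsilon_spec hex
  change C.η x (C.reeb x) = 1 at h1
  change ∀ w, extD C.η x (C.reeb x) w = 0 at h2
  rw [A.η_eq hx] at h1
  rw [← sub_eq_zero]
  refine eq_zero_of_stdOmega_eq_zero (y := A.chart l x) ?_ fun b => ?_
  · rw [map_sub, h1, stdForm_last, sub_self]
  · obtain ⟨w, rfl⟩ := dChart_surjective (A.chart_mem l) hx b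
    have h3 := h2 w
    rw [A.extD_η hx] at h3
    rw [map_sub, sub_apply, h3, stdOmega_last, sub_self]

theorem η_reeb (hx : x ∈ (A.chart l).source) : C.η x (C.reeb x) = 1 := by
  rw [A.η_eq hx, A.dChart_reeb hx, stdForm_last]

theorem holPart_spec (A : AdaptedAtlas C ι) (hx : x ∈ (A.chart l).source) (v : TS n x) :
    C.holPart x v ∈ C.hol x ∧ C.holPart x v + conjT (C.holPart x v) =
      (1 : ℂ) ⊗ₜ[ℝ] (v - C.η x v • C.reeb x) := by
  refine Classical.epsilon_spec (p := fun z : CT n x => z ∈ C.hol x ∧ z + conjT z =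
    (1 : ℂ) ⊗ₜ[ℝ] (v - C.η x v • C.reeb x)) ?_
  set w : CT n x := (1 : ℂ) ⊗ₜ[ℝ] (v - C.η x v • C.reeb x) with hw
  have hwc : conjT w = w := by simp [hw, conjT]
  have h0 : evη C x w = 0 := by
    have h : C.η x (v - C.η x v • C.reeb x) = 0 := by
      rw [map_sub, map_smul, A.η_reeb hx]; simp
    exact (cEval_real_eq_zero (C.η x) w).2 ⟨by simpa [hw] using h, by simp [hw]⟩
  -- The (1,0)-half of the frame expansion of w. As w is real, its (0,1)-half is the conjugate of
  -- this sum.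
  refine ⟨∑ α, A.ev l α x w • A.Z l α x, Submodule.sum_mem _ fun α _ =>
    Submodule.smul_mem _ _ (A.Z_mem_hol hx α), ?_⟩
  conv_rhs => rw [A.H_eq_sum hx h0]
  rw [map_sum]
  simp only [conjT_smul, evBar_apply, hwc, Zbar]

theorem reT_holPart (A : AdaptedAtlas C ι) (hx : x ∈ (A.chart l).source) (v : TS n x) :
    v = (2 : ℝ) • reT (C.holPart x v) + C.η x v • C.reeb x := by
  have h := congrArg reT (A.holPart_spec hx v).2
  rw [map_add, reT_conjT, reT_tmul, Complex.one_re, one_smul] at h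
  rw [two_smul, h, sub_add_cancel]

theorem J_eq (x : M) (v : TS n x) : C.J x v = (-2 : ℝ) • imT (C.holPart x v) := by
  unfold CRStructure.J
  rw [map_add, reT_conjT, reT_smul]
  simp
  module

theorem ev_holPart (A : AdaptedAtlas C ι) (hx : x ∈ (A.chart l).source) (v : TS n x) (α : Fin n) :
    A.ev l α x (C.holPart x v) = A.θ l α x (v - C.η x v • C.reeb x) := by
  obtain ⟨h1, h2⟩ := A.holPart_spec hx v
  have h3 := congrArg (A.ev l α x) h2
  have h4 : A.ev l α x (conjT (C.holPart x v)) = 0 :=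
    ((A.mem_antihol_iff hx _).1 ((mem_hol_iff_conj _).1 h1)).2 α
  rw [map_add, h4, add_zero] at h3
  rw [h3]
  have h5 : A.ev l α x ((1 : ℂ) ⊗ₜ[ℝ] (v - C.η x v • C.reeb x)) =
    cEval (A.θ l α x) ((1 : ℂ) ⊗ₜ[ℝ] (v - C.η x v • C.reeb x)) := rfl
  rw [h5]
  simp [cEval]

/-! #### Symmetry and positivity -/

/-- Comparison of the two expressions for (L_X η)(W): the terms W(η(X)) and X(η(W)) vanish because
both fields are horizontal. -/
theorem extD_of_annihilated {X W : VF n M} (hX : VFSmoothOn ∞ X univ) (hW : VFSmoothOn ∞ W univ)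
    (h1 : ∀ y, C.η y (X y) = 0) (h2 : ∀ y, C.η y (W y) = 0) (x : M) :
    extD C.η x (X x) (W x) = C.η x (VectorField.mlieBracket (𝓡 (2 * n + 1)) W X x) := by
  have he := isSmoothChart_chartAt (n := n) x
  have hx := mem_chart_source (Model n) x
  have h := lieD_apply_vf he C.η_smooth isOpen_univ (hX.of_le (by simp)) (hW.of_le (by simp))
    (mem_univ x) hx
  have h3 : (fun y => formIn (chartAt (Model n) x) C.η y (vfIn (chartAt (Model n) x) W y))
      =ᶠ[𝓝 (chartAt (Model n) x x)] fun _ => 0 := by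
    refine (form_vf_comp_symm he C.η W hx).symm.trans (Eventually.of_forall fun y => ?_)
    exact h2 _
  rw [h3.fderiv_eq, fderiv_fun_const] at h
  simp only [Pi.zero_apply, zero_apply, add_zero] at h
  rw [← h]
  let d : ℝ := mfderiv (𝓡 (2 * n + 1)) 𝓘(ℝ, ℝ) (fun y => C.η y (X y)) x (W x)
  have hd : d = 0 := by
    have hg : (fun y => C.η y (X y)) ∘ (chartAt (Model n) x).symm = fun _ => (0 : ℝ) :=
      funext fun y => h1 _
    refine (mfderiv_eq_chart he hx (by rw [hg]; exact differentiableAt_const _) _).trans ?_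
    rw [hg, fderiv_fun_const]
    rfl
  have h5 : lieD X C.η x (W x) = extD C.η x (X x) (W x) + d := rfl
  rw [h5, hd, add_zero]

theorem exists_holSection (A : AdaptedAtlas C ι) (x : M) {z : CT n x} (hz : z ∈ C.hol x) :
    ∃ W : CVF n M, CVFSmoothOn W univ ∧ (∀ y, W y ∈ C.hol y) ∧ W x = z := by
  obtain ⟨W, hW, hWx⟩ := A.exists_antiholSection x ⟨conjT z, (mem_hol_iff_conj _).1 hz⟩
  refine ⟨fun y => conjT (W y), hW.1.conj, fun y => ?_, ?_⟩
  · exact (mem_antihol_iff_conj _).1 (hW.2 y)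
  · simp [hWx]

/-- Integrability says η([W, Z]) = 0 for sections of H_(1,0), that is, dη has no (2,0)-part. Since
integrability speaks of global sections, the vectors are first extended. The second identity is the
symmetry of the adapted metric. -/
theorem extD_hol (A : AdaptedAtlas C ι) {z w : CT n x} (hz : z ∈ C.hol x) (hw : w ∈ C.hol x) :
    extD C.η x (reT z) (reT w) = extD C.η x (imT z) (imT w) ∧
    extD C.η x (reT z) (imT w) = -extD C.η x (imT z) (reT w) := by
  obtain ⟨Z, hZ, hZm, rfl⟩ := A.exists_holSection x hz
  obtain ⟨W, hW, hWm, rfl⟩ := A.exists_holSection x hw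
  have h0 : ∀ (Z : CVF n M), (∀ y, Z y ∈ C.hol y) → ∀ y, C.η y (reT (Z y)) = 0 ∧
      C.η y (imT (Z y)) = 0 := fun Z hZ y =>
    (cEval_real_eq_zero _ _).1 ((mem_H_iff _).1 (Submodule.mem_sup_left (hZ y)))
  have hb := h0 _ (C.integrable W Z hW hZ hWm hZm) x
  have hZ0 := h0 Z hZm
  have hW0 := h0 W hWm
  rw [extD_of_annihilated hZ.1 hW.1 (fun y => (hZ0 y).1) (fun y => (hW0 y).1),
    extD_of_annihilated hZ.2 hW.2 (fun y => (hZ0 y).2) (fun y => (hW0 y).2),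
    extD_of_annihilated hZ.1 hW.2 (fun y => (hZ0 y).1) (fun y => (hW0 y).2),
    extD_of_annihilated hZ.2 hW.1 (fun y => (hZ0 y).2) (fun y => (hW0 y).1)]
  simp only [cBracket, map_add, reT_tmul, imT_tmul, Complex.one_re, Complex.one_im, Complex.I_re,
    Complex.I_im, one_smul, zero_smul, add_zero, zero_add, map_sub] at hb
  constructor <;> linarith [hb.1, hb.2]

/-- With v = 2 Re z + η(v)T and Jw = −2 Im z' for the (1,0)-parts z and z' of v and w, the Reeb
component drops out of dη and the factor −4 appears. -/
theorem metric_eq (A : AdaptedAtlas C ι) (hx : x ∈ (A.chart l).source) (v w : TS n x) :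
    C.metric x v w = C.η x v * C.η x w -
      4 * extD C.η x (reT (C.holPart x v)) (imT (C.holPart x w)) := by
  unfold CRStructure.metric
  rw [J_eq, A.extD_η hx, A.extD_η hx]
  conv_lhs => enter [2, 1]; rw [A.reT_holPart hx v]
  rw [map_add, map_smul, map_smul, map_smul, A.dChart_reeb hx, map_add, map_smul, map_smul]
  simp only [add_apply, smul_apply, map_smul,
    stdOmega_last, smul_eq_mul]
  ring

theorem extD_swap (A : AdaptedAtlas C ι) (hx : x ∈ (A.chart l).source) (v w : TS n x) :
    extD C.η x v w = -extD C.η x w v := by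
  rw [A.extD_η hx, A.extD_η hx, stdOmega_apply, stdOmega_apply, ← Finset.sum_neg_distrib]
  exact Finset.sum_congr rfl fun j _ => by ring

theorem metric_symm (A : AdaptedAtlas C ι) (hx : x ∈ (A.chart l).source) (v w : TS n x) :
    C.metric x v w = C.metric x w v := by
  have h := (A.extD_hol (A.holPart_spec hx v).1 (A.holPart_spec hx w).1).2
  rw [A.metric_eq hx, A.metric_eq hx, h, A.extD_swap hx]
  ring

/-- If the (1,0)-part z of v vanishes, v is a nonzero multiple of the Reeb vector and η(v)² > 0.
Otherwise −i dη(z, z̄) = −2 dη(Re z, Im z) is positive by pseudoconvexity. -/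
theorem metric_pos (A : AdaptedAtlas C ι) (hx : x ∈ (A.chart l).source) {v : TS n x}
    (hv : v ≠ 0) : 0 < C.metric x v v := by
  rw [A.metric_eq hx]
  set z := C.holPart x v with hz
  by_cases h0 : z = 0
  · have h1 := A.reT_holPart hx v
    rw [← hz, h0, map_zero, smul_zero, zero_add] at h1
    have h2 : C.η x v ≠ 0 := by
      intro h; rw [h, zero_smul] at h1; exact hv h1
    have h3 : extD C.η x (reT (0 : CT n x)) (imT (0 : CT n x)) = 0 := by
      rw [A.extD_η hx]; simp
    rw [h0, h3]
    have := mul_self_pos.2 h2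
    linarith
  · have h1 := C.pseudoconvex x z (A.holPart_spec hx v).1 h0
    have h2 : extD C.η x (reT z) (imT (conjT z)) = -extD C.η x (reT z) (imT z) := by
      rw [A.extD_η hx, A.extD_η hx]; simp
    have h3 := A.extD_swap hx (imT z) (reT z)
    simp only [extDC, h2, reT_conjT] at h1
    simp at h1
    nlinarith [mul_self_nonneg (C.η x v)]

/-! #### The coordinate expression -/

/-- The coordinate expression of the component `θ^α` of the contact part. -/
def contactCoef (l : ι) (α : Fin n) (y : Model n) : Model n →L[ℝ] ℂ :=
  (formIn (A.chart l) (A.θ l α) y).comp (ContinuousLinearMap.id ℝ (Model n) -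
    (stdForm n y).smulRight (basisVec n (Fin.last (2 * n))))

/-- The coordinate expression of `J`. -/
def chartJ (l : ι) (y : Model n) : Model n →L[ℝ] Model n :=
  (-2 : ℝ) • ∑ α, ((Complex.reCLM.comp (A.contactCoef l α y)).smulRight
      (vfIn (A.chart l) (fun x => imT (A.Z l α x)) y) +
    (Complex.imCLM.comp (A.contactCoef l α y)).smulRight
      (vfIn (A.chart l) (fun x => reT (A.Z l α x)) y))

/-- The coordinate expression of the adapted metric. -/
def chartMetric (l : ι) (y : Model n) : Model n →L[ℝ] Model n →L[ℝ] ℝ :=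
  (stdForm n y).smulRight (stdForm n y) +
    ((ContinuousLinearMap.compL ℝ (Model n) (Model n) ℝ).flip (A.chartJ l y)).comp (stdOmega n)

theorem chartMetric_apply (l : ι) (y a b : Model n) : A.chartMetric l y a b =
    stdForm n y a * stdForm n y b + stdOmega n a (A.chartJ l y b) := rfl

theorem dChart_J (hx : x ∈ (A.chart l).source) (v : TS n x) :
    dChart (A.chart l) x (C.J x v) = A.chartJ l (A.chart l x) (dChart (A.chart l) x v) := by
  have h1 : ∀ α, A.contactCoef l α (A.chart l x) (dChart (A.chart l) x v) =
      A.ev l α x (C.holPart x v) := by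
    intro α
    rw [A.ev_holPart hx, ← formIn_apply (A.chart_mem l) (A.θ l α) hx, map_sub, map_smul,
      A.dChart_reeb hx, A.η_eq hx]
    rfl
  have h2 := A.hol_eq_sum hx (A.holPart_spec hx v).1
  rw [J_eq]
  conv_lhs => rw [h2]
  simp only [map_smul, map_sum, imT_smul, map_add]
  simp only [chartJ, smul_apply, sum_apply,
    add_apply, ContinuousLinearMap.smulRight_apply, ContinuousLinearMap.comp_apply, h1,
    vfIn_apply _ hx, Complex.reCLM_apply, Complex.imCLM_apply]

theorem chartMetric_dChart (hx : x ∈ (A.chart l).source) (v w : TS n x) :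
    A.chartMetric l (A.chart l x) (dChart (A.chart l) x v) (dChart (A.chart l) x w) =
      C.metric x v w := by
  rw [chartMetric_apply, ← A.dChart_J hx, ← A.extD_η hx, ← A.η_eq hx, ← A.η_eq hx]
  rfl

theorem chartMetric_symm {y : Model n} (hy : y ∈ (A.chart l).target) (a b : Model n) :
    A.chartMetric l y a b = A.chartMetric l y b a := by
  have hx := (A.chart l).map_target hy
  obtain ⟨v, rfl⟩ := dChart_surjective (A.chart_mem l) hx a
  obtain ⟨w, rfl⟩ := dChart_surjective (A.chart_mem l) hx b
  have h1 := A.chartMetric_dChart hx v w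
  have h2 := A.chartMetric_dChart hx w v
  rw [(A.chart l).right_inv hy] at h1 h2
  rw [h1, h2, A.metric_symm hx]

theorem chartMetric_pos {y : Model n} (hy : y ∈ (A.chart l).target) {a : Model n} (ha : a ≠ 0) :
    0 < A.chartMetric l y a a := by
  have hx := (A.chart l).map_target hy
  obtain ⟨v, rfl⟩ := dChart_surjective (A.chart_mem l) hx a
  have h1 := A.chartMetric_dChart hx v v
  rw [(A.chart l).right_inv hy] at h1
  rw [h1]
  exact A.metric_pos hx fun h => ha (by rw [h, map_zero])

theorem chartMetric_contDiffOn : ContDiffOn ℝ ∞ (A.chartMetric l) (A.chart l).target := by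
  rw [contDiffOn_clm_apply]
  intro a y hy
  refine ContDiffAt.contDiffWithinAt ?_
  have hx := (A.chart l).map_target hy
  have hs : ContDiffAt ℝ ∞ (stdForm n) y := contDiff_stdForm.contDiffAt
  have hr : ∀ α, ContDiffAt ℝ ∞ (vfIn (A.chart l) fun x => reT (A.Z l α x)) y := fun α => by
    have h := vfIn_contDiffAt (A.chart_mem l) (k := ∞) (by simp) (A.Z_smooth l α).1
      (A.chart l).open_source hx hx
    rwa [(A.chart l).right_inv hy] at h
  have hi : ∀ α, ContDiffAt ℝ ∞ (vfIn (A.chart l) fun x => imT (A.Z l α x)) y := fun α => by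
    have h := vfIn_contDiffAt (A.chart_mem l) (k := ∞) (by simp) (A.Z_smooth l α).2
      (A.chart l).open_source hx hx
    rwa [(A.chart l).right_inv hy] at h
  have hθ : ∀ α, ContDiffAt ℝ ∞ (formIn (A.chart l) (A.θ l α)) y := fun α => by
    have h := formIn_contDiffAt (A.chart_mem l) (A.θ_smooth l α) hx hx
    rwa [(A.chart l).right_inv hy] at h
  have hc : ∀ α, ContDiffAt ℝ ∞ (A.contactCoef l α) y := fun α =>
    (hθ α).clm_comp (contDiffAt_const.sub (hs.smulRight contDiffAt_const))
  have hJ : ContDiffAt ℝ ∞ (A.chartJ l) y := by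
    refine ContDiffAt.const_smul _ (ContDiffAt.sum fun α _ => ContDiffAt.add ?_ ?_)
    · exact (contDiffAt_const.clm_comp (hc α)).smulRight (hi α)
    · exact (contDiffAt_const.clm_comp (hc α)).smulRight (hr α)
  exact ((hs.clm_apply contDiffAt_const).smul hs).add
    ((contDiffAt_const (c := stdOmega n a)).clm_comp hJ)

theorem chartMetric_contDiffAt {y : Model n} (hy : y ∈ (A.chart l).target) :
    ContDiffAt ℝ ∞ (A.chartMetric l) y :=
  A.chartMetric_contDiffOn.contDiffAt ((A.chart l).open_target.mem_nhds hy)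

end AdaptedAtlas

end CRDef

end

open scoped Manifold ContDiff TensorProduct ENNReal Topology
noncomputable section
namespace CRDef
open Set Filter
set_option linter.unusedSectionVars false
set_option maxSynthPendingDepth 3

/-! ### The geodesic equation -/

section GeodesicEquation

variable {E : Type*} [NormedAddCommGroup E] [NormedSpace ℝ E]

/-- The Euler-Lagrange expression of the energy of `G` at a curve with position `y`, velocity `p`
and acceleration `r`. -/
def eulerLagrange (G : E → E →L[ℝ] E →L[ℝ] ℝ) (y p r w : E) : ℝ :=
  fderiv ℝ G y p p w + G y r w - (1 / 2) * fderiv ℝ G y w p p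

/-- The Euler–Lagrange expression transforms as a covector: the two contributions of D²τ cancel by
the symmetry of D²τ and of G. Geodesics, defined through the preferred chart at each of their
points, can thus be studied in a fixed chart. -/
theorem eulerLagrange_transition {G : E → E →L[ℝ] E →L[ℝ] ℝ} {τ : E → E} {c : ℝ → E} {t₀ : ℝ}
    (hτ : ContDiffAt ℝ 2 τ (c t₀)) (hc : ContDiffAt ℝ 2 c t₀) (hG : DifferentiableAt ℝ G (τ (c t₀)))
    (hs : ∀ a b, G (τ (c t₀)) a b = G (τ (c t₀)) b a) (w : E) :
    deriv (fun t => G (τ (c t)) (fderiv ℝ τ (c t) (deriv c t)) (fderiv ℝ τ (c t) w)) t₀ -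
      (1 / 2) * fderiv ℝ (fun z => G (τ z) (fderiv ℝ τ z (deriv c t₀))
        (fderiv ℝ τ z (deriv c t₀))) (c t₀) w =
    eulerLagrange G (τ (c t₀)) (deriv (τ ∘ c) t₀) (deriv (deriv (τ ∘ c)) t₀)
      (fderiv ℝ τ (c t₀) w) := by
  have hτ1 : ∀ᶠ z in 𝓝 (c t₀), DifferentiableAt ℝ τ z :=
    (hτ.eventually (by simp)).mono fun z hz => hz.differentiableAt (by simp)
  have hc1 : ∀ᶠ t in 𝓝 t₀, DifferentiableAt ℝ c t :=
    (hc.eventually (by simp)).mono fun z hz => hz.differentiableAt (by simp)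
  have hd : ∀ᶠ t in 𝓝 t₀, deriv (τ ∘ c) t = fderiv ℝ τ (c t) (deriv c t) := by
    filter_upwards [hc1, hc.continuousAt.eventually hτ1] with t h1 h2
    exact fderiv_comp_deriv t h2 h1
  have hτ0 : HasFDerivAt τ (fderiv ℝ τ (c t₀)) (c t₀) := hτ1.self_of_nhds.hasFDerivAt
  have hτ' : HasFDerivAt (fderiv ℝ τ) (fderiv ℝ (fderiv ℝ τ) (c t₀)) (c t₀) :=
    ((hτ.fderiv_right (m := 1) (by rw [one_add_one_eq_two])).differentiableAt
      (by simp)).hasFDerivAt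
  have hc0 : HasDerivAt c (deriv c t₀) t₀ := hc1.self_of_nhds.hasDerivAt
  have hcc : ContDiffAt ℝ 2 (τ ∘ c) t₀ := hτ.comp t₀ hc
  have hcc1 : HasDerivAt (τ ∘ c) (deriv (τ ∘ c) t₀) t₀ :=
    (hcc.differentiableAt (by simp)).hasDerivAt
  have hcc2 : HasDerivAt (deriv (τ ∘ c)) (deriv (deriv (τ ∘ c)) t₀) t₀ :=
    ((ContDiffAt.derivWithin (m := 1) hcc (by rw [one_add_one_eq_two])).differentiableAt (by simp)).hasDerivAt
  have hDw : HasDerivAt (fun t => fderiv ℝ τ (c t) w)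
      (fderiv ℝ (fderiv ℝ τ) (c t₀) (deriv c t₀) w) t₀ := by
    have h := hτ'.comp_hasDerivAt t₀ hc0
    simpa using h.clm_apply (hasDerivAt_const t₀ w)
  have hGc : HasDerivAt (fun t => G (τ (c t))) (fderiv ℝ G (τ (c t₀)) (deriv (τ ∘ c) t₀)) t₀ :=
    HasFDerivAt.comp_hasDerivAt (f := τ ∘ c) t₀ (l := G) hG.hasFDerivAt hcc1
  have h1 : deriv (fun t => G (τ (c t)) (fderiv ℝ τ (c t) (deriv c t)) (fderiv ℝ τ (c t) w)) t₀ =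
      fderiv ℝ G (τ (c t₀)) (deriv (τ ∘ c) t₀) (deriv (τ ∘ c) t₀) (fderiv ℝ τ (c t₀) w) +
      G (τ (c t₀)) (deriv (deriv (τ ∘ c)) t₀) (fderiv ℝ τ (c t₀) w) +
      G (τ (c t₀)) (deriv (τ ∘ c) t₀) (fderiv ℝ (fderiv ℝ τ) (c t₀) (deriv c t₀) w) := by
    have h2 := ((hGc.clm_apply hcc2).clm_apply hDw)
    have h3 : (fun t => G (τ (c t)) (fderiv ℝ τ (c t) (deriv c t)) (fderiv ℝ τ (c t) w)) =ᶠ[𝓝 t₀]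
        fun t => G (τ (c t)) (deriv (τ ∘ c) t) (fderiv ℝ τ (c t) w) := by
      filter_upwards [hd] with t ht
      rw [ht]
    rw [h3.deriv_eq, h2.deriv]
    simp only [add_apply]
  have h4 : fderiv ℝ (fun z => G (τ z) (fderiv ℝ τ z (deriv c t₀))
        (fderiv ℝ τ z (deriv c t₀))) (c t₀) w =
      fderiv ℝ G (τ (c t₀)) (fderiv ℝ τ (c t₀) w) (deriv (τ ∘ c) t₀) (deriv (τ ∘ c) t₀) +
      2 * G (τ (c t₀)) (deriv (τ ∘ c) t₀) (fderiv ℝ (fderiv ℝ τ) (c t₀) (deriv c t₀) w) := by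
    have hu : HasFDerivAt (fun z => fderiv ℝ τ z (deriv c t₀))
        ((fderiv ℝ (fderiv ℝ τ) (c t₀)).flip (deriv c t₀)) (c t₀) := by
      have h := hτ'.clm_apply (hasFDerivAt_const (deriv c t₀) (c t₀))
      refine h.congr_fderiv ?_
      ext v; simp
    have hsym : fderiv ℝ (fderiv ℝ τ) (c t₀) w (deriv c t₀) =
        fderiv ℝ (fderiv ℝ τ) (c t₀) (deriv c t₀) w :=
      (hτ.isSymmSndFDerivAt (by simp)).eq w (deriv c t₀)
    have h5 := (((hG.hasFDerivAt.comp (c t₀) hτ0).clm_apply hu).clm_apply hu)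
    have h6 := congrArg (fun L : E →L[ℝ] ℝ => L w) h5.fderiv
    refine h6.trans ?_
    simp only [add_apply, ContinuousLinearMap.comp_apply, ContinuousLinearMap.flip_apply,
      Function.comp_apply, hsym, ← hd.self_of_nhds]
    rw [hs (fderiv ℝ (fderiv ℝ τ) (c t₀) (deriv c t₀) w)]
    ring
  rw [h1, h4, eulerLagrange]
  ring

/-- The right-hand side of the geodesic equation, with lowered index. -/
def sprayForm (G : E → E →L[ℝ] E →L[ℝ] ℝ) (y p : E) : E →L[ℝ] ℝ :=
  (1 / 2 : ℝ) • ((fderiv ℝ G y).flip p).flip p - fderiv ℝ G y p p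

/-- The right-hand side of the geodesic equation `c'' = spray G c c'`. -/
def spray (G : E → E →L[ℝ] E →L[ℝ] ℝ) (y p : E) : E := (G y).inverse (sprayForm G y p)

theorem isInvertible_of_pos [FiniteDimensional ℝ E] {L : E →L[ℝ] E →L[ℝ] ℝ}
    (h : ∀ a, a ≠ 0 → 0 < L a a) : L.IsInvertible := by
  have hinj : Function.Injective L.toLinearMap := by
    rw [injective_iff_map_eq_zero]
    intro a ha
    by_contra h0
    have h1 := h a h0
    have h2 : L a = 0 := ha
    rw [h2] at h1
    exact lt_irrefl _ h1
  have hf : Module.finrank ℝ E = Module.finrank ℝ (E →L[ℝ] ℝ) := by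
    rw [← (LinearMap.toContinuousLinearMap (𝕜 := ℝ) (E := E) (F' := ℝ)).finrank_eq]
    exact (Subspace.dual_finrank_eq (K := ℝ) (V := E)).symm
  have : FiniteDimensional ℝ (E →L[ℝ] ℝ) :=
    (LinearMap.toContinuousLinearMap (𝕜 := ℝ) (E := E) (F' := ℝ)).finiteDimensional
  refine ⟨(LinearEquiv.ofInjectiveOfFinrankEq L.toLinearMap hinj hf).toContinuousLinearEquiv, ?_⟩
  ext a b
  rfl

theorem eulerLagrange_eq_zero_iff [FiniteDimensional ℝ E] {G : E → E →L[ℝ] E →L[ℝ] ℝ} {y : E}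
    (hG : ∀ a, a ≠ 0 → 0 < G y a a) (p r : E) :
    (∀ w, eulerLagrange G y p r w = 0) ↔ r = spray G y p := by
  obtain ⟨e, he⟩ := isInvertible_of_pos hG
  have h1 : (∀ w, eulerLagrange G y p r w = 0) ↔ G y r = sprayForm G y p := by
    rw [ContinuousLinearMap.ext_iff]
    refine forall_congr' fun w => ?_
    simp only [eulerLagrange, sprayForm, sub_apply, smul_apply, ContinuousLinearMap.flip_apply,
      smul_eq_mul]
    constructor <;> intro h <;> linarith
  rw [h1, spray, ← he, ContinuousLinearMap.inverse_equiv]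
  exact (e.eq_symm_apply).symm

/-- The spray is quadratic in the velocity. This is what makes a rescaling of time turn geodesics
into geodesics. -/
theorem spray_smul (G : E → E →L[ℝ] E →L[ℝ] ℝ) (y p : E) (a : ℝ) :
    spray G y (a • p) = a ^ 2 • spray G y p := by
  have h : sprayForm G y (a • p) = a ^ 2 • sprayForm G y p := by
    ext w
    simp only [sprayForm, sub_apply, smul_apply, ContinuousLinearMap.flip_apply, map_smul,
      smul_eq_mul]
    ring
  rw [spray, h, map_smul, spray]

theorem contDiffAt_spray [FiniteDimensional ℝ E] {G : E → E →L[ℝ] E →L[ℝ] ℝ} {T : Set E}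
    (hT : IsOpen T) (hG : ContDiffOn ℝ ∞ G T) (hpos : ∀ y ∈ T, ∀ a, a ≠ 0 → 0 < G y a a)
    {z : E × E} (hz : z.1 ∈ T) : ContDiffAt ℝ 1 (fun z : E × E => spray G z.1 z.2) z := by
  have : CompleteSpace E := FiniteDimensional.complete ℝ E
  have hGz : ContDiffAt ℝ ∞ G z.1 := hG.contDiffAt (hT.mem_nhds hz)
  have hopen : IsOpen (Prod.fst ⁻¹' T : Set (E × E)) := hT.preimage continuous_fst
  have hform : ContDiffOn ℝ 1 (fun z : E × E => sprayForm G z.1 z.2) (Prod.fst ⁻¹' T) := by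
    rw [contDiffOn_clm_apply]
    intro w x hx
    refine ContDiffAt.contDiffWithinAt ?_
    have hGx : ContDiffAt ℝ ∞ G x.1 := hG.contDiffAt (hT.mem_nhds hx)
    have hD : ContDiffAt ℝ 1 (fun z : E × E => fderiv ℝ G z.1) x :=
      (hGx.fderiv_right (m := 1) one_add_one_le_infty).comp x contDiffAt_fst
    have h2 : ContDiffAt ℝ 1 (fun z : E × E => z.2) x := contDiffAt_snd
    exact (contDiffAt_const.mul (((hD.clm_apply contDiffAt_const).clm_apply h2).clm_apply h2)).sub
      (((hD.clm_apply h2).clm_apply h2).clm_apply contDiffAt_const)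
  have hinv : ContDiffAt ℝ 1 (fun z : E × E => (G z.1).inverse) z := by
    obtain ⟨e, he⟩ := isInvertible_of_pos (hpos z.1 hz)
    have h1 : ContDiffAt ℝ 1 ContinuousLinearMap.inverse (G z.1) := by
      rw [← he]; exact contDiffAt_map_inverse e
    exact ContDiffAt.comp z (f := fun z : E × E => G z.1) h1
      ((hGz.of_le (by simp)).comp z contDiffAt_fst)
  exact hinv.clm_apply (hform.contDiffAt (hopen.mem_nhds hz))

end GeodesicEquation

end CRDef

end

open scoped Manifold ContDiff TensorProduct ENNReal Topology
noncomputable section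
namespace CRDef
open Set Filter
set_option linter.unusedSectionVars false
set_option maxSynthPendingDepth 3

/-! ### Second-order equations with small initial velocity -/

section SecondOrder

/-- A field bounded by B moves a point by at most 2B in time 2, so a ball of radius 2B is never left
and Picard–Lindelöf applies on all of [−2, 2]. -/
theorem exists_flow {W : Type*} [NormedAddCommGroup W] [NormedSpace ℝ W] [CompleteSpace W]
    {v : W → W} {L B : NNReal} (hL : LipschitzWith L v) (hB : ∀ z, ‖v z‖ ≤ B) (z₀ : W) :
    ∃ α : ℝ → W, α 0 = z₀ ∧ ∀ t ∈ Ioo (-2 : ℝ) 2, HasDerivAt α (v (α t)) t := by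
  have h : IsPicardLindelof (fun _ : ℝ => v) (tmin := -2) (tmax := 2) ⟨0, by norm_num⟩ z₀
      (B * 2) 0 B L :=
    { lipschitzOnWith := fun _ _ => hL.lipschitzOnWith
      continuousOn := fun _ _ => continuousOn_const
      norm_le := fun _ _ z _ => hB z
      mul_max_le := by simp }
  obtain ⟨α, h0, hα⟩ := h.exists_eq_forall_mem_Icc_hasDerivWithinAt₀
  exact ⟨α, h0, fun t ht => (hα t (Ioo_subset_Icc_self ht)).hasDerivAt
    (Icc_mem_nhds ht.1 ht.2)⟩

theorem norm_sub_le_of_hasDerivAt {W : Type*} [NormedAddCommGroup W] [NormedSpace ℝ W]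
    {α β : ℝ → W} {B a b : ℝ} (h : ∀ t ∈ uIcc a b, HasDerivAt α (β t) t)
    (hB : ∀ t ∈ uIcc a b, ‖β t‖ ≤ B) : ‖α b - α a‖ ≤ B * |b - a| :=
  (convex_uIcc a b).norm_image_sub_le_of_norm_hasDerivWithin_le
    (fun t ht => (h t ht).hasDerivWithinAt) hB left_mem_uIcc right_mem_uIcc

variable {E : Type*} [NormedAddCommGroup E] [NormedSpace ℝ E] [FiniteDimensional ℝ E]

/-- The second-order equation is only defined over T. A cut-off in position and velocity makes it a
compactly supported C¹ field, hence bounded and globally Lipschitz, without changing it near K at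
speeds up to 2. -/
theorem exists_truncation {T K : Set E} (hT : IsOpen T) (hK : IsCompact K) (hKT : K ⊆ T)
    {f : E × E → E} (hf : ∀ z : E × E, z.1 ∈ T → ContDiffAt ℝ 1 f z) :
    ∃ v : E × E → E × E, ContDiff ℝ 1 v ∧ HasCompactSupport v ∧ ∃ r > 0, r ≤ 1 ∧
      ∀ y ∈ K, ∀ z : E × E, dist z.1 y ≤ r → ‖z.2‖ ≤ 2 → z.1 ∈ T ∧ v z = (z.2, f z) := by
  have : ProperSpace E := FiniteDimensional.proper ℝ E
  obtain ⟨K', hK', hKK', hK'T⟩ := exists_compact_between hK hT hKT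
  obtain ⟨r₀, hr₀, hr₀'⟩ := hK.exists_cthickening_subset_open isOpen_interior hKK'
  set r := min r₀ 1 with hr
  have hrK : Metric.cthickening r K ⊆ interior K' :=
    (Metric.cthickening_mono (min_le_left _ _) K).trans hr₀'
  obtain ⟨χ, hχs, -, hχ, hχ1⟩ :=
    exists_contMDiff_support_eq_eq_one_iff (𝓘(ℝ, E × E)) (n := (⊤ : ℕ∞))
      (s := interior K' ×ˢ Metric.ball (0 : E) 4)
      (t := Metric.cthickening r K ×ˢ Metric.closedBall (0 : E) 2)
      (isOpen_interior.prod Metric.isOpen_ball)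
      (Metric.isClosed_cthickening.prod Metric.isClosed_closedBall)
      (prod_mono hrK (Metric.closedBall_subset_ball (by norm_num)))
  have hχd : ContDiff ℝ ∞ χ := hχs.contDiff
  have hcpt : IsCompact (K' ×ˢ Metric.closedBall (0 : E) 4) :=
    hK'.prod (isCompact_closedBall _ _)
  have hts : tsupport χ ⊆ K' ×ˢ Metric.closedBall (0 : E) 4 := by
    refine closure_minimal ?_ hcpt.isClosed
    rw [hχ]
    exact prod_mono interior_subset Metric.ball_subset_closedBall
  have hχc : HasCompactSupport χ := hcpt.of_isClosed_subset (isClosed_tsupport _) hts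
  refine ⟨fun z => χ z • (z.2, f z), ?_, hχc.smul_right, r, lt_min hr₀ one_pos,
    min_le_right _ _, ?_⟩
  · rw [contDiff_iff_contDiffAt]
    intro z
    by_cases hz : z ∈ tsupport χ
    · have hzT : z.1 ∈ T := hK'T (hts hz).1
      exact (hχd.contDiffAt.of_le (by simp)).smul (contDiffAt_snd.prodMk (hf z hzT))
    · have h0 : (fun z : E × E => χ z • (z.2, f z)) =ᶠ[𝓝 z] fun _ => 0 := by
        filter_upwards [(isClosed_tsupport χ).isOpen_compl.mem_nhds hz] with w hw
        rw [image_eq_zero_of_notMem_tsupport hw, zero_smul]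
      exact contDiffAt_const.congr_of_eventuallyEq h0
  · intro y hy z hz1 hz2
    have h1 : z.1 ∈ Metric.cthickening r K := Metric.mem_cthickening_of_dist_le z.1 y r K hy hz1
    refine ⟨hK'T (interior_subset (hrK h1)), ?_⟩
    have h2 : χ z = 1 := (hχ1 z).1 ⟨h1, by simpa using hz2⟩
    simp only [h2, one_smul]

/-- The deviation from the straight line y + tq vanishes at t = 0 together with its velocity, so two
integrations give the factor t². For the difference of two solutions the same argument applies to a
bound from Grönwall's inequality, and the Lipschitz constant of the field enters. -/
theorem exists_scaled_flow {T K : Set E} (hT : IsOpen T) (hK : IsCompact K) (hKT : K ⊆ T)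
    {f : E × E → E} (hf : ∀ z : E × E, z.1 ∈ T → ContDiffAt ℝ 1 f z) :
    ∃ s₀ > 0, ∃ B : ℝ, 0 ≤ B ∧ ∃ z : E × E → ℝ → E × E,
      (∀ y ∈ K, ∀ q, ‖q‖ ≤ 1 → z (y, q) 0 = (y, q) ∧ (∀ t ∈ Ioo (-(2 * s₀)) (2 * s₀),
        (z (y, q) t).1 ∈ T ∧ HasDerivAt (z (y, q)) ((z (y, q) t).2, f (z (y, q) t)) t) ∧
        ∀ t ∈ Icc 0 s₀, ‖(z (y, q) t).1 - y - t • q‖ ≤ B * t ^ 2) ∧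
      ∀ y ∈ K, ∀ q, ‖q‖ ≤ 1 → ∀ y' ∈ K, ∀ q', ‖q'‖ ≤ 1 → ∀ t ∈ Icc 0 s₀,
        ‖((z (y, q) t).1 - y - t • q) - ((z (y', q') t).1 - y' - t • q')‖ ≤
          B * t ^ 2 * (‖y - y'‖ + ‖q - q'‖) := by
  have : CompleteSpace E := FiniteDimensional.complete ℝ E
  obtain ⟨v, hv, hvc, r, hr, hr1, hvr⟩ := exists_truncation hT hK hKT hf
  obtain ⟨L, hL⟩ := hv.lipschitzWith_of_hasCompactSupport hvc (by simp)
  obtain ⟨B, hB⟩ := hv.continuous.bounded_above_of_compact_support hvc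
  have hB0 : 0 ≤ B := (norm_nonneg _).trans (hB 0)
  lift B to NNReal using hB0
  choose z hz0 hz using exists_flow hL hB
  -- During time 2s₀ the state moves by at most 2Bs₀ ≤ r ≤ 1, so positions stay within r of y and
  -- speeds within 1 + r ≤ 2: the truncation is never felt.
  set s₀ : ℝ := min 1 (r / (2 * (B + 1))) with hs
  have hs0 : 0 < s₀ := lt_min one_pos (by positivity)
  have hs1 : s₀ ≤ 1 := min_le_left _ _
  have hsr : B * (2 * s₀) ≤ r := by
    have h1 : s₀ ≤ r / (2 * (B + 1)) := min_le_right _ _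
    rw [le_div_iff₀ (by positivity)] at h1
    nlinarith [B.2, hs0]
  have hmove : ∀ w : E × E, ∀ t ∈ Ioo (-2 : ℝ) 2, ‖z w t - w‖ ≤ B * |t| := by
    intro w t ht
    have h1 : uIcc 0 t ⊆ Ioo (-2 : ℝ) 2 := ordConnected_Ioo.uIcc_subset (by norm_num) ht
    have h := norm_sub_le_of_hasDerivAt (fun τ hτ => hz w τ (h1 hτ)) (fun τ _ => hB _)
    rwa [hz0, sub_zero] at h
  have hIoo : ∀ t ∈ Ioo (-(2 * s₀)) (2 * s₀), t ∈ Ioo (-2 : ℝ) 2 := fun t ht =>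
    ⟨by linarith [ht.1], by linarith [ht.2]⟩
  have hIcc : ∀ t ∈ Icc 0 s₀, t ∈ Ioo (-2 : ℝ) 2 := fun t ht =>
    ⟨by linarith [ht.1], by linarith [ht.2]⟩
  have hfst : ∀ w : E × E, ∀ t ∈ Ioo (-2 : ℝ) 2,
      HasDerivAt (fun t => (z w t).1) (v (z w t)).1 t := fun w t ht =>
    (ContinuousLinearMap.fst ℝ E E).hasFDerivAt.comp_hasDerivAt t (hz w t ht)
  have hsnd : ∀ w : E × E, ∀ t ∈ Ioo (-2 : ℝ) 2,
      HasDerivAt (fun t => (z w t).2) (v (z w t)).2 t := fun w t ht =>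
    (ContinuousLinearMap.snd ℝ E E).hasFDerivAt.comp_hasDerivAt t (hz w t ht)
  have hreg : ∀ y ∈ K, ∀ q, ‖q‖ ≤ 1 → ∀ t ∈ Ioo (-(2 * s₀)) (2 * s₀),
      (z (y, q) t).1 ∈ T ∧ v (z (y, q) t) = ((z (y, q) t).2, f (z (y, q) t)) := by
    intro y hy q hq t ht
    have h1 := hmove (y, q) t (hIoo t ht)
    have h2 : B * |t| ≤ r := by
      refine le_trans ?_ hsr
      have : |t| ≤ 2 * s₀ := (abs_lt.2 ht).le
      gcongr
    have h3 := (norm_fst_le (z (y, q) t - (y, q))).trans (h1.trans h2)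
    have h4 := (norm_snd_le (z (y, q) t - (y, q))).trans (h1.trans h2)
    refine hvr y hy _ (by rw [dist_eq_norm]; exact h3) ?_
    have h5 : (z (y, q) t).2 = ((z (y, q) t).2 - q) + q := by abel
    rw [h5]
    refine (norm_add_le _ _).trans ?_
    have h6 : ‖(z (y, q) t).2 - q‖ ≤ r := h4
    linarith
  have hregIcc : ∀ t ∈ Icc 0 s₀, t ∈ Ioo (-(2 * s₀)) (2 * s₀) := fun t ht =>
    ⟨by linarith [ht.1], by linarith [ht.2]⟩
  have hg : ∀ y ∈ K, ∀ q, ‖q‖ ≤ 1 → ∀ t ∈ Icc 0 s₀,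
      HasDerivAt (fun t => (z (y, q) t).1 - y - t • q) ((z (y, q) t).2 - q) t := by
    intro y hy q hq t ht
    have h1 := hfst (y, q) t (hIcc t ht)
    rw [(hreg y hy q hq t (hregIcc t ht)).2] at h1
    have h2 := (h1.sub_const y).sub ((hasDerivAt_id t).smul_const q)
    rwa [one_smul] at h2
  have hsub : ∀ t ∈ Icc 0 s₀, ∀ τ ∈ uIcc 0 t, τ ∈ Icc 0 s₀ ∧ |τ| ≤ t := by
    intro t ht τ hτ
    rw [uIcc_of_le ht.1] at hτ
    exact ⟨⟨hτ.1, hτ.2.trans ht.2⟩, by rw [abs_of_nonneg hτ.1]; exact hτ.2⟩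
  -- B serves the bound for one solution, L e^L the bound for the difference of two.
  set B' : ℝ := B + L * Real.exp L with hB'
  have hB'0 : 0 ≤ B' := by positivity
  refine ⟨s₀, hs0, B', hB'0, z, fun y hy q hq => ⟨hz0 _, fun t ht => ?_, fun t ht => ?_⟩, ?_⟩
  · have h := hz (y, q) t (hIoo t ht)
    rw [(hreg y hy q hq t ht).2] at h
    exact ⟨(hreg y hy q hq t ht).1, h⟩
  · have h := norm_sub_le_of_hasDerivAt (α := fun t => (z (y, q) t).1 - y - t • q)
      (fun τ hτ => hg y hy q hq τ (hsub t ht τ hτ).1) (B := B * t) (fun τ hτ => by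
        have h1 := (norm_snd_le _).trans (hmove (y, q) τ (hIcc τ (hsub t ht τ hτ).1))
        refine le_trans h1 ?_
        gcongr
        exact (hsub t ht τ hτ).2)
    simp only [hz0, sub_self, zero_smul, sub_zero, abs_of_nonneg ht.1] at h
    refine h.trans ?_
    have : 0 ≤ L * Real.exp L * t ^ 2 := by positivity
    rw [hB']; nlinarith
  · intro y hy q hq y' hy' q' hq' t ht
    set δ : ℝ := ‖y - y'‖ + ‖q - q'‖ with hδ
    have hδ0 : 0 ≤ δ := by positivity
    have hdist : ∀ τ ∈ Icc (0 : ℝ) 1, ‖z (y, q) τ - z (y', q') τ‖ ≤ δ * Real.exp L := by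
      intro τ hτ
      have hI : ∀ τ ∈ Icc (0 : ℝ) 1, τ ∈ Ioo (-2 : ℝ) 2 := fun τ hτ =>
        ⟨by linarith [hτ.1], by linarith [hτ.2]⟩
      have h := dist_le_of_trajectories_ODE (v := fun _ : ℝ => v) (a := 0) (b := 1)
        (f := z (y, q)) (g := z (y', q')) (δ := δ) (fun _ => hL)
        (fun s hs => (hz _ s (hI s hs)).continuousAt.continuousWithinAt)
        (fun s hs => (hz _ s (hI s (Ico_subset_Icc_self hs))).hasDerivWithinAt)
        (fun s hs => (hz _ s (hI s hs)).continuousAt.continuousWithinAt)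
        (fun s hs => (hz _ s (hI s (Ico_subset_Icc_self hs))).hasDerivWithinAt)
        (by rw [hz0, hz0, dist_eq_norm, Prod.norm_def]
            exact max_le (by simp [hδ]) (by simp [hδ])) τ hτ
      rw [dist_eq_norm, sub_zero] at h
      refine h.trans ?_
      have h7 : (L : ℝ) * τ ≤ L := mul_le_of_le_one_right L.2 hτ.2
      gcongr
    have hI1 : ∀ τ ∈ Icc 0 s₀, τ ∈ Icc (0 : ℝ) 1 := fun τ hτ => ⟨hτ.1, hτ.2.trans hs1⟩
    have hk : ∀ τ ∈ uIcc 0 t,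
        ‖((z (y, q) τ).2 - q) - ((z (y', q') τ).2 - q')‖ ≤ L * Real.exp L * δ * t := by
      intro τ hτ
      obtain ⟨h1, h2⟩ := hsub t ht τ hτ
      have h := norm_sub_le_of_hasDerivAt (a := 0) (b := τ)
        (α := fun τ => ((z (y, q) τ).2 - q) - ((z (y', q') τ).2 - q'))
        (β := fun τ => (v (z (y, q) τ)).2 - (v (z (y', q') τ)).2) (B := L * Real.exp L * δ)
        (fun σ hσ => ((hsnd _ σ (hIcc σ (hsub τ h1 σ hσ).1)).sub_const q).sub
          ((hsnd _ σ (hIcc σ (hsub τ h1 σ hσ).1)).sub_const q'))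
        (fun σ hσ => by
          have h3 := hdist σ (hI1 σ (hsub τ h1 σ hσ).1)
          have h4 := (norm_snd_le _).trans (hL.norm_sub_le (z (y, q) σ) (z (y', q') σ))
          refine le_trans h4 ?_
          calc (L : ℝ) * ‖z (y, q) σ - z (y', q') σ‖ ≤ L * (δ * Real.exp L) := by gcongr
            _ = _ := by ring)
      simp only [hz0, sub_self, sub_zero] at h
      refine h.trans ?_
      gcongr
    have h := norm_sub_le_of_hasDerivAt (a := 0) (b := t)
      (α := fun t => ((z (y, q) t).1 - y - t • q) - ((z (y', q') t).1 - y' - t • q'))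
      (fun τ hτ => (hg y hy q hq τ (hsub t ht τ hτ).1).sub (hg y' hy' q' hq' τ (hsub t ht τ hτ).1))
      hk
    simp only [hz0, sub_self, zero_smul, sub_zero, abs_of_nonneg ht.1] at h
    refine h.trans ?_
    have : 0 ≤ B * t ^ 2 * δ := by positivity
    rw [hB']; nlinarith

end SecondOrder

end CRDef

end

open scoped Manifold ContDiff TensorProduct ENNReal Topology
noncomputable section
namespace CRDef
open Set Filter
set_option linter.unusedSectionVars false
set_option maxSynthPendingDepth 3

/-! ### Geodesics and the exponential map of the adapted metric -/

section Curves

variable {n : ℕ} {M : Type*} [TopologicalSpace M] [ChartedSpace (Model n) M]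
  [IsManifold (𝓡 (2 * n + 1)) ∞ M] {e : OpenPartialHomeomorph M (Model n)}

theorem hasDerivAt_chart_comp (he : IsSmoothChart e) {γ : ℝ → M} {t : ℝ}
    (hγ : MDifferentiableAt 𝓘(ℝ, ℝ) (𝓡 (2 * n + 1)) γ t) (ht : γ t ∈ e.source) :
    HasDerivAt (e ∘ γ)
      (dChart e (γ t) (mfderiv 𝓘(ℝ, ℝ) (𝓡 (2 * n + 1)) γ t (1 : ℝ))) t := by
  have h1 : MDifferentiableAt (𝓡 (2 * n + 1)) 𝓘(ℝ, Model n) e (γ t) :=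
    mdifferentiableAt_of_mem_maximalAtlas he.of_one ht
  have h2 : MDifferentiableAt 𝓘(ℝ, ℝ) 𝓘(ℝ, Model n) (e ∘ γ) t := MDifferentiableAt.comp t h1 hγ
  have h3 : DifferentiableAt ℝ (e ∘ γ) t := mdifferentiableAt_iff_differentiableAt.1 h2
  have h4 := mfderiv_comp t h1 hγ
  have h5 : deriv (e ∘ γ) t =
      dChart e (γ t) (mfderiv 𝓘(ℝ, ℝ) (𝓡 (2 * n + 1)) γ t (1 : ℝ)) := by
    rw [← fderiv_apply_one_eq_deriv]
    have h6 := mfderiv_eq_fderiv (𝕜 := ℝ) (f := e ∘ γ) (x := t)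
    exact (congrArg (fun L : ℝ →L[ℝ] Model n => L 1) h6).symm.trans
      (congrArg (fun L : ℝ →L[ℝ] Model n => L 1) h4)
  rw [← h5]
  exact h3.hasDerivAt

theorem contDiffAt_chart_comp (he : IsSmoothChart e) {γ : ℝ → M} {t : ℝ}
    (hγ : ContMDiffAt 𝓘(ℝ, ℝ) (𝓡 (2 * n + 1)) 2 γ t) (ht : γ t ∈ e.source) :
    ContDiffAt ℝ 2 (e ∘ γ) t := by
  have h1 : ContMDiffAt (𝓡 (2 * n + 1)) 𝓘(ℝ, Model n) 2 e (γ t) :=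
    (contMDiffAt_of_mem_maximalAtlas he ht).of_le two_le_infty
  exact contMDiffAt_iff_contDiffAt.1 (h1.comp t hγ)

theorem tangentBundle_ext (he : IsSmoothChart e) {p q : TangentBundle (𝓡 (2 * n + 1)) M}
    (h1 : p.1 = q.1) (hp : p.1 ∈ e.source) (h2 : dChart e p.1 p.2 = dChart e q.1 q.2) : p = q := by
  obtain ⟨x, v⟩ := p
  obtain ⟨y, w⟩ := q
  change x = y at h1
  subst h1
  have : v = w := dChart_injective he hp h2
  rw [this]

end Curves

namespace AdaptedAtlas

variable {n : ℕ} {M : Type*} [TopologicalSpace M] [ChartedSpace (Model n) M]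
  [IsManifold (𝓡 (2 * n + 1)) ∞ M]
  {C : CRStructure n M} {ι : Type*} [Fintype ι] (A : AdaptedAtlas C ι) {l : ι} {x : M}

theorem metric_eq_transition {e : OpenPartialHomeomorph M (Model n)} (he : IsSmoothChart e)
    {z : Model n} (hz : z ∈ e.target) (hz' : e.symm z ∈ (A.chart l).source) (a b : Model n) :
    C.metric (e.symm z) (dSymm e z a) (dSymm e z b) =
      A.chartMetric l ((A.chart l ∘ e.symm) z) (fderiv ℝ (A.chart l ∘ e.symm) z a)
        (fderiv ℝ (A.chart l ∘ e.symm) z b) := by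
  rw [fderiv_transition he (A.chart_mem l) hz hz', fderiv_transition he (A.chart_mem l) hz hz']
  exact (A.chartMetric_dChart hz' _ _).symm

/-- Near t₀ the coordinate metric of the preferred chart is the pull-back of `chartMetric` by the
coordinate change τ. The weak equation therefore becomes the Euler–Lagrange equation tested on
Dτ(w); Dτ is surjective and the metric is positive, so the acceleration can be solved for. -/
theorem isGeodesic_at_iff (A : AdaptedAtlas C ι) {γ : ℝ → M} {t₀ : ℝ}
    (hγ : ContMDiffAt 𝓘(ℝ, ℝ) (𝓡 (2 * n + 1)) 2 γ t₀) (hl : γ t₀ ∈ (A.chart l).source) :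
    (∀ w : Model n,
      let e := extChartAt (𝓡 (2 * n + 1)) (γ t₀)
      let G : Model n → Model n → Model n → ℝ := fun y a b =>
        C.metric (e.symm y) (mfderiv 𝓘(ℝ, Model n) (𝓡 (2 * n + 1)) e.symm y a)
          (mfderiv 𝓘(ℝ, Model n) (𝓡 (2 * n + 1)) e.symm y b)
      let c : ℝ → Model n := fun t => e (γ t)
      deriv (fun t => G (c t) (deriv c t) w) t₀ =
        (1 / 2) * fderiv ℝ (fun y => G y (deriv c t₀) (deriv c t₀)) (c t₀) w) ↔
    deriv (deriv (A.chart l ∘ γ)) t₀ =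
      spray (A.chartMetric l) (A.chart l (γ t₀)) (deriv (A.chart l ∘ γ) t₀) := by
  set e := chartAt (Model n) (γ t₀) with he_def
  have he : IsSmoothChart e := isSmoothChart_chartAt (γ t₀)
  have hx : γ t₀ ∈ e.source := mem_chart_source _ _
  have hc : ContDiffAt ℝ 2 (e ∘ γ) t₀ := contDiffAt_chart_comp he hγ hx
  have hτ := (contDiffAt_transition he (A.chart_mem l) hx hl).of_le two_le_infty
  have hdom := eventually_transition_dom (e := e) (e' := A.chart l) hx hl
  have hback : e.symm (e (γ t₀)) = γ t₀ := e.left_inv hx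
  have htar : (A.chart l ∘ e.symm) (e (γ t₀)) ∈ (A.chart l).target := by
    rw [Function.comp_apply, hback]; exact (A.chart l).map_source hl
  have key := fun w => eulerLagrange_transition (G := A.chartMetric l) (τ := A.chart l ∘ e.symm)
    (c := e ∘ γ) (t₀ := t₀) hτ hc ((A.chartMetric_contDiffAt htar).differentiableAt (by simp))
    (A.chartMetric_symm htar) w
  have hnear : ∀ᶠ t in 𝓝 t₀, e (γ t) ∈ e.target ∧ e.symm (e (γ t)) ∈ (A.chart l).source :=
    hc.continuousAt.eventually hdom
  have hsrc : ∀ᶠ t in 𝓝 t₀, γ t ∈ e.source :=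
    hγ.continuousAt.eventually (e.open_source.mem_nhds hx)
  have hcomp : (A.chart l ∘ e.symm) ∘ (e ∘ γ) =ᶠ[𝓝 t₀] A.chart l ∘ γ := by
    filter_upwards [hsrc] with t ht
    simp [e.left_inv ht]
  have hd1 : deriv ((A.chart l ∘ e.symm) ∘ (e ∘ γ)) t₀ = deriv (A.chart l ∘ γ) t₀ :=
    hcomp.deriv_eq
  have hd2 : deriv (deriv ((A.chart l ∘ e.symm) ∘ (e ∘ γ))) t₀ =
      deriv (deriv (A.chart l ∘ γ)) t₀ := hcomp.deriv.deriv_eq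
  have hval : (A.chart l ∘ e.symm) ((e ∘ γ) t₀) = A.chart l (γ t₀) := by
    simp [hback]
  rw [hd1, hd2, hval] at key
  have hpos : ∀ a, a ≠ 0 → 0 < A.chartMetric l (A.chart l (γ t₀)) a a := fun a ha =>
    A.chartMetric_pos ((A.chart l).map_source hl) ha
  rw [← eulerLagrange_eq_zero_iff hpos]
  have hsurj : Function.Surjective (fderiv ℝ (A.chart l ∘ e.symm) ((e ∘ γ) t₀)) := by
    intro b
    obtain ⟨v, rfl⟩ := dChart_surjective (A.chart_mem l) hl b
    exact ⟨dChart e (γ t₀) v, fderiv_transition_dChart he (A.chart_mem l) hx hl v⟩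
  refine Iff.trans ?_ hsurj.forall.symm
  refine forall_congr' fun w => ?_
  have hL : (fun t => C.metric (e.symm (e (γ t))) (dSymm e (e (γ t)) (deriv (e ∘ γ) t))
        (dSymm e (e (γ t)) w)) =ᶠ[𝓝 t₀] fun t => A.chartMetric l ((A.chart l ∘ e.symm) ((e ∘ γ) t))
          (fderiv ℝ (A.chart l ∘ e.symm) ((e ∘ γ) t) (deriv (e ∘ γ) t))
          (fderiv ℝ (A.chart l ∘ e.symm) ((e ∘ γ) t) w) := by
    filter_upwards [hnear] with t ht
    exact A.metric_eq_transition he ht.1 ht.2 _ _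
  have hR : (fun y => C.metric (e.symm y) (dSymm e y (deriv (e ∘ γ) t₀))
        (dSymm e y (deriv (e ∘ γ) t₀))) =ᶠ[𝓝 ((e ∘ γ) t₀)] fun z =>
          A.chartMetric l ((A.chart l ∘ e.symm) z)
          (fderiv ℝ (A.chart l ∘ e.symm) z (deriv (e ∘ γ) t₀))
          (fderiv ℝ (A.chart l ∘ e.symm) z (deriv (e ∘ γ) t₀)) := by
    filter_upwards [hdom] with z hz
    exact A.metric_eq_transition he hz.1 hz.2 _ _
  rw [← key w, sub_eq_zero, ← hL.deriv_eq, ← hR.fderiv_eq]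
  exact Iff.rfl

/-- The geodesic vector field. -/
def geodField (l : ι) (z : Model n × Model n) : Model n × Model n :=
  (z.2, spray (A.chartMetric l) z.1 z.2)

theorem contDiffAt_geodField {z : Model n × Model n} (hz : z.1 ∈ (A.chart l).target) :
    ContDiffAt ℝ 1 (A.geodField l) z :=
  contDiffAt_snd.prodMk (contDiffAt_spray (A.chart l).open_target A.chartMetric_contDiffOn
    (fun _ hy _ ha => A.chartMetric_pos hy ha) hz)

theorem hasDerivAt_geodesic (A : AdaptedAtlas C ι) {γ : ℝ → M} {s : Set ℝ} (hs : IsOpen s)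
    (hγ : IsGeodesicOn C.metric γ s) {t : ℝ} (ht : t ∈ s) (hl : γ t ∈ (A.chart l).source) :
    HasDerivAt (fun t => ((A.chart l ∘ γ) t, deriv (A.chart l ∘ γ) t))
      (A.geodField l ((A.chart l ∘ γ) t, deriv (A.chart l ∘ γ) t)) t := by
  have h1 : ContMDiffAt 𝓘(ℝ, ℝ) (𝓡 (2 * n + 1)) 2 γ t := hγ.1.contMDiffAt (hs.mem_nhds ht)
  have h2 := contDiffAt_chart_comp (A.chart_mem l) h1 hl
  have h3 := (A.isGeodesic_at_iff h1 hl).1 (hγ.2 t ht)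
  have h4 : HasDerivAt (deriv (A.chart l ∘ γ)) (deriv (deriv (A.chart l ∘ γ)) t) t :=
    ((ContDiffAt.derivWithin (m := 1) h2 (by rw [one_add_one_eq_two])).differentiableAt
      (by simp)).hasDerivAt
  rw [h3] at h4
  exact (h2.differentiableAt (by simp)).hasDerivAt.prodMk h4

/-- The geodesic field is C¹ on phase space, hence locally Lipschitz, and solutions with the same
position and velocity agree for nearby times. -/
theorem geodesic_eventuallyEq (A : AdaptedAtlas C ι) {γ₁ γ₂ : ℝ → M} {s : Set ℝ} (hs : IsOpen s)
    (h1 : IsGeodesicOn C.metric γ₁ s) (h2 : IsGeodesicOn C.metric γ₂ s) {t : ℝ} (ht : t ∈ s)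
    (hl : γ₁ t ∈ (A.chart l).source) (h0 : γ₁ t = γ₂ t)
    (hd : deriv (A.chart l ∘ γ₁) t = deriv (A.chart l ∘ γ₂) t) : γ₁ =ᶠ[𝓝 t] γ₂ := by
  obtain ⟨L, S, hS, hL⟩ := (A.contDiffAt_geodField (l := l)
    (z := ((A.chart l ∘ γ₁) t, deriv (A.chart l ∘ γ₁) t))
    ((A.chart l).map_source hl)).exists_lipschitzOnWith
  have main : ∀ γ : ℝ → M, IsGeodesicOn C.metric γ s → γ t = γ₁ t →
      deriv (A.chart l ∘ γ) t = deriv (A.chart l ∘ γ₁) t → ∀ᶠ τ in 𝓝 t, γ τ ∈ (A.chart l).source ∧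
      (HasDerivAt (fun t => ((A.chart l ∘ γ) t, deriv (A.chart l ∘ γ) t))
        (A.geodField l ((A.chart l ∘ γ) τ, deriv (A.chart l ∘ γ) τ)) τ ∧
        ((A.chart l ∘ γ) τ, deriv (A.chart l ∘ γ) τ) ∈ S) := by
    intro γ hγ h3 h4
    have hl' : γ t ∈ (A.chart l).source := h3 ▸ hl
    have h5 := (hγ.1.contMDiffAt (hs.mem_nhds ht)).continuousAt.eventually
      ((A.chart l).open_source.mem_nhds hl')
    have h6 := (A.hasDerivAt_geodesic hs hγ ht hl').continuousAt.eventually_mem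
      (s := S) (by rw [Function.comp_apply, h3, h4]; exact hS)
    filter_upwards [h5, h6, hs.mem_nhds ht] with τ h7 h8 h9
    exact ⟨h7, A.hasDerivAt_geodesic hs hγ h9 h7, h8⟩
  have m1 := main γ₁ h1 rfl rfl
  have m2 := main γ₂ h2 h0.symm hd.symm
  have h := ODE_solution_unique_of_eventually (v := fun _ => A.geodField l) (s := fun _ => S)
    (K := L) (Eventually.of_forall fun _ => hL) (m1.mono fun _ h => h.2) (m2.mono fun _ h => h.2)
    (by simp only [Function.comp_apply, hd, h0])
  filter_upwards [h, m1, m2] with τ hτ h3 h4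
  exact (A.chart l).injOn h3.1 h4.1 (congrArg Prod.fst hτ)

/-- The set of times near which the curves coincide is open. It is also closed in the interval: at a
limit time positions agree because M is Hausdorff, velocities agree by continuity in a chart, and
local uniqueness applies again. -/
theorem geodesic_unique [T2Space M] (A : AdaptedAtlas C ι) {γ₁ γ₂ : ℝ → M} {s : Set ℝ}
    (hs : IsOpen s) (hsc : IsPreconnected s)
    (h1 : IsGeodesicOn C.metric γ₁ s) (h2 : IsGeodesicOn C.metric γ₂ s) {t₀ : ℝ} (ht₀ : t₀ ∈ s)
    (hl : γ₁ t₀ ∈ (A.chart l).source) (h0 : γ₁ t₀ = γ₂ t₀)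
    (hd : deriv (A.chart l ∘ γ₁) t₀ = deriv (A.chart l ∘ γ₂) t₀) : ∀ t ∈ s, γ₁ t = γ₂ t := by
  set u : Set ℝ := {t | γ₁ =ᶠ[𝓝 t] γ₂}
  have hu : IsOpen u := isOpen_setOfPred_eventually_nhds
  have hsub : s ⊆ u := by
    refine hsc.subset_of_closure_inter_subset hu
      ⟨t₀, ht₀, A.geodesic_eventuallyEq hs h1 h2 ht₀ hl h0 hd⟩ ?_
    rintro t ⟨htu, ht⟩
    have hf : ∃ᶠ τ in 𝓝 t, τ ∈ u := mem_closure_iff_frequently.1 htu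
    have c1 := h1.1.contMDiffAt (hs.mem_nhds ht)
    have c2 := h2.1.contMDiffAt (hs.mem_nhds ht)
    have he : γ₁ t = γ₂ t := tendsto_nhds_unique_of_frequently_eq c1.continuousAt c2.continuousAt
      (hf.mono fun τ hτ => hτ.self_of_nhds)
    have hm := A.idx_mem (γ₁ t)
    have hm2 : γ₂ t ∈ (A.chart (A.idx (γ₁ t))).source := he ▸ hm
    refine A.geodesic_eventuallyEq hs h1 h2 ht hm he ?_
    have d1 := (ContDiffAt.derivWithin (m := 1) (contDiffAt_chart_comp
      (A.chart_mem (A.idx (γ₁ t))) c1 hm) (by rw [one_add_one_eq_two])).continuousAt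
    have d2 := (ContDiffAt.derivWithin (m := 1) (contDiffAt_chart_comp
      (A.chart_mem (A.idx (γ₁ t))) c2 hm2) (by rw [one_add_one_eq_two])).continuousAt
    exact tendsto_nhds_unique_of_frequently_eq d1 d2
      (hf.mono fun τ hτ => (hτ.fun_comp (A.chart (A.idx (γ₁ t)))).deriv_eq)
  exact fun t ht => (hsub ht).self_of_nhds

theorem IsGeodesicOn.mono {γ : ℝ → M} {s s' : Set ℝ} (h : IsGeodesicOn C.metric γ s')
    (hs : s ⊆ s') : IsGeodesicOn C.metric γ s :=
  ⟨h.1.mono hs, fun t ht => h.2 t (hs ht)⟩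

/-- `expMap` picks some geodesic with the given initial velocity; uniqueness on a common interval
containing [0, 1] shows that the choice does not affect the value at time 1. -/
theorem expMap_eq [T2Space M] (A : AdaptedAtlas C ι) {x : M} {v : TS n x} {γ : ℝ → M}
    (hγ : IsGeodesicFrom C.metric x v γ) : expMap C.metric x v = γ 1 := by
  have hex : ∃ γ : ℝ → M, IsGeodesicFrom C.metric x v γ := ⟨γ, hγ⟩
  rw [expMap, dif_pos hex]
  obtain ⟨⟨ε₁, hε₁, h1⟩, h1'⟩ := hex.choose_spec
  obtain ⟨⟨ε₂, hε₂, h2⟩, h2'⟩ := hγ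
  set γ₁ := hex.choose
  set ε := min ε₁ ε₂ with hε
  have hε0 : 0 < ε := lt_min hε₁ hε₂
  have hm : ∀ ε', ε ≤ ε' → Ioo (-ε) (1 + ε) ⊆ Ioo (-ε') (1 + ε') := fun ε' h =>
    Ioo_subset_Ioo (by linarith) (by linarith)
  have g1 := IsGeodesicOn.mono h1 (hm _ (min_le_left _ _))
  have g2 := IsGeodesicOn.mono h2 (hm _ (min_le_right _ _))
  have hz : (0 : ℝ) ∈ Ioo (-ε) (1 + ε) := ⟨by linarith, by linarith⟩
  have hx1 : γ₁ 0 = x := congrArg (fun p : TangentBundle (𝓡 (2 * n + 1)) M => p.1) h1'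
  have hx2 : γ 0 = x := congrArg (fun p : TangentBundle (𝓡 (2 * n + 1)) M => p.1) h2'
  have hl := A.idx_mem x
  have d1 := (hasDerivAt_chart_comp (A.chart_mem (A.idx x)) ((g1.1.contMDiffAt
    (isOpen_Ioo.mem_nhds hz)).mdifferentiableAt (by simp)) (by rw [hx1]; exact hl)).deriv
  have d2 := (hasDerivAt_chart_comp (A.chart_mem (A.idx x)) ((g2.1.contMDiffAt
    (isOpen_Ioo.mem_nhds hz)).mdifferentiableAt (by simp)) (by rw [hx2]; exact hl)).deriv
  have v1 := congrArg (fun p : TangentBundle (𝓡 (2 * n + 1)) M =>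
    dChart (A.chart (A.idx x)) p.1 p.2) h1'
  have v2 := congrArg (fun p : TangentBundle (𝓡 (2 * n + 1)) M =>
    dChart (A.chart (A.idx x)) p.1 p.2) h2'
  exact A.geodesic_unique isOpen_Ioo isPreconnected_Ioo g1 g2 hz (by rw [hx1]; exact hl)
    (hx1.trans hx2.symm) ((d1.trans v1).trans (d2.trans v2).symm) 1
    ⟨by linarith, by linarith⟩

end AdaptedAtlas

end CRDef

end

open scoped Manifold ContDiff TensorProduct ENNReal Topology
noncomputable section
namespace CRDef
open Set Filter
set_option linter.unusedSectionVars false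
set_option maxSynthPendingDepth 3

/-! ### Estimates for the exponential map -/

namespace AdaptedAtlas

variable {n : ℕ} {M : Type*} [TopologicalSpace M] [ChartedSpace (Model n) M]
  [IsManifold (𝓡 (2 * n + 1)) ∞ M]
  {C : CRStructure n M} {ι : Type*} [Fintype ι] (A : AdaptedAtlas C ι) {l : ι} {x : M}

/-- For an integral curve of s times the geodesic field the velocity is s times the second component
and the acceleration carries s², which matches the quadratic homogeneity of the spray. -/
theorem isGeodesicFrom_of_chart (A : AdaptedAtlas C ι) {w : ℝ → Model n × Model n} {s ε : ℝ}
    (hε : 0 < ε) {y q : Model n} (h0 : w 0 = (y, q))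
    (hw : ∀ t ∈ Ioo (-ε) (1 + ε), (w t).1 ∈ (A.chart l).target ∧
      HasDerivAt w (s • A.geodField l (w t)) t) :
    IsGeodesicFrom C.metric ((A.chart l).symm y) (dSymm (A.chart l) y (s • q))
      fun t => (A.chart l).symm (w t).1 := by
  set I := Ioo (-ε) (1 + ε) with hI
  have hIo : IsOpen I := isOpen_Ioo
  have hz : (0 : ℝ) ∈ I := ⟨by linarith, by linarith⟩
  have hfst : ∀ t ∈ I, HasDerivAt (fun t => (w t).1) (s • (w t).2) t := fun t ht =>
    (ContinuousLinearMap.fst ℝ (Model n) (Model n)).hasFDerivAt.comp_hasDerivAt t (hw t ht).2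
  have hsnd : ∀ t ∈ I, HasDerivAt (fun t => (w t).2)
      (s • spray (A.chartMetric l) (w t).1 (w t).2) t := fun t ht =>
    (ContinuousLinearMap.snd ℝ (Model n) (Model n)).hasFDerivAt.comp_hasDerivAt t (hw t ht).2
  -- Bootstrap: w is differentiable with a derivative that is continuous along w, so w is C¹, and
  -- then its first component is C².
  have hw1 : ContDiffOn ℝ 1 w I := by
    rw [show (1 : WithTop ℕ∞) = 0 + 1 from rfl, contDiffOn_succ_iff_deriv_of_isOpen hIo]
    refine ⟨fun t ht => (hw t ht).2.differentiableAt.differentiableWithinAt, by simp, ?_⟩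
    rw [contDiffOn_zero]
    have h1 : ContinuousOn (fun t => s • A.geodField l (w t)) I := fun t ht =>
      (((A.contDiffAt_geodField (hw t ht).1).continuousAt.comp
        (hw t ht).2.continuousAt).const_smul s).continuousWithinAt
    exact h1.congr fun t ht => (hw t ht).2.deriv
  have hc2 : ContDiffOn ℝ 2 (fun t => (w t).1) I := by
    rw [show (2 : WithTop ℕ∞) = 1 + 1 from one_add_one_eq_two.symm,
      contDiffOn_succ_iff_deriv_of_isOpen hIo]
    refine ⟨fun t ht => (hfst t ht).differentiableAt.differentiableWithinAt, by simp, ?_⟩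
    exact (contDiff_snd.comp_contDiffOn hw1).const_smul s |>.congr fun t ht => (hfst t ht).deriv
  have hγ2 : ContMDiffOn 𝓘(ℝ, ℝ) (𝓡 (2 * n + 1)) 2 (fun t => (A.chart l).symm (w t).1) I :=
    ((contMDiffOn_symm_of_mem_maximalAtlas (A.chart_mem l)).of_le two_le_infty).comp
      (contMDiffOn_iff_contDiffOn.2 hc2) fun t ht => (hw t ht).1
  have hchart : ∀ t ∈ I, A.chart l ∘ (fun t => (A.chart l).symm (w t).1) =ᶠ[𝓝 t]
      fun t => (w t).1 := by
    intro t ht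
    filter_upwards [hIo.mem_nhds ht] with τ hτ
    exact (A.chart l).right_inv (hw τ hτ).1
  have hsrc : ∀ t ∈ I, (A.chart l).symm (w t).1 ∈ (A.chart l).source := fun t ht =>
    (A.chart l).map_target (hw t ht).1
  refine ⟨⟨ε, hε, hγ2, fun t ht => ?_⟩, ?_⟩
  · refine (A.isGeodesic_at_iff (hγ2.contMDiffAt (hIo.mem_nhds ht)) (hsrc t ht)).2 ?_
    rw [(hchart t ht).deriv_eq, (hchart t ht).deriv.deriv_eq, (hfst t ht).deriv,
      (A.chart l).right_inv (hw t ht).1, spray_smul]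
    have h1 : deriv (fun t => (w t).1) =ᶠ[𝓝 t] fun t => s • (w t).2 := by
      filter_upwards [hIo.mem_nhds ht] with τ hτ using (hfst τ hτ).deriv
    rw [h1.deriv_eq, ((hsnd t ht).fun_const_smul s).deriv, smul_smul, sq]
  · have hy : y ∈ (A.chart l).target := by have := (hw 0 hz).1; rwa [h0] at this
    have h00 : (A.chart l).symm (w 0).1 = (A.chart l).symm y := by rw [h0]
    refine tangentBundle_ext (A.chart_mem l) h00 (hsrc 0 hz) ?_
    have h1 := (hasDerivAt_chart_comp (A.chart_mem l)
      ((hγ2.contMDiffAt (hIo.mem_nhds hz)).mdifferentiableAt (by simp)) (hsrc 0 hz)).deriv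
    refine h1.symm.trans ?_
    rw [(hchart 0 hz).deriv_eq, (hfst 0 hz).deriv, h0]
    exact (dChart_dSymm (A.chart_mem l) hy _).symm

/-- Writing a = s q with ‖q‖ ≤ 1, the time-one geodesic with velocity a is the geodesic with
velocity q run to time s. The bound s²‖q − q'‖ for the flow then reads s‖a − a'‖. -/
theorem exists_exp_estimate [T2Space M] (A : AdaptedAtlas C ι) {K : Set (Model n)}
    (hK : IsCompact K) (hKT : K ⊆ (A.chart l).target) :
    ∃ s₀ > 0, ∃ B : ℝ, 0 ≤ B ∧ ∀ s, 0 < s → s ≤ s₀ → ∀ y ∈ K, ∀ a : Model n, ‖a‖ ≤ s →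
      expMap C.metric ((A.chart l).symm y) (dSymm (A.chart l) y a) ∈ (A.chart l).source ∧
      ‖A.chart l (expMap C.metric ((A.chart l).symm y) (dSymm (A.chart l) y a)) - y - a‖ ≤
        B * s ^ 2 ∧
      ∀ y' ∈ K, ∀ a' : Model n, ‖a'‖ ≤ s →
        ‖(A.chart l (expMap C.metric ((A.chart l).symm y) (dSymm (A.chart l) y a)) - y - a) -
          (A.chart l (expMap C.metric ((A.chart l).symm y') (dSymm (A.chart l) y' a')) - y' - a')‖
        ≤ B * (s ^ 2 * ‖y - y'‖ + s * ‖a - a'‖) := by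
  obtain ⟨s₀, hs₀, B, hB, z, hz, hzz⟩ := exists_scaled_flow (A.chart l).open_target hK hKT
    (f := fun z => spray (A.chartMetric l) z.1 z.2)
    (fun z hz => contDiffAt_spray (A.chart l).open_target A.chartMetric_contDiffOn
      (fun _ hy _ ha => A.chartMetric_pos hy ha) hz)
  refine ⟨s₀, hs₀, B, hB, fun s hs hss => ?_⟩
  have hq : ∀ a : Model n, ‖a‖ ≤ s → ‖s⁻¹ • a‖ ≤ 1 := fun a ha => by
    rw [norm_smul, Real.norm_of_nonneg (by positivity), inv_mul_le_iff₀ hs, mul_one]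
    exact ha
  have hss' : ∀ a : Model n, s • s⁻¹ • a = a := fun a => smul_inv_smul₀ hs.ne' a
  have hsI : s ∈ Icc 0 s₀ := ⟨hs.le, hss⟩
  have hexp : ∀ y ∈ K, ∀ a : Model n, ‖a‖ ≤ s →
      expMap C.metric ((A.chart l).symm y) (dSymm (A.chart l) y a) =
        (A.chart l).symm (z (y, s⁻¹ • a) s).1 ∧ (z (y, s⁻¹ • a) s).1 ∈ (A.chart l).target := by
    intro y hy a ha
    obtain ⟨h0, h1, -⟩ := hz y hy _ (hq a ha)
    -- Rescaled times slightly outside [0, 1] reach at most 3s/2; this is why the flow was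
    -- constructed on (−2s₀, 2s₀).
    have hI : ∀ t ∈ Ioo (-(1 / 2) : ℝ) (1 + 1 / 2), s * t ∈ Ioo (-(2 * s₀)) (2 * s₀) := by
      intro t ht
      constructor <;> nlinarith [ht.1, ht.2]
    have hg := A.isGeodesicFrom_of_chart (l := l) (w := fun t => z (y, s⁻¹ • a) (s * t)) (s := s)
      (ε := 1 / 2) (by norm_num) (y := y) (q := s⁻¹ • a) (by simp [h0]) (fun t ht => by
        refine ⟨(h1 _ (hI t ht)).1, ?_⟩
        have h2 := HasDerivAt.scomp t (h1 _ (hI t ht)).2 ((hasDerivAt_id t).const_mul s)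
        exact h2.congr_deriv (by rw [mul_one]; rfl))
    have h3 := A.expMap_eq hg
    simp only [mul_one] at h3
    rw [hss'] at h3
    refine ⟨h3, ?_⟩
    have := (h1 _ (hI 1 ⟨by norm_num, by norm_num⟩)).1
    rwa [mul_one] at this
  have hval : ∀ y ∈ K, ∀ a : Model n, ‖a‖ ≤ s →
      A.chart l (expMap C.metric ((A.chart l).symm y) (dSymm (A.chart l) y a)) - y - a =
        (z (y, s⁻¹ • a) s).1 - y - s • s⁻¹ • a := by
    intro y hy a ha
    obtain ⟨h1, h2⟩ := hexp y hy a ha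
    rw [h1, (A.chart l).right_inv h2, hss']
  intro y hy a ha
  refine ⟨?_, ?_, fun y' hy' a' ha' => ?_⟩
  · obtain ⟨h1, h2⟩ := hexp y hy a ha
    rw [h1]
    exact (A.chart l).map_target h2
  · rw [hval y hy a ha]
    exact (hz y hy _ (hq a ha)).2.2 s hsI
  · rw [hval y hy a ha, hval y' hy' a' ha']
    refine (hzz y hy _ (hq a ha) y' hy' _ (hq a' ha') s hsI).trans (le_of_eq ?_)
    rw [← smul_sub, norm_smul, Real.norm_of_nonneg (by positivity)]
    field_simp

end AdaptedAtlas

end CRDef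

end

open scoped Manifold ContDiff TensorProduct ENNReal Topology
noncomputable section
namespace CRDef
open Set Filter MeasureTheory
set_option linter.unusedSectionVars false
set_option maxSynthPendingDepth 3

/-! ### Bounds that are uniform near compact sets. -/

section CompactBounds

variable {E F : Type*} [NormedAddCommGroup E] [NormedSpace ℝ E] [FiniteDimensional ℝ E]
  [NormedAddCommGroup F] [NormedSpace ℝ F]

/-- First and second order Taylor bounds near a compact set. -/
theorem exists_taylor_bound {T K : Set E} (hT : IsOpen T) (hK : IsCompact K) (hKT : K ⊆ T)
    {f : E → F} (hf : ContDiffOn ℝ ∞ f T) :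
    ∃ r > 0, ∃ B : ℝ, 0 ≤ B ∧ ∀ y ∈ K, ∀ y', ‖y' - y‖ ≤ r → y' ∈ T ∧ ‖f y'‖ ≤ B ∧
      ‖fderiv ℝ f y‖ ≤ B ∧
      ‖f y' - f y‖ ≤ B * ‖y' - y‖ ∧ ‖f y' - f y - fderiv ℝ f y (y' - y)‖ ≤ B * ‖y' - y‖ ^ 2 := by
  have : ProperSpace E := FiniteDimensional.proper ℝ E
  obtain ⟨r, hr, hrT⟩ := hK.exists_cthickening_subset_open hT hKT
  have hK' : IsCompact (Metric.cthickening r K) := hK.cthickening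
  have hfd : ∀ y ∈ T, ContDiffAt ℝ ∞ f y := fun y hy => hf.contDiffAt (hT.mem_nhds hy)
  have hD : ∀ y ∈ T, ContDiffAt ℝ ∞ (fderiv ℝ f) y := fun y hy =>
    (hfd y hy).fderiv_right (m := ∞) (by simp)
  have hD2 : ∀ y ∈ T, ContDiffAt ℝ ∞ (fderiv ℝ (fderiv ℝ f)) y := fun y hy =>
    (hD y hy).fderiv_right (m := ∞) (by simp)
  obtain ⟨B0, h0⟩ := hK'.exists_bound_of_continuousOn (f := f)
    fun y hy => (hfd y (hrT hy)).continuousAt.continuousWithinAt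
  obtain ⟨B1, h1⟩ := hK'.exists_bound_of_continuousOn (f := fderiv ℝ f)
    fun y hy => (hD y (hrT hy)).continuousAt.continuousWithinAt
  obtain ⟨B2, h2⟩ := hK'.exists_bound_of_continuousOn (f := fderiv ℝ (fderiv ℝ f))
    fun y hy => (hD2 y (hrT hy)).continuousAt.continuousWithinAt
  set B : ℝ := |B0| + |B1| + |B2| with hB
  have hB0 : B0 ≤ B := by linarith [le_abs_self B0, abs_nonneg B1, abs_nonneg B2]
  have hB1 : B1 ≤ B := by linarith [le_abs_self B1, abs_nonneg B0, abs_nonneg B2]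
  have hB2 : B2 ≤ B := by linarith [le_abs_self B2, abs_nonneg B0, abs_nonneg B1]
  refine ⟨r, hr, B, by positivity, fun y hy y' hy' => ?_⟩
  have hball : Metric.closedBall y r ⊆ Metric.cthickening r K :=
    Metric.closedBall_subset_cthickening hy r
  have hyr : y ∈ Metric.closedBall y r := Metric.mem_closedBall_self hr.le
  have hyr' : y' ∈ Metric.closedBall y r := by rwa [Metric.mem_closedBall, dist_eq_norm]
  have hseg : segment ℝ y y' ⊆ Metric.closedBall y r :=
    (convex_closedBall y r).segment_subset hyr hyr'
  refine ⟨hrT (hball hyr'), (h0 _ (hball hyr')).trans hB0, (h1 _ (hball hyr)).trans hB1, ?_, ?_⟩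
  · exact (convex_closedBall y r).norm_image_sub_le_of_norm_fderiv_le (𝕜 := ℝ)
      (fun z hz => (hfd z (hrT (hball hz))).differentiableAt (by simp))
      (fun z hz => (h1 z (hball hz)).trans hB1) hyr hyr'
  · have hfz : ∀ z ∈ segment ℝ y y', ‖fderiv ℝ f z - fderiv ℝ f y‖ ≤ B * ‖y' - y‖ := by
      intro z hz
      have h3 := (convex_closedBall y r).norm_image_sub_le_of_norm_fderiv_le (𝕜 := ℝ)
        (fun z hz => (hD z (hrT (hball hz))).differentiableAt (by simp))
        (fun z hz => (h2 z (hball hz)).trans hB2) hyr (hseg hz)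
      refine h3.trans ?_
      gcongr
      have h4 : z ∈ Metric.closedBall y ‖y' - y‖ :=
        (convex_closedBall y _).segment_subset (Metric.mem_closedBall_self (norm_nonneg _))
          (by rw [Metric.mem_closedBall, dist_eq_norm]) hz
      rwa [Metric.mem_closedBall, dist_eq_norm] at h4
    have h5 := (convex_segment y y').norm_image_sub_le_of_norm_fderiv_le' (𝕜 := ℝ)
      (fun z hz => (hfd z (hrT (hball (hseg hz)))).differentiableAt (by simp)) hfz
      (left_mem_segment ℝ y y') (right_mem_segment ℝ y y')
    rwa [mul_assoc, ← sq] at h5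

end CompactBounds

namespace AdaptedAtlas

variable {n : ℕ} {M : Type*} [TopologicalSpace M] [ChartedSpace (Model n) M]
  [IsManifold (𝓡 (2 * n + 1)) ∞ M]
  {C : CRStructure n M} {ι : Type*} [Fintype ι] (A : AdaptedAtlas C ι) {l : ι} {x : M}

/-! ### The derivative of `exp ∘ Y` in an adapted chart -/

/-- The derivative of the remainder exp ∘ Y − id − Y is bounded by its local Lipschitz constant.
Near y, Y is small and 2s-Lipschitz, so the estimate for exp gives B(s² + s·2s) = 3Bs². Smoothness
of exp is not needed, only differentiability of the composite at the point. -/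
theorem exists_flowExp_estimate [T2Space M] (A : AdaptedAtlas C ι) {K : Set (Model n)}
    (hK : IsCompact K) (hKT : K ⊆ (A.chart l).target) :
    ∃ s₀ > 0, ∃ B : ℝ, 0 ≤ B ∧ ∀ s, 0 < s → s ≤ s₀ → ∀ Y : VF n M, VFSmoothOn 1 Y univ →
      ∀ y ∈ K, ‖vfIn (A.chart l) Y y‖ < s → ‖fderiv ℝ (vfIn (A.chart l) Y) y‖ ≤ s →
      MDifferentiableAt (𝓡 (2 * n + 1)) (𝓡 (2 * n + 1)) (C.flowExp Y) ((A.chart l).symm y) →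
      C.flowExp Y ((A.chart l).symm y) ∈ (A.chart l).source ∧
      ‖A.chart l (C.flowExp Y ((A.chart l).symm y)) - y - vfIn (A.chart l) Y y‖ ≤ B * s ^ 2 ∧
      ‖fderiv ℝ (A.chart l ∘ C.flowExp Y ∘ (A.chart l).symm) y - ContinuousLinearMap.id ℝ (Model n)
        - fderiv ℝ (vfIn (A.chart l) Y) y‖ ≤ B * s ^ 2 := by
  obtain ⟨K', hK', hKK', hK'T⟩ := exists_compact_between hK (A.chart l).open_target hKT
  obtain ⟨s₀, hs₀, B, hB, h⟩ := A.exists_exp_estimate hK' hK'T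
  refine ⟨s₀, hs₀, 3 * B, by positivity, fun s hs hss Y hY y hy hYy hDY hF => ?_⟩
  have hsource : (A.chart l).symm y ∈ (A.chart l).source := (A.chart l).map_target (hKT hy)
  have hflow : ∀ z ∈ K', C.flowExp Y ((A.chart l).symm z) =
      expMap C.metric ((A.chart l).symm z) (dSymm (A.chart l) z (vfIn (A.chart l) Y z)) := by
    intro z hz
    have h1 := (A.chart l).map_target (hK'T hz)
    have h2 : dChart (A.chart l) ((A.chart l).symm z)
        (dSymm (A.chart l) z (vfIn (A.chart l) Y z)) =
        dChart (A.chart l) ((A.chart l).symm z) (Y ((A.chart l).symm z)) :=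
      dChart_dSymm (A.chart_mem l) (hK'T hz) _
    rw [dChart_injective (A.chart_mem l) h1 h2]
    rfl
  have hYd : ContDiffAt ℝ 1 (vfIn (A.chart l) Y) y := by
    have h1 := vfIn_contDiffAt (A.chart_mem l) one_add_one_le_infty hY isOpen_univ
      (mem_univ _) hsource
    rwa [(A.chart l).right_inv (hKT hy)] at h1
  have hyK' : y ∈ K' := interior_subset (hKK' hy)
  obtain ⟨hm, h1, h2⟩ := h s hs hss y hyK' _ hYy.le
  rw [← hflow y hyK'] at hm h1 h2
  have hFd : HasFDerivAt (A.chart l ∘ C.flowExp Y ∘ (A.chart l).symm)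
      (fderiv ℝ (A.chart l ∘ C.flowExp Y ∘ (A.chart l).symm) y) y := by
    have h3 := differentiableAt_chart_comp (A.chart_mem l) hF hsource hm
    rw [(A.chart l).right_inv (hKT hy)] at h3
    exact h3.hasFDerivAt
  have hYf := (hYd.differentiableAt (by simp)).hasFDerivAt
  refine ⟨hm, h1.trans (by nlinarith [mul_nonneg hB (sq_nonneg s)]), ?_⟩
  refine ((hFd.sub (hasFDerivAt_id y)).sub hYf).le_of_lip' (by positivity) ?_
  -- The derivative at y contributes s and the little-o remainder another s.
  have hlip : ∀ᶠ z in 𝓝 y, ‖vfIn (A.chart l) Y z - vfIn (A.chart l) Y y‖ ≤ 2 * s * ‖z - y‖ := by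
    have h4 := hYf.isLittleO.bound hs
    filter_upwards [h4] with z hz
    have h5 : vfIn (A.chart l) Y z - vfIn (A.chart l) Y y =
        (vfIn (A.chart l) Y z - vfIn (A.chart l) Y y -
          fderiv ℝ (vfIn (A.chart l) Y) y (z - y)) + fderiv ℝ (vfIn (A.chart l) Y) y (z - y) := by
      abel
    rw [h5]
    refine (norm_add_le _ _).trans ?_
    have h6 := (fderiv ℝ (vfIn (A.chart l) Y) y).le_of_opNorm_le hDY (z - y)
    linarith
  have hsmall : ∀ᶠ z in 𝓝 y, ‖vfIn (A.chart l) Y z‖ < s :=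
    hYd.continuousAt.norm.eventually_lt continuousAt_const hYy
  filter_upwards [hlip, hsmall, isOpen_interior.mem_nhds (hKK' hy)] with z hz1 hz2 hz3
  have hz3' := interior_subset hz3
  have h7 := h2 z hz3' _ hz2.le
  rw [← hflow z hz3', norm_sub_rev] at h7
  refine h7.trans ?_
  rw [norm_sub_rev y z, norm_sub_rev (vfIn (A.chart l) Y y)]
  have h8 : s * ‖vfIn (A.chart l) Y z - vfIn (A.chart l) Y y‖ ≤ s * (2 * s * ‖z - y‖) := by gcongr
  calc B * (s ^ 2 * ‖z - y‖ + s * ‖vfIn (A.chart l) Y z - vfIn (A.chart l) Y y‖)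
      ≤ B * (s ^ 2 * ‖z - y‖ + s * (2 * s * ‖z - y‖)) := by gcongr
    _ = _ := by ring

/-! ### The cut-off functions in the charts -/

/-- The function `ρ_ℓ` in the chart, extended by zero. -/
def chartρ (l : ι) (y : Model n) : ℝ := (A.D l).indicator (fun y => A.ρ l ((A.chart l).symm y)) y

theorem D_subset_target : A.D l ⊆ (A.chart l).target := by
  rintro _ ⟨x, hx, rfl⟩
  exact (A.chart l).map_source (A.mem_source_of_mem_V hx)

theorem isOpen_D : IsOpen (A.D l) :=
  (A.chart l).isOpen_image_of_subset_source (A.V_open l) fun _ hx => A.mem_source_of_mem_V hx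

theorem symm_mem_V {y : Model n} (hy : y ∈ A.D l) : (A.chart l).symm y ∈ A.V l := by
  obtain ⟨x, hx, rfl⟩ := hy
  rwa [(A.chart l).left_inv (A.mem_source_of_mem_V hx)]

theorem isCompact_chart_image {S : Set M} (hS : IsClosed S) (hSV : S ⊆ closure (A.V l)) :
    IsCompact (A.chart l '' S) :=
  ((A.V_compact l).of_isClosed_subset hS hSV).image_of_continuousOn
    ((A.chart l).continuousOn.mono (hSV.trans (A.V_sub l)))

theorem isBounded_D : Bornology.IsBounded (A.D l) :=
  (A.isCompact_chart_image isClosed_closure le_rfl).isBounded.subset (image_mono subset_closure)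

theorem chartρ_eq_zero {y : Model n} (hy : y ∉ A.chart l '' tsupport (A.ρ l)) :
    A.chartρ l y = 0 := by
  by_cases h : y ∈ A.D l
  · rw [chartρ, indicator_of_mem h]
    refine image_eq_zero_of_notMem_tsupport fun h1 => hy ⟨_, h1, ?_⟩
    exact (A.chart l).right_inv (A.D_subset_target h)
  · exact indicator_of_notMem h _

theorem isCompact_support : IsCompact (A.chart l '' tsupport (A.ρ l)) :=
  A.isCompact_chart_image (isClosed_tsupport _) ((A.ρ_supp l).trans subset_closure)

theorem support_subset_D : A.chart l '' tsupport (A.ρ l) ⊆ A.D l := image_mono (A.ρ_supp l)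

theorem chartρ_of_mem {y : Model n} (hy : y ∈ A.D l) :
    A.chartρ l y = A.ρ l ((A.chart l).symm y) := indicator_of_mem hy _

theorem chartρ_chart (hx : x ∈ A.V l) : A.chartρ l (A.chart l x) = A.ρ l x := by
  rw [A.chartρ_of_mem (mem_image_of_mem _ hx), (A.chart l).left_inv (A.mem_source_of_mem_V hx)]

theorem hasCompactSupport_chartρ : HasCompactSupport (A.chartρ l) :=
  HasCompactSupport.intro A.isCompact_support fun _ hy => A.chartρ_eq_zero hy

theorem continuous_of_zero_off {F : Type*} [TopologicalSpace F] [Zero F] {f : Model n → F}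
    (hf : ContinuousOn f (A.D l)) (h0 : ∀ y ∉ A.chart l '' tsupport (A.ρ l), f y = 0) :
    Continuous f := by
  rw [continuous_iff_continuousAt]
  intro y
  by_cases hy : y ∈ A.chart l '' tsupport (A.ρ l)
  · exact hf.continuousAt (A.isOpen_D.mem_nhds (A.support_subset_D hy))
  · have h : f =ᶠ[𝓝 y] fun _ => 0 := by
      filter_upwards [A.isCompact_support.isClosed.isOpen_compl.mem_nhds hy] with z hz
        using h0 z hz
    exact continuousAt_const.congr h.symm

theorem contDiff_chartρ : ContDiff ℝ ∞ (A.chartρ l) := by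
  rw [contDiff_iff_contDiffAt]
  intro y
  by_cases hy : y ∈ A.D l
  · have h1 : ContMDiffAt (𝓡 (2 * n + 1)) 𝓘(ℝ, ℝ) ∞ (A.ρ l ∘ (A.chart l).symm) y :=
      (A.ρ_smooth l).contMDiffAt.comp y
        (contMDiffAt_symm_of_mem_maximalAtlas (A.chart_mem l) (A.D_subset_target hy))
    refine (contMDiffAt_iff_contDiffAt.1 h1).congr_of_eventuallyEq ?_
    filter_upwards [A.isOpen_D.mem_nhds hy] with z hz using A.chartρ_of_mem hz
  · have h : A.chartρ l =ᶠ[𝓝 y] fun _ => 0 := by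
      filter_upwards [A.isCompact_support.isClosed.isOpen_compl.mem_nhds
        fun h => hy (A.support_subset_D h)] with z hz using A.chartρ_eq_zero hz
    exact contDiffAt_const.congr_of_eventuallyEq h

/-- Pointwise and `C¹` bounds from the Folland-Stein norm where the cut-off is at least `c`. -/
theorem exists_pointwise_bound (hn : 1 ≤ n) {F : Type*} [NormedAddCommGroup F] [NormedSpace ℝ F]
    (l : ι) {c : ℝ} (hc : 0 < c) :
    ∃ r > 0, ∃ B : ℝ, 0 ≤ B ∧ ∀ s, 2 * n + 4 ≤ s → ∀ h : Model n → F, ContinuousOn h (A.D l) →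
      ∀ p : ℝ, 0 ≤ p →
      fsNorm (A.D l) s (fun y => A.ρ l ((A.chart l).symm y) • h y) ≤ ENNReal.ofReal p →
      ∀ y, c ≤ A.chartρ l y → ‖h y‖ ≤ B * p ∧
        (DifferentiableAt ℝ h y → ‖fderiv ℝ h y‖ ≤ B * p) ∧
        ∀ y', ‖y' - y‖ ≤ r → y' ∈ A.D l ∧ ‖h y'‖ ≤ B * p ∧ ‖h y' - h y‖ ≤ B * p * ‖y' - y‖ := by
  obtain ⟨S, hS⟩ := exists_sobolev (F := F) hn A.isCompact_support A.support_subset_D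
    (A.isOpen_D (l := l)) A.isBounded_D
  obtain ⟨L, hL⟩ := (A.contDiff_chartρ (l := l)).lipschitzWith_of_hasCompactSupport
    A.hasCompactSupport_chartρ (by simp)
  -- Within this radius the L-Lipschitz cut-off stays at least c/2.
  have hr : 0 < c / (2 * (L + 1)) := by positivity
  -- The three summands bound h at y, h at nearby points (where only c/2 is available), and the
  -- difference quotient of h at y.
  set B : ℝ := S / c + 2 * S / c + (S + L * (2 * S / c)) / c with hB
  have hS0 : (0 : ℝ) ≤ S := S.2
  have hL0 : (0 : ℝ) ≤ L := L.2
  have hb1 : S / c ≤ B := by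
    have h1 : 0 ≤ 2 * S / c := by positivity
    have h2 : 0 ≤ (S + L * (2 * S / c)) / c := by positivity
    linarith
  have hb2 : 2 * S / c ≤ B := by
    have h1 : 0 ≤ S / c := by positivity
    have h2 : 0 ≤ (S + L * (2 * S / c)) / c := by positivity
    linarith
  have hb3 : (S + L * (2 * S / c)) / c ≤ B := by
    have h1 : 0 ≤ S / c := by positivity
    have h2 : 0 ≤ 2 * S / c := by positivity
    linarith
  refine ⟨c / (2 * (L + 1)), hr, B, by positivity, fun s hs h hh p hp hnorm y hy => ?_⟩
  set g : Model n → F := fun y => A.chartρ l y • h y with hg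
  have hg0 : ∀ y ∉ A.chart l '' tsupport (A.ρ l), g y = 0 := fun y hy => by
    simp [hg, A.chartρ_eq_zero hy]
  have hgc : Continuous g := A.continuous_of_zero_off
    (A.contDiff_chartρ.continuous.continuousOn.smul hh) hg0
  have hfs : fsNorm (A.D l) s g ≤ ENNReal.ofReal p := by
    rw [fsNorm_congr A.isOpen_D.measurableSet s
      (f' := fun y => A.ρ l ((A.chart l).symm y) • h y) fun y hy => by
        simp only [hg, A.chartρ_of_mem hy]]
    exact hnorm
  obtain ⟨hS1, hS2⟩ := hS s hs g hgc hg0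
  have hg1 : ∀ z, ‖g z‖ ≤ S * p := by
    intro z
    have h1 : ‖g z‖ₑ ≤ ENNReal.ofReal (S * p) := by
      refine (hS1 z).trans ?_
      rw [ENNReal.ofReal_mul hS0, ENNReal.ofReal_coe_nnreal]
      gcongr
    rw [← ofReal_norm] at h1
    exact (ENNReal.ofReal_le_ofReal_iff (by positivity)).1 h1
  have hg2 : ∀ z w, ‖g z - g w‖ ≤ S * p * ‖z - w‖ := by
    intro z w
    have h1 : ‖g z - g w‖ₑ ≤ ENNReal.ofReal (S * p * ‖z - w‖) := by
      refine (hS2 z w).trans ?_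
      rw [ENNReal.ofReal_mul (by positivity), ENNReal.ofReal_mul hS0, ENNReal.ofReal_coe_nnreal,
        ofReal_norm]
      gcongr
    rw [← ofReal_norm] at h1
    exact (ENNReal.ofReal_le_ofReal_iff (by positivity)).1 h1
  have hbound : ∀ z, ∀ c' : ℝ, 0 < c' → c' ≤ A.chartρ l z → ‖h z‖ ≤ S * p / c' := by
    intro z c' hc' hz
    rw [le_div_iff₀ hc']
    have h1 := hg1 z
    rw [hg, norm_smul, Real.norm_of_nonneg (hc'.le.trans hz)] at h1
    nlinarith [norm_nonneg (h z)]
  have hdiff : ∀ z, c / 2 ≤ A.chartρ l z →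
      ‖h z - h y‖ ≤ (S + L * (2 * S / c)) / c * p * ‖z - y‖ := by
    intro z hz
    -- A discrete quotient rule: the increment of h is recovered from those of g = ρh and of ρ.
    have h1 : A.chartρ l y • (h z - h y) = (g z - g y) - (A.chartρ l z - A.chartρ l y) • h z := by
      simp only [hg]; module
    have h2 : c * ‖h z - h y‖ ≤ ‖A.chartρ l y • (h z - h y)‖ := by
      rw [norm_smul, Real.norm_of_nonneg (hc.le.trans hy)]
      gcongr
    have h3 : ‖(A.chartρ l z - A.chartρ l y) • h z‖ ≤ L * ‖z - y‖ * (S * p / (c / 2)) := by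
      rw [norm_smul]
      exact mul_le_mul (hL.norm_sub_le z y) (hbound z _ (by positivity) hz) (norm_nonneg _)
        (by positivity)
    have h4 := norm_sub_le (g z - g y) ((A.chartρ l z - A.chartρ l y) • h z)
    rw [← h1] at h4
    have h5 := hg2 z y
    have h6 : (S + L * (2 * S / c)) / c * p * ‖z - y‖ =
        (S * p * ‖z - y‖ + L * ‖z - y‖ * (S * p / (c / 2))) / c := by
      field_simp
    rw [h6, le_div_iff₀ hc]
    linarith
  have hnear : ∀ z, ‖z - y‖ ≤ c / (2 * (L + 1)) → c / 2 ≤ A.chartρ l z := by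
    intro z hz
    have h1 := hL.norm_sub_le z y
    rw [Real.norm_eq_abs] at h1
    rw [le_div_iff₀ (by positivity)] at hz
    nlinarith [(abs_le.1 h1).1, norm_nonneg (z - y)]
  have hyb : ‖h y‖ ≤ B * p := (hbound y c hc hy).trans (by
    rw [mul_div_right_comm]; gcongr)
  refine ⟨hyb, fun hd => ?_, fun y' hy' => ⟨?_, ?_, ?_⟩⟩
  · refine hd.hasFDerivAt.le_of_lip' (by positivity) ?_
    filter_upwards [Metric.closedBall_mem_nhds y hr] with z hz
    rw [Metric.mem_closedBall, dist_eq_norm] at hz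
    refine (hdiff z (hnear z hz)).trans ?_
    gcongr
  · by_contra hD
    have h1 := hnear y' hy'
    rw [chartρ, indicator_of_notMem hD] at h1
    linarith
  · refine (hbound y' (c / 2) (by positivity) (hnear y' hy')).trans ?_
    have h1 : S * p / (c / 2) = 2 * S / c * p := by field_simp
    rw [h1]; gcongr
  · refine (hdiff y' (hnear y' hy')).trans ?_
    gcongr

end AdaptedAtlas

end CRDef

end

open scoped Manifold ContDiff TensorProduct ENNReal Topology
noncomputable section
namespace CRDef
open Set Filter MeasureTheory
set_option linter.unusedSectionVars false
set_option maxSynthPendingDepth 3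

/-! ### Bounds for pulled back forms -/

section PullBounds

variable {n : ℕ} {M : Type*} [TopologicalSpace M] [ChartedSpace (Model n) M]
  [IsManifold (𝓡 (2 * n + 1)) ∞ M] {e : OpenPartialHomeomorph M (Model n)}

/-- The size of a complex tangent vector in the chart `e`. -/
def chartNorm (e : OpenPartialHomeomorph M (Model n)) {x : M} (z : CT n x) : ℝ :=
  ‖dChart e x (reT z)‖ + ‖dChart e x (imT z)‖

theorem chartNorm_nonneg {x : M} (z : CT n x) : 0 ≤ chartNorm e z := by
  unfold chartNorm; positivity

theorem norm_cEval_le {x : M} {f : TS n x → ℂ} {b : ℝ} (h : ∀ v, ‖f v‖ ≤ b * ‖dChart e x v‖)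
    (z : CT n x) : ‖cEval f z‖ ≤ b * chartNorm e z := by
  unfold cEval chartNorm
  refine (norm_add_le _ _).trans ?_
  rw [norm_mul, Complex.norm_I, one_mul, mul_add]
  exact add_le_add (h _) (h _)

theorem cEval_sub {x : M} (f g : TS n x → ℂ) (z : CT n x) :
    cEval (fun v => f v - g v) z = cEval f z - cEval g z := by
  simp only [cEval]; ring

theorem conjForm_smooth {θ : OneForm n M ℂ} {U : Set M} (hθ : FormSmoothOn θ U) :
    FormSmoothOn (conjForm θ) U := fun x hx =>
  (contDiffAt_const (c := (Complex.conjCLE : ℂ →L[ℝ] ℂ))).clm_comp (hθ x hx)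

/-- In the chart F^*θ is θ evaluated at F(x) composed with DF. The first-order bound compares it
with θ; the second-order one subtracts the coordinate formula of the Lie derivative and bounds each
remainder by Taylor's formula for the coefficients of θ. -/
theorem exists_pull_bound (he : IsSmoothChart e) {θ : OneForm n M ℂ}
    (hθ : FormSmoothOn θ e.source) {K : Set (Model n)} (hK : IsCompact K) (hKT : K ⊆ e.target) :
    ∃ r > 0, ∃ B : ℝ, 0 ≤ B ∧ ∀ x ∈ e.source, e x ∈ K →
      (∀ v, ‖θ x v‖ ≤ B * ‖dChart e x v‖) ∧
      (∀ Y : VF n M, VFSmoothOn 1 Y univ → ∀ s, ‖vfIn e Y (e x)‖ ≤ s →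
        ‖fderiv ℝ (vfIn e Y) (e x)‖ ≤ s → ∀ v, ‖lieD Y θ x v‖ ≤ B * s * ‖dChart e x v‖) ∧
      ∀ F : M → M, MDifferentiableAt (𝓡 (2 * n + 1)) (𝓡 (2 * n + 1)) F x → F x ∈ e.source →
        ‖e (F x) - e x‖ ≤ r →
        (∀ t, ‖e (F x) - e x‖ ≤ t →
          ‖fderiv ℝ (e ∘ F ∘ e.symm) (e x) - ContinuousLinearMap.id ℝ (Model n)‖ ≤ t →
          ∀ v, ‖pullForm F θ x v - θ x v‖ ≤ B * t * ‖dChart e x v‖) ∧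
        ∀ Y : VF n M, VFSmoothOn 1 Y univ → ∀ s, 0 ≤ s → s ≤ 1 → ‖vfIn e Y (e x)‖ ≤ s →
          ‖fderiv ℝ (vfIn e Y) (e x)‖ ≤ s → ∀ b, 0 ≤ b →
          ‖e (F x) - e x - vfIn e Y (e x)‖ ≤ b * s ^ 2 →
          ‖fderiv ℝ (e ∘ F ∘ e.symm) (e x) - ContinuousLinearMap.id ℝ (Model n) -
            fderiv ℝ (vfIn e Y) (e x)‖ ≤ b * s ^ 2 →
          ∀ v, ‖pullForm F θ x v - θ x v - lieD Y θ x v‖ ≤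
            B * (1 + b) ^ 2 * s ^ 2 * ‖dChart e x v‖ := by
  have hβ : ContDiffOn ℝ ∞ (formIn e θ) e.target := fun y hy => by
    have h := formIn_contDiffAt he hθ (e.map_target hy) (e.map_target hy)
    rw [e.right_inv hy] at h
    exact h.contDiffWithinAt
  obtain ⟨r, hr, B, hB, h⟩ := exists_taylor_bound e.open_target hK hKT hβ
  refine ⟨r, hr, 4 * B, by positivity, fun x hx hxK => ?_⟩
  obtain ⟨-, hb0, hbD, -, -⟩ := h _ hxK (e x) (by simpa using hr.le)
  refine ⟨fun v => ?_, fun Y hY s h1 h2 v => ?_, fun F hF hFx hFr => ?_⟩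
  · rw [← formIn_apply he θ hx v]
    have h3 := (formIn e θ (e x)).le_of_opNorm_le hb0 (dChart e x v)
    nlinarith [norm_nonneg (dChart e x v), mul_nonneg hB (norm_nonneg (dChart e x v))]
  · rw [lieD_eq he hθ e.open_source (hY.mono (subset_univ _)) hx hx]
    set u := dChart e x v
    have hs : 0 ≤ s := (norm_nonneg _).trans h1
    have h3 : ‖fderiv ℝ (formIn e θ) (e x) (vfIn e Y (e x)) u‖ ≤ B * s * ‖u‖ :=
      (fderiv ℝ (formIn e θ) (e x) (vfIn e Y (e x))).le_of_opNorm_le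
        (((fderiv ℝ (formIn e θ) (e x)).le_of_opNorm_le hbD _).trans (by gcongr)) u
    have h4 : ‖formIn e θ (e x) (fderiv ℝ (vfIn e Y) (e x) u)‖ ≤ B * (s * ‖u‖) :=
      ((formIn e θ (e x)).le_of_opNorm_le hb0 _).trans (by
        gcongr; exact (fderiv ℝ (vfIn e Y) (e x)).le_of_opNorm_le h2 u)
    refine (norm_add_le _ _).trans ?_
    have : 0 ≤ B * s * ‖u‖ := by positivity
    nlinarith
  · obtain ⟨-, hb', -, hlip, htay⟩ := h _ hxK _ hFr
    have hpull := pullForm_eq he θ hF hx hFx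
    constructor
    · intro t ht1 ht2 v
      rw [hpull, ← formIn_apply he θ hx v]
      set u := dChart e x v
      set D := fderiv ℝ (e ∘ F ∘ e.symm) (e x)
      have ht : 0 ≤ t := (norm_nonneg _).trans ht1
      have h3 : formIn e θ (e (F x)) (D u) - formIn e θ (e x) u =
          formIn e θ (e (F x)) ((D - ContinuousLinearMap.id ℝ (Model n)) u) +
            (formIn e θ (e (F x)) - formIn e θ (e x)) u := by
        simp only [sub_apply, ContinuousLinearMap.id_apply, map_sub]; abel
      rw [h3]
      have h4 : ‖formIn e θ (e (F x)) ((D - ContinuousLinearMap.id ℝ (Model n)) u)‖ ≤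
          B * (t * ‖u‖) := ((formIn e θ (e (F x))).le_of_opNorm_le hb' _).trans (by
        gcongr; exact (D - ContinuousLinearMap.id ℝ (Model n)).le_of_opNorm_le ht2 u)
      have h5 : ‖(formIn e θ (e (F x)) - formIn e θ (e x)) u‖ ≤ B * t * ‖u‖ :=
        (formIn e θ (e (F x)) - formIn e θ (e x)).le_of_opNorm_le
          (hlip.trans (by gcongr)) u
      refine (norm_add_le _ _).trans ?_
      have : 0 ≤ B * t * ‖u‖ := by positivity
      nlinarith
    · intro Y hY s hs hs1 h1 h2 b hb h3 h4 v
      rw [hpull, ← formIn_apply he θ hx v,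
        lieD_eq he hθ e.open_source (hY.mono (subset_univ _)) hx hx]
      set u := dChart e x v
      set D := fderiv ℝ (e ∘ F ∘ e.symm) (e x)
      set β := formIn e θ
      set V := vfIn e Y
      have hmove : ‖e (F x) - e x‖ ≤ (1 + b) * s := by
        have h5 : e (F x) - e x = (e (F x) - e x - V (e x)) + V (e x) := by abel
        rw [h5]
        refine (norm_add_le _ _).trans ?_
        nlinarith [mul_nonneg hb hs, mul_le_mul_of_nonneg_left hs1 (mul_nonneg hb hs)]
      -- Four second-order terms: the remainder of DF, the change of θ against DY, the Taylor
      -- remainder of θ, and Dθ applied to the remainder of F.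
      have key : β (e (F x)) (D u) - β (e x) u -
          (fderiv ℝ β (e x) (V (e x)) u + β (e x) (fderiv ℝ V (e x) u)) =
          β (e (F x)) ((D - ContinuousLinearMap.id ℝ (Model n) - fderiv ℝ V (e x)) u) +
          (β (e (F x)) - β (e x)) (fderiv ℝ V (e x) u) +
          (β (e (F x)) - β (e x) - fderiv ℝ β (e x) (e (F x) - e x)) u +
          fderiv ℝ β (e x) (e (F x) - e x - V (e x)) u := by
        simp only [sub_apply, ContinuousLinearMap.id_apply, map_sub]; abel
      rw [key]
      have k1 : ‖β (e (F x)) ((D - ContinuousLinearMap.id ℝ (Model n) - fderiv ℝ V (e x)) u)‖ ≤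
          B * (b * s ^ 2 * ‖u‖) := ((β (e (F x))).le_of_opNorm_le hb' _).trans (by
        gcongr
        exact (D - ContinuousLinearMap.id ℝ (Model n) - fderiv ℝ V (e x)).le_of_opNorm_le h4 u)
      have k2 : ‖(β (e (F x)) - β (e x)) (fderiv ℝ V (e x) u)‖ ≤
          B * ((1 + b) * s) * (s * ‖u‖) :=
        ((β (e (F x)) - β (e x)).le_of_opNorm_le (hlip.trans (by gcongr)) _).trans (by
          gcongr; exact (fderiv ℝ V (e x)).le_of_opNorm_le h2 u)
      have k3 : ‖(β (e (F x)) - β (e x) - fderiv ℝ β (e x) (e (F x) - e x)) u‖ ≤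
          B * ((1 + b) * s) ^ 2 * ‖u‖ :=
        (β (e (F x)) - β (e x) - fderiv ℝ β (e x) (e (F x) - e x)).le_of_opNorm_le
          (htay.trans (by gcongr)) u
      have k4 : ‖fderiv ℝ β (e x) (e (F x) - e x - V (e x)) u‖ ≤ B * (b * s ^ 2) * ‖u‖ :=
        (fderiv ℝ β (e x) (e (F x) - e x - V (e x))).le_of_opNorm_le
          (((fderiv ℝ β (e x)).le_of_opNorm_le hbD _).trans (by gcongr)) u
      refine (norm_add_le _ _).trans ((add_le_add_left ((norm_add_le _ _).trans
        (add_le_add_left (norm_add_le _ _) _)) _).trans ?_)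
      have hw : 0 ≤ B * s ^ 2 * ‖u‖ := by positivity
      have : 4 * B * (1 + b) ^ 2 * s ^ 2 * ‖u‖ - (B * (b * s ^ 2 * ‖u‖) +
          B * ((1 + b) * s) * (s * ‖u‖) + B * ((1 + b) * s) ^ 2 * ‖u‖ +
          B * (b * s ^ 2) * ‖u‖) = (B * s ^ 2 * ‖u‖) * (3 * (1 + b) ^ 2 - (1 + b) - 2 * b) := by
        ring
      have h6 : 0 ≤ 3 * (1 + b) ^ 2 - (1 + b) - 2 * b := by nlinarith
      have h7 := mul_nonneg hw h6
      rw [← this] at h7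
      linarith

end PullBounds

/-! ### Matrices close to the identity -/

/-- Strict diagonal dominance: the off-diagonal row sums are at most (n − 1)η, while the diagonal
entries have modulus at least 1 − η. -/
theorem isUnit_det_of_close {n : ℕ} {P : Matrix (Fin n) (Fin n) ℂ} {η : ℝ}
    (h : ∀ i j, ‖P i j - if i = j then 1 else 0‖ ≤ η) (hη : n * η ≤ 1 / 2) : IsUnit P.det := by
  rw [isUnit_iff_ne_zero]
  refine det_ne_zero_of_sum_row_lt_diag fun k => ?_
  have h0 : 0 ≤ η := (norm_nonneg _).trans (h k k)
  have h1 : ∑ j ∈ Finset.univ.erase k, ‖P k j‖ ≤ (n - 1 : ℝ) * η := by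
    refine (Finset.sum_le_card_nsmul _ _ η fun j hj => ?_).trans (le_of_eq ?_)
    · have := h k j
      rwa [if_neg (Finset.ne_of_mem_erase hj).symm, sub_zero] at this
    · rw [Finset.card_erase_of_mem (Finset.mem_univ k), Finset.card_univ, Fintype.card_fin,
        nsmul_eq_mul, Nat.cast_sub k.pos]
      simp
  have h2 := h k k
  rw [if_pos rfl] at h2
  have h3 : 1 - η ≤ ‖P k k‖ := by
    have h4 := norm_sub_norm_le (1 : ℂ) (1 - P k k)
    rw [norm_one, sub_sub_cancel, norm_sub_rev] at h4
    linarith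
  nlinarith

/-- X = P⁻¹Q satisfies X − Q = (I − P)X. If m is the largest entry of X in modulus, this gives m ≤ b
+ m/2, so m ≤ 2b, and reinserting it bounds X − Q; no norm of P⁻¹ is needed. -/
theorem inv_mul_close {n : ℕ} {P Q : Matrix (Fin n) (Fin n) ℂ} {η b : ℝ}
    (h : ∀ i j, ‖P i j - if i = j then 1 else 0‖ ≤ η) (hη : n * η ≤ 1 / 2)
    (hQ : ∀ i j, ‖Q i j‖ ≤ b) (i j : Fin n) : ‖(P⁻¹ * Q) i j - Q i j‖ ≤ 2 * n * η * b := by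
  have hu := isUnit_det_of_close h hη
  set X := P⁻¹ * Q with hX
  have h0 : 0 ≤ η := (norm_nonneg _).trans (h i i)
  have hPX : P * X = Q := by rw [hX, ← Matrix.mul_assoc, Matrix.mul_nonsing_inv _ hu, Matrix.one_mul]
  have hdiff : ∀ i j, X i j - Q i j = ∑ k, ((if i = k then 1 else 0) - P i k) * X k j := by
    intro i j
    have h1 := congrFun (congrFun hPX i) j
    rw [Matrix.mul_apply] at h1
    simp only [sub_mul, Finset.sum_sub_distrib, h1]
    simp
  have hne : (Finset.univ : Finset (Fin n)).Nonempty := ⟨i, Finset.mem_univ _⟩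
  have : Nonempty (Fin n × Fin n) := ⟨(i, j)⟩
  obtain ⟨p, hp⟩ := Finite.exists_max fun p : Fin n × Fin n => ‖X p.1 p.2‖
  set m := ‖X p.1 p.2‖ with hm
  have hm' : ∀ i j, ‖X i j‖ ≤ m := fun i j => hp (i, j)
  have hXQ : ∀ i j, ‖X i j - Q i j‖ ≤ n * η * m := by
    intro i j
    rw [hdiff]
    refine (norm_sum_le _ _).trans ((Finset.sum_le_card_nsmul _ _ (η * m) fun k _ => ?_).trans
      (le_of_eq ?_))
    · rw [norm_mul]
      have h2 := h i k
      rw [norm_sub_rev] at h2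
      exact mul_le_mul h2 (hm' _ _) (norm_nonneg _) h0
    · rw [Finset.card_univ, Fintype.card_fin, nsmul_eq_mul, mul_assoc]
  have hmb : m ≤ 2 * b := by
    have h3 := hXQ p.1 p.2
    have h4 := norm_sub_norm_le (X p.1 p.2) (Q p.1 p.2)
    have h5 := hQ p.1 p.2
    have h6 : n * η * m ≤ 1 / 2 * m := by gcongr
    linarith
  refine (hXQ i j).trans ?_
  have h7 : (0 : ℝ) ≤ n * η := by positivity
  nlinarith [mul_le_mul_of_nonneg_left hmb h7]

end CRDef

end

open scoped Manifold ContDiff TensorProduct ENNReal Topology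
noncomputable section
namespace CRDef
open Set Filter MeasureTheory
set_option linter.unusedSectionVars false
set_option maxSynthPendingDepth 3

/-! ### Uniform estimates for frames, coframes and the matrices A and B. -/

theorem exists_pos_forall_le {κ : Type*} [Finite κ] (r : κ → ℝ) (hr : ∀ i, 0 < r i) :
    ∃ r₀ > 0, ∀ i, r₀ ≤ r i := by
  rcases isEmpty_or_nonempty κ with h | h
  · exact ⟨1, one_pos, fun i => h.elim i⟩
  · obtain ⟨i, hi⟩ := Finite.exists_min r
    exact ⟨r i, hr i, hi⟩

theorem exists_nonneg_forall_ge {κ : Type*} [Finite κ] (B : κ → ℝ) :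
    ∃ B₀ ≥ 0, ∀ i, B i ≤ B₀ := by
  rcases isEmpty_or_nonempty κ with h | h
  · exact ⟨0, le_rfl, fun i => h.elim i⟩
  · obtain ⟨i, hi⟩ := Finite.exists_max B
    exact ⟨max (B i) 0, le_max_right _ _, fun j => (hi j).trans (le_max_left _ _)⟩

namespace AdaptedAtlas

variable {n : ℕ} {M : Type*} [TopologicalSpace M] [ChartedSpace (Model n) M]
  [IsManifold (𝓡 (2 * n + 1)) ∞ M]
  {C : CRStructure n M} {ι : Type*} [Fintype ι] (A : AdaptedAtlas C ι) {l : ι} {x : M}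

/-- The forms `θ^α` and their conjugates. -/
def coframe (l : ι) : Fin n ⊕ Fin n → OneForm n M ℂ :=
  Sum.elim (A.θ l) fun α => conjForm (A.θ l α)

/-- The fields `Z_α` and their conjugates. -/
def frame (l : ι) : Fin n ⊕ Fin n → CVF n M := Sum.elim (A.Z l) (A.Zbar l)

theorem coframe_smooth (l : ι) (i : Fin n ⊕ Fin n) :
    FormSmoothOn (A.coframe l i) (A.chart l).source := by
  rcases i with α | α
  · exact A.θ_smooth l α
  · exact conjForm_smooth (A.θ_smooth l α)

theorem chartNorm_conjT {e : OpenPartialHomeomorph M (Model n)} (z : CT n x) :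
    chartNorm e (conjT z) = chartNorm e z := by
  unfold chartNorm
  rw [reT_conjT, imT_conjT, map_neg, norm_neg]

theorem exists_frame_bound (A : AdaptedAtlas C ι) {K : Set (Model n)} (hK : IsCompact K)
    (hKT : K ⊆ (A.chart l).target) : ∃ B ≥ 0, ∀ x ∈ (A.chart l).source, A.chart l x ∈ K →
      ∀ j, chartNorm (A.chart l) (A.frame l j x) ≤ B := by
  have hcont : ∀ X : VF n M, VFSmoothOn ∞ X (A.chart l).source →
      ContinuousOn (vfIn (A.chart l) X) K := fun X hX y hy => by
    have hx := (A.chart l).map_target (hKT hy)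
    have h := vfIn_contDiffAt (A.chart_mem l) (k := ∞) (by simp) hX (A.chart l).open_source hx hx
    rw [(A.chart l).right_inv (hKT hy)] at h
    exact h.continuousAt.continuousWithinAt
  choose Br hr using fun α => hK.exists_bound_of_continuousOn (hcont _ (A.Z_smooth l α).1)
  choose Bi hi using fun α => hK.exists_bound_of_continuousOn (hcont _ (A.Z_smooth l α).2)
  obtain ⟨B, hB, hB'⟩ := exists_nonneg_forall_ge fun α => Br α + Bi α
  have hZ : ∀ x ∈ (A.chart l).source, A.chart l x ∈ K → ∀ α,
      chartNorm (A.chart l) (A.Z l α x) ≤ B := by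
    intro x hx hxK α
    have h1 := hr α _ hxK
    have h2 := hi α _ hxK
    rw [vfIn_apply _ hx] at h1 h2
    exact (add_le_add h1 h2).trans (hB' α)
  refine ⟨B, hB, fun x hx hxK j => ?_⟩
  rcases j with α | α
  · exact hZ x hx hxK α
  · exact (chartNorm_conjT _).trans_le (hZ x hx hxK α)

theorem exists_frame_pull_bound (A : AdaptedAtlas C ι) {K : Set (Model n)} (hK : IsCompact K)
    (hKT : K ⊆ (A.chart l).target) :
    ∃ r > 0, ∃ B ≥ 0, ∀ x ∈ (A.chart l).source, A.chart l x ∈ K → ∀ i j : Fin n ⊕ Fin n,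
      (∀ Y : VF n M, VFSmoothOn 1 Y univ → ∀ s, ‖vfIn (A.chart l) Y (A.chart l x)‖ ≤ s →
        ‖fderiv ℝ (vfIn (A.chart l) Y) (A.chart l x)‖ ≤ s →
        ‖cEval (lieD Y (A.coframe l i) x) (A.frame l j x)‖ ≤ B * s) ∧
      ∀ F : M → M, MDifferentiableAt (𝓡 (2 * n + 1)) (𝓡 (2 * n + 1)) F x →
        F x ∈ (A.chart l).source → ‖A.chart l (F x) - A.chart l x‖ ≤ r →
        (∀ t, ‖A.chart l (F x) - A.chart l x‖ ≤ t →
          ‖fderiv ℝ (A.chart l ∘ F ∘ (A.chart l).symm) (A.chart l x) -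
            ContinuousLinearMap.id ℝ (Model n)‖ ≤ t →
          ‖cEval (pullForm F (A.coframe l i) x) (A.frame l j x) -
            cEval (A.coframe l i x) (A.frame l j x)‖ ≤ B * t) ∧
        ∀ Y : VF n M, VFSmoothOn 1 Y univ → ∀ s, 0 ≤ s → s ≤ 1 →
          ‖vfIn (A.chart l) Y (A.chart l x)‖ ≤ s →
          ‖fderiv ℝ (vfIn (A.chart l) Y) (A.chart l x)‖ ≤ s → ∀ b, 0 ≤ b →
          ‖A.chart l (F x) - A.chart l x - vfIn (A.chart l) Y (A.chart l x)‖ ≤ b * s ^ 2 →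
          ‖fderiv ℝ (A.chart l ∘ F ∘ (A.chart l).symm) (A.chart l x) -
            ContinuousLinearMap.id ℝ (Model n) -
            fderiv ℝ (vfIn (A.chart l) Y) (A.chart l x)‖ ≤ b * s ^ 2 →
          ‖cEval (pullForm F (A.coframe l i) x) (A.frame l j x) -
            cEval (A.coframe l i x) (A.frame l j x) -
            cEval (lieD Y (A.coframe l i) x) (A.frame l j x)‖ ≤ B * (1 + b) ^ 2 * s ^ 2 := by
  choose r hr B hB h using fun i =>
    exists_pull_bound (A.chart_mem l) (A.coframe_smooth l i) hK hKT
  obtain ⟨r₀, hr₀, hr'⟩ := exists_pos_forall_le r hr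
  obtain ⟨B₀, hB₀, hB'⟩ := exists_nonneg_forall_ge B
  obtain ⟨N, hN, hN'⟩ := A.exists_frame_bound hK hKT
  refine ⟨r₀, hr₀, B₀ * N, by positivity, fun x hx hxK i j => ?_⟩
  obtain ⟨-, h1, h2⟩ := h i x hx hxK
  have hz := hN' x hx hxK j
  have hz0 := chartNorm_nonneg (e := A.chart l) (A.frame l j x)
  have hBi := hB' i
  have hBi0 := hB i
  refine ⟨fun Y hY s hs1 hs2 => ?_, fun F hF hFx hFr => ⟨fun t ht1 ht2 => ?_,
    fun Y hY s hs0 hs1 hY1 hY2 b hb hb1 hb2 => ?_⟩⟩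
  · have hs : 0 ≤ s := (norm_nonneg _).trans hs1
    refine (norm_cEval_le (h1 Y hY s hs1 hs2) _).trans ?_
    calc B i * s * chartNorm (A.chart l) (A.frame l j x) ≤ B₀ * s * N := by gcongr
      _ = _ := by ring
  · have ht : 0 ≤ t := (norm_nonneg _).trans ht1
    rw [← cEval_sub]
    refine (norm_cEval_le ((h2 F hF hFx (hFr.trans (hr' i))).1 t ht1 ht2) _).trans ?_
    calc B i * t * chartNorm (A.chart l) (A.frame l j x) ≤ B₀ * t * N := by gcongr
      _ = _ := by ring
  · rw [← cEval_sub, ← cEval_sub]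
    refine (norm_cEval_le ((h2 F hF hFx (hFr.trans (hr' i))).2 Y hY s hs0 hs1 hY1 hY2 b hb hb1
      hb2) _).trans ?_
    calc B i * (1 + b) ^ 2 * s ^ 2 * chartNorm (A.chart l) (A.frame l j x)
        ≤ B₀ * (1 + b) ^ 2 * s ^ 2 * N := by gcongr
      _ = _ := by ring

theorem pulled_apply (F : M → M) (φ : C.Deform) (l : ι) (α : Fin n) (x : M) (z : CT n x) :
    A.pulled F φ l α x z = cEval (pullForm F (A.coframe l (Sum.inl α)) x) z +
      ∑ γ, A.coef φ l α γ (F x) * cEval (pullForm F (A.coframe l (Sum.inr γ)) x) z := by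
  simp only [pulled, LinearMap.add_apply, LinearMap.comp_apply, LinearMap.sum_apply,
    LinearMap.smul_apply, smul_eq_mul, cEval_pullForm]
  rfl

theorem cEval_coframe_inl_inl (hx : x ∈ (A.chart l).source) (α β : Fin n) :
    cEval (A.coframe l (Sum.inl α) x) (A.frame l (Sum.inl β) x) = if α = β then 1 else 0 :=
  A.ev_Z hx α β

theorem cEval_coframe_inl_inr (hx : x ∈ (A.chart l).source) (α β : Fin n) :
    cEval (A.coframe l (Sum.inl α) x) (A.frame l (Sum.inr β) x) = 0 := A.ev_Zbar hx α β

theorem cEval_coframe_inr_inl (hx : x ∈ (A.chart l).source) (α β : Fin n) :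
    cEval (A.coframe l (Sum.inr α) x) (A.frame l (Sum.inl β) x) = 0 := A.evBar_Z hx α β

theorem cEval_coframe_inr_inr (hx : x ∈ (A.chart l).source) (α β : Fin n) :
    cEval (A.coframe l (Sum.inr α) x) (A.frame l (Sum.inr β) x) = if α = β then 1 else 0 :=
  A.evBar_Zbar hx α β

theorem norm_sum_le_card_mul {f : Fin n → ℂ} {b : ℝ} (h : ∀ i, ‖f i‖ ≤ b) :
    ‖∑ i, f i‖ ≤ n * b := by
  refine (norm_sum_le _ _).trans ((Finset.sum_le_card_nsmul _ _ b fun i _ => h i).trans ?_)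
  rw [Finset.card_univ, Fintype.card_fin, nsmul_eq_mul]

/-- At F = id and φ = 0 duality of the frames gives A = I and B = 0; both matrices depend in a
Lipschitz way on the 1-jet of F and on the values of φ at F(x). -/
theorem exists_pullMat_bound (A : AdaptedAtlas C ι) {K : Set (Model n)} (hK : IsCompact K)
    (hKT : K ⊆ (A.chart l).target) :
    ∃ t₀ > 0, ∃ B ≥ 0, ∀ x ∈ (A.chart l).source, A.chart l x ∈ K → ∀ (F : M → M) (φ : C.Deform),
      MDifferentiableAt (𝓡 (2 * n + 1)) (𝓡 (2 * n + 1)) F x → F x ∈ (A.chart l).source →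
      ∀ t, t ≤ t₀ → ‖A.chart l (F x) - A.chart l x‖ ≤ t →
      ‖fderiv ℝ (A.chart l ∘ F ∘ (A.chart l).symm) (A.chart l x) -
        ContinuousLinearMap.id ℝ (Model n)‖ ≤ t →
      (∀ α γ, ‖A.coef φ l α γ (F x)‖ ≤ t) → ∀ α β,
        ‖A.pullA F φ l x α β - (if α = β then 1 else 0)‖ ≤ B * t ∧
        ‖A.pullB F φ l x α β‖ ≤ B * t := by
  obtain ⟨r, hr, B, hB, h⟩ := A.exists_frame_pull_bound hK hKT
  refine ⟨min r 1, lt_min hr one_pos, B + n * (1 + B), by positivity,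
    fun x hx hxK F φ hF hFx t ht ht1 ht2 hφ α β => ?_⟩
  have ht0 : 0 ≤ t := (norm_nonneg _).trans ht1
  have htr : ‖A.chart l (F x) - A.chart l x‖ ≤ r := ht1.trans (ht.trans (min_le_left _ _))
  have ht11 : t ≤ 1 := ht.trans (min_le_right _ _)
  have hd := fun i j => ((h x hx hxK i j).2 F hF hFx htr).1 t ht1 ht2
  have hsum : ∀ z : CT n x, ∀ c : Fin n → ℂ, (∀ γ, ‖c γ‖ ≤ 1) →
      (∀ γ, ‖cEval (pullForm F (A.coframe l (Sum.inr γ)) x) z - c γ‖ ≤ B * t) →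
      ‖∑ γ, A.coef φ l α γ (F x) * cEval (pullForm F (A.coframe l (Sum.inr γ)) x) z‖ ≤
        n * ((1 + B) * t) := by
    intro z c hc hz
    refine norm_sum_le_card_mul fun γ => ?_
    rw [norm_mul]
    have h1 : ‖cEval (pullForm F (A.coframe l (Sum.inr γ)) x) z‖ ≤ 1 + B := by
      have h2 := norm_le_norm_add_norm_sub' (cEval (pullForm F (A.coframe l (Sum.inr γ)) x) z) (c γ)
      nlinarith [hc γ, hz γ]
    calc _ ≤ t * (1 + B) := mul_le_mul (hφ α γ) h1 (norm_nonneg _) ht0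
      _ = _ := by ring
  have hle : B * t + n * ((1 + B) * t) = (B + n * (1 + B)) * t := by ring
  rw [← hle]
  constructor
  · simp only [pullA, Matrix.of_apply]
    rw [pulled_apply, add_sub_right_comm]
    refine (norm_add_le _ _).trans (add_le_add ?_ (hsum _ (fun _ => 0) (by simp) fun γ => ?_))
    · have h3 := hd (Sum.inl α) (Sum.inl β)
      rwa [A.cEval_coframe_inl_inl hx] at h3
    · have h3 := hd (Sum.inr γ) (Sum.inl β)
      rwa [A.cEval_coframe_inr_inl hx] at h3
  · simp only [pullB, Matrix.of_apply]
    rw [pulled_apply]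
    refine (norm_add_le _ _).trans (add_le_add ?_ (hsum _ (fun γ => if γ = β then 1 else 0)
      (fun γ => by split_ifs <;> simp) fun γ => ?_))
    · have h3 := hd (Sum.inl α) (Sum.inr β)
      rwa [A.cEval_coframe_inl_inr hx, sub_zero] at h3
    · have h3 := hd (Sum.inr γ) (Sum.inr β)
      rwa [A.cEval_coframe_inr_inr hx] at h3

/-- The quadratic estimate for the action in an adapted chart. -/
theorem exists_quadratic_bound (A : AdaptedAtlas C ι) {K : Set (Model n)} (hK : IsCompact K)
    (hKT : K ⊆ (A.chart l).target) {b : ℝ} (hb : 0 ≤ b) :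
    ∃ t₀ > 0, ∃ B ≥ 0, ∀ x ∈ (A.chart l).source, A.chart l x ∈ K → ∀ (F : M → M) (φ : C.Deform)
      (X Y : VF n M), VFSmoothOn 1 X univ → VFSmoothOn 1 Y univ →
      MDifferentiableAt (𝓡 (2 * n + 1)) (𝓡 (2 * n + 1)) F x → F x ∈ (A.chart l).source →
      ∀ t, 0 ≤ t → t ≤ t₀ → ‖vfIn (A.chart l) Y (A.chart l x)‖ ≤ t →
      ‖fderiv ℝ (vfIn (A.chart l) Y) (A.chart l x)‖ ≤ t →
      ‖vfIn (A.chart l) (Y - X) (A.chart l x)‖ ≤ b * t ^ 2 →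
      ‖fderiv ℝ (vfIn (A.chart l) (Y - X)) (A.chart l x)‖ ≤ b * t ^ 2 →
      ‖A.chart l (F x) - A.chart l x - vfIn (A.chart l) Y (A.chart l x)‖ ≤ b * t ^ 2 →
      ‖fderiv ℝ (A.chart l ∘ F ∘ (A.chart l).symm) (A.chart l x) -
        ContinuousLinearMap.id ℝ (Model n) -
        fderiv ℝ (vfIn (A.chart l) Y) (A.chart l x)‖ ≤ b * t ^ 2 →
      (∀ α γ, ‖A.coef φ l α γ (F x)‖ ≤ t) →
      (∀ α γ, ‖A.coef φ l α γ (F x) - A.coef φ l α γ x‖ ≤ b * t ^ 2) →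
      IsUnit (A.pullA F φ l x).det ∧ ∀ α β,
        ‖((A.pullA F φ l x)⁻¹ * A.pullB F φ l x) α β -
          (cEval (lieD X (A.θ l α) x) (A.Zbar l β x) + A.coef φ l α β x)‖ ≤ B * t ^ 2 := by
  obtain ⟨r, hr, B, hB, h⟩ := A.exists_frame_pull_bound hK hKT
  obtain ⟨t₁, ht₁, B₁, hB₁, h'⟩ := A.exists_pullMat_bound hK hKT
  -- F − id and its derivative are at most t + bt² ≤ ct when t ≤ 1.
  set c : ℝ := 1 + b with hc
  have hc1 : 1 ≤ c := by linarith
  have hc0 : 0 < c := by linarith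
  -- The bounds on t ensure in turn t² ≤ t, the radius for pulled-back forms, the range of the
  -- matrix estimate, and n·B₁·ct ≤ 1/2 for inverting A.
  set t₀ : ℝ := min 1 (min (r / c) (min (t₁ / c) (1 / (2 * (n * (B₁ * c) + 1))))) with ht₀
  have hden : 0 < 2 * (n * (B₁ * c) + 1) := by positivity
  have hpos : 0 < t₀ := lt_min one_pos (lt_min (by positivity)
    (lt_min (by positivity) (by positivity)))
  set B₂ : ℝ := B * c ^ 2 + B * b + n * (B * c) + b + 2 * n * (B₁ * c) * (B₁ * c) with hB₂
  refine ⟨t₀, hpos, B₂, by positivity,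
    fun x hx hxK F φ X Y hX hY hF hFx t ht0 ht hY1 hY2 hd1 hd2 hF1 hF2 hφ hφd => ?_⟩
  have ht1 : t ≤ 1 := ht.trans (min_le_left _ _)
  have htr : c * t ≤ r := by
    have : t ≤ r / c := ht.trans ((min_le_right _ _).trans (min_le_left _ _))
    rwa [le_div_iff₀ hc0, mul_comm] at this
  have htt : c * t ≤ t₁ := by
    have : t ≤ t₁ / c := ht.trans ((min_le_right _ _).trans ((min_le_right _ _).trans
      (min_le_left _ _)))
    rwa [le_div_iff₀ hc0, mul_comm] at this
  have htn : n * (B₁ * (c * t)) ≤ 1 / 2 := by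
    have : t ≤ 1 / (2 * (n * (B₁ * c) + 1)) := ht.trans ((min_le_right _ _).trans
      ((min_le_right _ _).trans (min_le_right _ _)))
    rw [le_div_iff₀ hden] at this
    nlinarith
  have hbt : b * t ^ 2 ≤ b * t := by
    have : t ^ 2 ≤ t := by nlinarith
    gcongr
  have hmove : ‖A.chart l (F x) - A.chart l x‖ ≤ c * t := by
    have h5 : A.chart l (F x) - A.chart l x = (A.chart l (F x) - A.chart l x -
      vfIn (A.chart l) Y (A.chart l x)) + vfIn (A.chart l) Y (A.chart l x) := by abel
    rw [h5]
    refine (norm_add_le _ _).trans ?_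
    rw [hc]; linarith
  have hDmove : ‖fderiv ℝ (A.chart l ∘ F ∘ (A.chart l).symm) (A.chart l x) -
        ContinuousLinearMap.id ℝ (Model n)‖ ≤ c * t := by
    have h5 : fderiv ℝ (A.chart l ∘ F ∘ (A.chart l).symm) (A.chart l x) -
        ContinuousLinearMap.id ℝ (Model n) =
        (fderiv ℝ (A.chart l ∘ F ∘ (A.chart l).symm) (A.chart l x) -
        ContinuousLinearMap.id ℝ (Model n) - fderiv ℝ (vfIn (A.chart l) Y) (A.chart l x)) +
        fderiv ℝ (vfIn (A.chart l) Y) (A.chart l x) := by abel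
    rw [h5]
    refine (norm_add_le _ _).trans ?_
    rw [hc]; linarith
  have htc : t ≤ c * t := by nlinarith
  have hmat := h' x hx hxK F φ hF hFx (c * t) htt hmove hDmove
    (fun α γ => (hφ α γ).trans htc)
  refine ⟨isUnit_det_of_close (fun α β => (hmat α β).1) htn, fun α β => ?_⟩
  have hinv := inv_mul_close (fun α β => (hmat α β).1) htn (fun α β => (hmat α β).2) α β
  have hYX := hY.sub hX
  have hlie := lieD_sub (A.chart_mem l) (A.θ_smooth l α) (A.chart l).open_source
    (hX.mono (subset_univ _)) (hY.mono (subset_univ _)) hx hx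
  have hQ := ((h x hx hxK (Sum.inl α) (Sum.inr β)).2 F hF hFx (hmove.trans htr)).2 Y hY t ht0 ht1
    hY1 hY2 b hb hF1 hF2
  have hL := (h x hx hxK (Sum.inl α) (Sum.inr β)).1 (Y - X) hYX _ hd1 hd2
  have hS : ‖∑ γ, A.coef φ l α γ (F x) *
      (cEval (pullForm F (A.coframe l (Sum.inr γ)) x) (A.frame l (Sum.inr β) x) -
        cEval (A.coframe l (Sum.inr γ) x) (A.frame l (Sum.inr β) x))‖ ≤
        n * (t * (B * (c * t))) := by
    refine norm_sum_le_card_mul fun γ => ?_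
    rw [norm_mul]
    exact mul_le_mul (hφ α γ) (((h x hx hxK (Sum.inr γ) (Sum.inr β)).2 F hF hFx
      (hmove.trans htr)).1 _ hmove hDmove) (norm_nonneg _) ht0
  have hlie2 : cEval (lieD (Y - X) (A.coframe l (Sum.inl α)) x) (A.frame l (Sum.inr β) x) =
      cEval (lieD Y (A.θ l α) x) (A.Zbar l β x) - cEval (lieD X (A.θ l α) x) (A.Zbar l β x) := by
    rw [← cEval_sub]
    exact congrArg (fun f : TS n x → ℂ => cEval f (A.Zbar l β x)) (funext hlie)
  have hB : A.pullB F φ l x α β =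
      cEval (pullForm F (A.coframe l (Sum.inl α)) x) (A.frame l (Sum.inr β) x) +
      ∑ γ, A.coef φ l α γ (F x) *
        cEval (pullForm F (A.coframe l (Sum.inr γ)) x) (A.frame l (Sum.inr β) x) :=
    A.pulled_apply F φ l α x _
  have hsumδ : ∑ γ, A.coef φ l α γ (F x) *
      cEval (A.coframe l (Sum.inr γ) x) (A.frame l (Sum.inr β) x) = A.coef φ l α β (F x) := by
    simp only [A.cEval_coframe_inr_inr hx]
    simp
  have hlie3 : cEval (lieD Y (A.coframe l (Sum.inl α)) x) (A.frame l (Sum.inr β) x) =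
    cEval (lieD Y (A.θ l α) x) (A.Zbar l β x) := rfl
  -- Each group is quadratic: the pull-back remainder along Y, the Lie derivative along Y − X, φ
  -- times a first-order variation of the conjugate forms, and the variation of φ under F.
  have key : A.pullB F φ l x α β -
      (cEval (lieD X (A.θ l α) x) (A.Zbar l β x) + A.coef φ l α β x) =
      (cEval (pullForm F (A.coframe l (Sum.inl α)) x) (A.frame l (Sum.inr β) x) -
        cEval (A.coframe l (Sum.inl α) x) (A.frame l (Sum.inr β) x) -
        cEval (lieD Y (A.coframe l (Sum.inl α)) x) (A.frame l (Sum.inr β) x)) +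
      cEval (lieD (Y - X) (A.coframe l (Sum.inl α)) x) (A.frame l (Sum.inr β) x) +
      (∑ γ, A.coef φ l α γ (F x) *
        (cEval (pullForm F (A.coframe l (Sum.inr γ)) x) (A.frame l (Sum.inr β) x) -
        cEval (A.coframe l (Sum.inr γ) x) (A.frame l (Sum.inr β) x))) +
      (A.coef φ l α β (F x) - A.coef φ l α β x) := by
    simp only [mul_sub, Finset.sum_sub_distrib]
    rw [hsumδ, hB, hlie2, hlie3, A.cEval_coframe_inl_inr hx]
    ring
  have hfin : ‖A.pullB F φ l x α β -
      (cEval (lieD X (A.θ l α) x) (A.Zbar l β x) + A.coef φ l α β x)‖ ≤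
      B * c ^ 2 * t ^ 2 + B * (b * t ^ 2) + n * (t * (B * (c * t))) + b * t ^ 2 := by
    rw [key]
    refine (norm_add_le _ _).trans (add_le_add ((norm_add_le _ _).trans
      (add_le_add ((norm_add_le _ _).trans (add_le_add hQ hL)) hS)) (hφd α β))
  have hsplit := norm_add_le
    (((A.pullA F φ l x)⁻¹ * A.pullB F φ l x) α β - A.pullB F φ l x α β)
    (A.pullB F φ l x α β - (cEval (lieD X (A.θ l α) x) (A.Zbar l β x) + A.coef φ l α β x))
  rw [sub_add_sub_cancel] at hsplit
  refine hsplit.trans ((add_le_add hinv hfin).trans (le_of_eq ?_))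
  rw [hB₂]; ring

end AdaptedAtlas

end CRDef

end

open scoped Manifold ContDiff TensorProduct ENNReal Topology
noncomputable section
namespace CRDef
open Set Filter MeasureTheory
set_option linter.unusedSectionVars false
set_option maxSynthPendingDepth 3

namespace AdaptedAtlas

variable {n : ℕ} {M : Type*} [TopologicalSpace M] [ChartedSpace (Model n) M]
  [IsManifold (𝓡 (2 * n + 1)) ∞ M]
  {C : CRStructure n M} {ι : Type*} [Fintype ι] (A : AdaptedAtlas C ι) {l : ι} {x : M}

/-! ### Comparison of the norms with local quantities -/

theorem fsNorm_vfIn_le (s : ℕ) (X : VF n M) (l : ι) :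
    fsNorm (A.D l) s (fun y => A.ρ l ((A.chart l).symm y) • vfIn (A.chart l) X y) ≤
      A.vfNorm s X :=
  Finset.single_le_sum (f := fun l => fsNorm (A.D l) s fun y => A.ρ l ((A.chart l).symm y) •
    vfIn (A.chart l) X y) (fun _ _ => zero_le) (Finset.mem_univ l)

theorem fsNorm_coef_le (s : ℕ) (φ : C.Deform) (l : ι) (α β : Fin n) :
    fsNorm (A.D l) s (fun y => A.ρ l ((A.chart l).symm y) •
      A.coef φ l α β ((A.chart l).symm y)) ≤ A.deformNorm s φ := by
  unfold deformNorm
  refine le_trans ?_ (Finset.single_le_sum (f := fun l => ∑ α, ∑ β, fsNorm (A.D l) s fun y =>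
    A.ρ l ((A.chart l).symm y) • A.coef φ l α β ((A.chart l).symm y))
    (fun _ _ => zero_le) (Finset.mem_univ l))
  refine le_trans ?_ (Finset.single_le_sum (f := fun α => ∑ β, fsNorm (A.D l) s fun y =>
    A.ρ l ((A.chart l).symm y) • A.coef φ l α β ((A.chart l).symm y))
    (fun _ _ => zero_le) (Finset.mem_univ α))
  exact Finset.single_le_sum (f := fun β => fsNorm (A.D l) s fun y =>
    A.ρ l ((A.chart l).symm y) • A.coef φ l α β ((A.chart l).symm y))
    (fun _ _ => zero_le) (Finset.mem_univ β)

theorem vfNorm_mono {s s' : ℕ} (h : s ≤ s') (X : VF n M) : A.vfNorm s X ≤ A.vfNorm s' X :=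
  Finset.sum_le_sum fun l _ => fsNorm_mono (A.D l) h _

theorem continuousOn_coef_symm {s : ℕ} {φ : C.Deform} (hφ : A.IsFSDeform s φ) (l : ι)
    (α β : Fin n) : ContinuousOn (fun y => A.coef φ l α β ((A.chart l).symm y)) (A.D l) :=
  (hφ.1 l α β).continuousOn.comp ((A.chart l).continuousOn_symm.mono A.D_subset_target)
    fun _ hy => A.mem_source_of_mem_V (A.symm_mem_V hy)

theorem vfIn_contDiffAt_target {X : VF n M} (hX : VFSmoothOn 1 X univ) {y : Model n}
    (hy : y ∈ (A.chart l).target) : ContDiffAt ℝ 1 (vfIn (A.chart l) X) y := by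
  have h := vfIn_contDiffAt (A.chart_mem l) one_add_one_le_infty hX isOpen_univ (mem_univ _)
    ((A.chart l).map_target hy)
  rwa [(A.chart l).right_inv hy] at h

/-- Pigeonhole for the partition of unity. Adding 1 to the cardinality makes the threshold positive
in all cases and the contradiction strict. -/
theorem exists_le_ρ (x : M) : ∃ m, 1 / (Fintype.card ι + 1 : ℝ) ≤ A.ρ m x := by
  by_contra! h
  have h1 := A.ρ_sum x
  have h2 : ∑ l, A.ρ l x ≤ Fintype.card ι * (1 / (Fintype.card ι + 1 : ℝ)) := by
    refine (Finset.sum_le_card_nsmul _ _ _ fun l _ => (h l).le).trans (le_of_eq ?_)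
    rw [Finset.card_univ, nsmul_eq_mul]
  rw [h1, mul_one_div, le_div_iff₀ (by positivity)] at h2
  linarith

/-- The points of the chart where the cut-off is at least `c`. -/
def core (l : ι) (c : ℝ) : Set (Model n) := {y | c ≤ A.chartρ l y}

theorem core_subset_D {c : ℝ} (hc : 0 < c) : A.core l c ⊆ A.D l := by
  intro y hy
  by_contra h
  have h1 : c ≤ A.chartρ l y := hy
  rw [chartρ, indicator_of_notMem h] at h1
  linarith

theorem isCompact_core {c : ℝ} (hc : 0 < c) : IsCompact (A.core l c) := by
  refine (A.isCompact_support (l := l)).of_isClosed_subset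
    (isClosed_le continuous_const (A.contDiff_chartρ (l := l)).continuous) fun y hy => ?_
  by_contra h
  have h1 : c ≤ A.chartρ l y := hy
  rw [A.chartρ_eq_zero h] at h1
  linarith

theorem core_subset_target {c : ℝ} (hc : 0 < c) : A.core l c ⊆ (A.chart l).target :=
  (A.core_subset_D hc).trans A.D_subset_target

/-! ### Existence of the pulled back tensor near the identity -/

/-- Where the cut-off is at least c the Folland-Stein norms give pointwise bounds: C¹-closeness of F
to the identity from order s + 1, and smallness of φ near x, in particular at F(x), from order s.
Then A is close to the identity. -/
theorem exists_isUnit_pullA_local (hn : 1 ≤ n) {s : ℕ} (hs : 2 * n + 4 ≤ s) (l : ι) {c : ℝ}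
    (hc : 0 < c) : ∃ ε > 0, ∀ (F : M → M) (φ : C.Deform),
      MDifferentiable (𝓡 (2 * n + 1)) (𝓡 (2 * n + 1)) F → A.IsFSDeform s φ →
      F '' closure (A.V l) ⊆ (A.chart l).source →
      fsNorm (A.D l) (s + 1) (fun y => A.ρ l ((A.chart l).symm y) •
        (A.chart l (F ((A.chart l).symm y)) - y)) ≤ ENNReal.ofReal ε →
      A.deformNorm s φ ≤ ENNReal.ofReal ε → ∀ x ∈ A.V l, c ≤ A.ρ l x →
      IsUnit (A.pullA F φ l x).det := by
  obtain ⟨r₁, -, B₁, hB₁, h₁⟩ := A.exists_pointwise_bound hn (F := Model n) l hc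
  obtain ⟨r₂, hr₂, B₂, hB₂, h₂⟩ := A.exists_pointwise_bound hn (F := ℂ) l hc
  obtain ⟨t₀, ht₀, B₃, hB₃, h₃⟩ :=
    A.exists_pullMat_bound (A.isCompact_core (l := l) hc) (A.core_subset_target hc)
  set B : ℝ := B₁ + B₂ + 1 with hB
  have hB0 : 0 < B := by positivity
  -- Small enough that F(x) stays where φ is controlled, that the matrix estimate applies, and that
  -- n·B₃·t ≤ 1/2; the neighbourhood t/B then makes all pointwise quantities at most t.
  set t : ℝ := min r₂ (min t₀ (1 / (2 * (n * B₃ + 1)))) with ht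
  have hden : 0 < 2 * (n * B₃ + 1) := by positivity
  have ht0 : 0 < t := lt_min hr₂ (lt_min ht₀ (by positivity))
  have htn : n * (B₃ * t) ≤ 1 / 2 := by
    have h4 : t ≤ 1 / (2 * (n * B₃ + 1)) := (min_le_right _ _).trans (min_le_right _ _)
    rw [le_div_iff₀ hden] at h4
    nlinarith
  have hBt : B * (t / B) = t := by field_simp
  refine ⟨t / B, by positivity, fun F φ hF hφ hFV hnear hnorm x hx hxc => ?_⟩
  have hxs := A.mem_source_of_mem_V hx
  have hFx : F x ∈ (A.chart l).source := hFV ⟨x, subset_closure hx, rfl⟩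
  have hp : 0 ≤ t / B := by positivity
  have hy : c ≤ A.chartρ l (A.chart l x) := by rwa [A.chartρ_chart hx]
  have hcont : ContinuousOn (fun y => A.chart l (F ((A.chart l).symm y)) - y) (A.D l) := by
    refine ContinuousOn.sub ?_ continuousOn_id
    refine (A.chart l).continuousOn.comp (hF.continuous.comp_continuousOn
      ((A.chart l).continuousOn_symm.mono A.D_subset_target)) fun y hy => ?_
    exact hFV ⟨_, subset_closure (A.symm_mem_V hy), rfl⟩
  have hB₁t : B₁ * (t / B) ≤ t := by
    conv_rhs => rw [← hBt]
    gcongr; linarith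
  have hB₂t : B₂ * (t / B) ≤ t := by
    conv_rhs => rw [← hBt]
    gcongr; linarith
  obtain ⟨m1, m2, -⟩ := h₁ (s + 1) (by omega) _ hcont _ hp hnear _ hy
  have hdiff := differentiableAt_chart_comp (A.chart_mem l) (hF x) hxs hFx
  have hfd : HasFDerivAt (fun y => A.chart l (F ((A.chart l).symm y)) - y)
      (fderiv ℝ (A.chart l ∘ F ∘ (A.chart l).symm) (A.chart l x) -
        ContinuousLinearMap.id ℝ (Model n)) (A.chart l x) :=
    hdiff.hasFDerivAt.sub (hasFDerivAt_id _)
  have m3 := m2 hfd.differentiableAt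
  rw [hfd.fderiv] at m3
  simp only [(A.chart l).left_inv hxs] at m1
  have hcoef : ∀ α γ, ‖A.coef φ l α γ (F x)‖ ≤ t := by
    intro α γ
    obtain ⟨-, -, m4⟩ := h₂ s hs _ (A.continuousOn_coef_symm hφ l α γ) _ hp
      ((A.fsNorm_coef_le s φ l α γ).trans hnorm) _ hy
    have m5 := (m4 (A.chart l (F x)) ((m1.trans hB₁t).trans (min_le_left _ _))).2.1
    rw [(A.chart l).left_inv hFx] at m5
    exact m5.trans hB₂t
  have hmat := h₃ x hxs hy F φ (hF x) hFx t ((min_le_right _ _).trans (min_le_left _ _))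
    (m1.trans hB₁t) (m3.trans hB₁t) hcoef
  exact isUnit_det_of_close (fun α β => (hmat α β).1) htn

theorem exists_isUnit_pullA (A : AdaptedAtlas C ι) (hn : 1 ≤ n) {s : ℕ} (hs : 2 * n + 4 ≤ s) :
    ∃ ε : ℝ, 0 < ε ∧ ∀ (F : M → M) (φ : C.Deform),
      MDifferentiable (𝓡 (2 * n + 1)) (𝓡 (2 * n + 1)) F → A.IsFSDeform s φ →
      A.NearId (s + 1) (ENNReal.ofReal ε) F → A.deformNorm s φ < ENNReal.ofReal ε →
      ∀ x, ∃ m, x ∈ (A.chart m).source ∧ F x ∈ (A.chart m).source ∧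
        IsUnit (A.pullA F φ m x).det := by
  have hc : 0 < 1 / (Fintype.card ι + 1 : ℝ) := by positivity
  choose ε hε h using fun l => A.exists_isUnit_pullA_local hn hs l hc
  obtain ⟨ε₀, hε₀, hε'⟩ := exists_pos_forall_le ε hε
  refine ⟨ε₀, hε₀, fun F φ hF hφ hnear hnorm x => ?_⟩
  obtain ⟨m, hm⟩ := A.exists_le_ρ x
  have hx : x ∈ A.V m := A.mem_V_of_ρ_ne_zero (hc.trans_le hm).ne'
  have hle : ENNReal.ofReal ε₀ ≤ ENNReal.ofReal (ε m) := ENNReal.ofReal_le_ofReal (hε' m)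
  refine ⟨m, A.mem_source_of_mem_V hx, hnear.1 m ⟨x, subset_closure hx, rfl⟩,
    h m F φ hF hφ (hnear.1 m) ?_ (hnorm.le.trans hle) x hx hm⟩
  refine le_trans (Finset.single_le_sum (f := fun l => fsNorm (A.D l) (s + 1) fun y =>
    A.ρ l ((A.chart l).symm y) • (A.chart l (F ((A.chart l).symm y)) - y))
    (fun _ _ => zero_le) (Finset.mem_univ m)) (hnear.2.le.trans hle)

/-! ### The linearization -/

-- Here W stands for Ψ(X) − X, of size κN². Sobolev bounds, the estimate for exp ∘ Y and the
-- quadratic bound are combined with t = TN as the common scale of all first-order quantities.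
set_option maxHeartbeats 1000000 in
theorem exists_linearization_bound_local [T2Space M] (hn : 1 ≤ n) {s : ℕ} (hs : 2 * n + 4 ≤ s)
    (l : ι) {c : ℝ} (hc : 0 < c) {κ : ℝ} (hκ : 0 ≤ κ) :
    ∃ δ > 0, ∃ B ≥ 0, ∀ (X W : VF n M) (ψ : C.Deform), VFSmoothOn 1 X univ →
      VFSmoothOn 1 W univ → A.IsFSDeform s ψ →
      MDifferentiable (𝓡 (2 * n + 1)) (𝓡 (2 * n + 1)) (C.flowExp (X + W)) →
      ∀ N, 0 < N → N ≤ δ → A.vfNorm (s + 1) X ≤ ENNReal.ofReal N →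
      A.vfNorm (s + 1) W ≤ ENNReal.ofReal (κ * N ^ 2) → A.deformNorm s ψ ≤ ENNReal.ofReal N →
      ∀ x ∈ A.V l, c ≤ A.ρ l x → C.flowExp (X + W) x ∈ (A.chart l).source ∧
        IsUnit (A.pullA (C.flowExp (X + W)) ψ l x).det ∧ ∀ α β,
        ‖((A.pullA (C.flowExp (X + W)) ψ l x)⁻¹ * A.pullB (C.flowExp (X + W)) ψ l x) α β -
          (cEval (lieD X (A.θ l α) x) (A.Zbar l β x) + A.coef ψ l α β x)‖ ≤ B * N ^ 2 := by
  have hK := A.isCompact_core (l := l) hc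
  have hKT := A.core_subset_target (l := l) hc
  obtain ⟨r₁, -, B₁, hB₁, h₁⟩ := A.exists_pointwise_bound hn (F := Model n) l hc
  obtain ⟨r₂, hr₂, B₂, hB₂, h₂⟩ := A.exists_pointwise_bound hn (F := ℂ) l hc
  obtain ⟨s₀, hs₀, B₃, hB₃, h₃⟩ := A.exists_flowExp_estimate hK hKT
  -- The three summands account for W, for the remainder of exp, and for φ ∘ F − φ, where a gradient
  -- of size B₂N meets a displacement of size (1 + B₃)t.
  set b : ℝ := B₁ * κ + B₃ + (1 + B₃) * B₂ with hb
  have hb0 : 0 ≤ b := by positivity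
  obtain ⟨t₀, ht₀, B₄, hB₄, h₄⟩ := A.exists_quadratic_bound hK hKT hb0
  -- Chosen so that TN dominates N, the C¹ size of X + W (strictly) and the values of φ.
  set T : ℝ := 1 + B₁ * (1 + κ) + B₂ with hT
  have hT1 : 1 ≤ T := by
    have : 0 ≤ B₁ * (1 + κ) := by positivity
    linarith
  have hT0 : 0 < T := by linarith
  -- The conditions give N² ≤ N, the range of the exponential estimate, the radius in which φ is
  -- controlled at F(x), the range of the quadratic bound, and t² ≤ t.
  set δ : ℝ := min 1 (min (s₀ / T) (min (r₂ / ((1 + B₃) * T)) (min (t₀ / T) (1 / T)))) with hδ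
  have hδ0 : 0 < δ := lt_min one_pos (lt_min (by positivity) (lt_min (by positivity)
    (lt_min (by positivity) (by positivity))))
  refine ⟨δ, hδ0, B₄ * T ^ 2, by positivity,
    fun X W ψ hX hW hψ hF N hN hNδ hXN hWN hψN x hx hxc => ?_⟩
  set Y := X + W with hY
  set F := C.flowExp Y with hFdef
  have hN1 : N ≤ 1 := hNδ.trans (min_le_left _ _)
  have hts : T * N ≤ s₀ := by
    have : N ≤ s₀ / T := hNδ.trans ((min_le_right _ _).trans (min_le_left _ _))
    rwa [le_div_iff₀ hT0, mul_comm] at this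
  have htr : (1 + B₃) * (T * N) ≤ r₂ := by
    have : N ≤ r₂ / ((1 + B₃) * T) := hNδ.trans ((min_le_right _ _).trans
      ((min_le_right _ _).trans (min_le_left _ _)))
    rw [le_div_iff₀ (by positivity)] at this
    linarith
  have htt : T * N ≤ t₀ := by
    have : N ≤ t₀ / T := hNδ.trans ((min_le_right _ _).trans
      ((min_le_right _ _).trans ((min_le_right _ _).trans (min_le_left _ _))))
    rwa [le_div_iff₀ hT0, mul_comm] at this
  have htone : T * N ≤ 1 := by
    have : N ≤ 1 / T := hNδ.trans ((min_le_right _ _).trans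
      ((min_le_right _ _).trans ((min_le_right _ _).trans (min_le_right _ _))))
    rwa [le_div_iff₀ hT0, mul_comm] at this
  set t : ℝ := T * N with ht
  have ht0 : 0 < t := by positivity
  have hNt : N ≤ t := le_mul_of_one_le_left hN.le hT1
  have hN2 : N ^ 2 ≤ N := by
    rw [sq]
    exact mul_le_of_le_one_left hN.le hN1
  have hN2t : N ^ 2 ≤ t ^ 2 := by gcongr
  have hxs := A.mem_source_of_mem_V hx
  have hcore : A.chart l x ∈ A.core l c := by
    change c ≤ A.chartρ l (A.chart l x)
    rwa [A.chartρ_chart hx]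
  have htar := hKT hcore
  have hcD : ∀ V : VF n M, VFSmoothOn 1 V univ → ContinuousOn (vfIn (A.chart l) V) (A.D l) :=
    fun V hV y hy =>
      (A.vfIn_contDiffAt_target hV (A.D_subset_target hy)).continuousAt.continuousWithinAt
  have hdV : ∀ V : VF n M, VFSmoothOn 1 V univ →
      DifferentiableAt ℝ (vfIn (A.chart l) V) (A.chart l x) := fun V hV =>
    (A.vfIn_contDiffAt_target hV htar).differentiableAt (by simp)
  obtain ⟨x1, x2, -⟩ := h₁ (s + 1) (by omega) _ (hcD X hX) N hN.le
    ((A.fsNorm_vfIn_le _ X l).trans hXN) _ hcore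
  obtain ⟨w1, w2, -⟩ := h₁ (s + 1) (by omega) _ (hcD W hW) (κ * N ^ 2) (by positivity)
    ((A.fsNorm_vfIn_le _ W l).trans hWN) _ hcore
  replace x2 := x2 (hdV X hX)
  replace w2 := w2 (hdV W hW)
  have hsum : vfIn (A.chart l) Y = fun y => vfIn (A.chart l) X y + vfIn (A.chart l) W y := by
    ext1 y
    exact map_add (dChart (A.chart l) ((A.chart l).symm y)) _ _
  have hYX : Y - X = W := by rw [hY]; abel
  have hbound : B₁ * N + B₁ * (κ * N ^ 2) < t := by
    have h5 : B₁ * (κ * N ^ 2) ≤ B₁ * (κ * N) := by gcongr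
    have h6 : t = N + (B₁ * N + B₁ * (κ * N)) + B₂ * N := by rw [ht, hT]; ring
    have h7 : 0 ≤ B₂ * N := by positivity
    linarith
  have y1 : ‖vfIn (A.chart l) Y (A.chart l x)‖ < t := by
    rw [hsum]
    exact (norm_add_le _ _).trans_lt ((add_le_add x1 w1).trans_lt hbound)
  have y2 : ‖fderiv ℝ (vfIn (A.chart l) Y) (A.chart l x)‖ ≤ t := by
    rw [hsum, fderiv_fun_add (hdV X hX) (hdV W hW)]
    exact (norm_add_le _ _).trans ((add_le_add x2 w2).trans hbound.le)
  have hb1 : B₁ * κ ≤ b := by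
    have : 0 ≤ (1 + B₃) * B₂ := by positivity
    linarith
  have hb2 : B₃ ≤ b := by
    have : 0 ≤ (1 + B₃) * B₂ := by positivity
    have : 0 ≤ B₁ * κ := by positivity
    linarith
  have hb3 : (1 + B₃) * B₂ ≤ b := by
    have : 0 ≤ B₁ * κ := by positivity
    linarith
  have hκt : B₁ * (κ * N ^ 2) ≤ b * t ^ 2 := by
    rw [← mul_assoc]; gcongr
  have hFm : MDifferentiableAt (𝓡 (2 * n + 1)) (𝓡 (2 * n + 1)) F
      ((A.chart l).symm (A.chart l x)) := hF _
  obtain ⟨f1, f2, f3⟩ := h₃ t ht0 hts Y (hX.add hW) _ hcore y1 y2 hFm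
  rw [(A.chart l).left_inv hxs] at f1 f2
  have hB₃t : B₃ * t ^ 2 ≤ b * t ^ 2 := by gcongr
  have hmove : ‖A.chart l (F x) - A.chart l x‖ ≤ t + B₃ * t ^ 2 := by
    have h5 : A.chart l (F x) - A.chart l x = (A.chart l (F x) - A.chart l x -
      vfIn (A.chart l) Y (A.chart l x)) + vfIn (A.chart l) Y (A.chart l x) := by abel
    rw [h5]
    refine (norm_add_le _ _).trans ?_
    linarith
  have htsq : t ^ 2 ≤ t := by
    rw [sq]
    exact mul_le_of_le_one_left ht0.le htone
  have hmove' : ‖A.chart l (F x) - A.chart l x‖ ≤ (1 + B₃) * t := by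
    have : B₃ * t ^ 2 ≤ B₃ * t := by gcongr
    linarith
  have hB₂N : B₂ * N ≤ t := by
    have h5 : t = N + B₁ * (1 + κ) * N + B₂ * N := by rw [ht, hT]; ring
    have h6 : 0 ≤ B₁ * (1 + κ) * N := by positivity
    linarith
  have hcoef : ∀ α γ, ‖A.coef ψ l α γ (F x)‖ ≤ t ∧
      ‖A.coef ψ l α γ (F x) - A.coef ψ l α γ x‖ ≤ b * t ^ 2 := by
    intro α γ
    obtain ⟨-, -, m⟩ := h₂ s hs _ (A.continuousOn_coef_symm hψ l α γ) N hN.le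
      ((A.fsNorm_coef_le s ψ l α γ).trans hψN) _ hcore
    obtain ⟨-, m1, m2⟩ := m (A.chart l (F x)) (hmove'.trans htr)
    rw [(A.chart l).left_inv f1] at m1 m2
    rw [(A.chart l).left_inv hxs] at m2
    refine ⟨m1.trans hB₂N, m2.trans ?_⟩
    calc B₂ * N * ‖A.chart l (F x) - A.chart l x‖ ≤ B₂ * t * ((1 + B₃) * t) := by gcongr
      _ = (1 + B₃) * B₂ * t ^ 2 := by ring
      _ ≤ b * t ^ 2 := by gcongr
  have hw1 : ‖vfIn (A.chart l) (Y - X) (A.chart l x)‖ ≤ b * t ^ 2 := by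
    rw [hYX]; exact w1.trans hκt
  have hw2 : ‖fderiv ℝ (vfIn (A.chart l) (Y - X)) (A.chart l x)‖ ≤ b * t ^ 2 := by
    rw [hYX]; exact w2.trans hκt
  have hfin := h₄ x hxs hcore F ψ X Y hX (hX.add hW) (hF x) f1 t ht0.le htt y1.le y2 hw1 hw2
    (f2.trans hB₃t) (f3.trans hB₃t) (fun α γ => (hcoef α γ).1) (fun α γ => (hcoef α γ).2)
  refine ⟨f1, hfin.1, fun α β => (hfin.2 α β).trans (le_of_eq ?_)⟩
  rw [ht]; ring

end AdaptedAtlas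

end CRDef

end

open scoped Manifold ContDiff TensorProduct ENNReal Topology
noncomputable section
namespace CRDef
open Set Filter MeasureTheory
set_option linter.unusedSectionVars false
set_option maxSynthPendingDepth 3

namespace AdaptedAtlas

variable {n : ℕ} {M : Type*} [TopologicalSpace M] [ChartedSpace (Model n) M]
  [IsManifold (𝓡 (2 * n + 1)) ∞ M]
  {C : CRStructure n M} {ι : Type*} [Fintype ι] (A : AdaptedAtlas C ι) {l : ι} {x : M}

/-! ### Change of coframe -/

theorem _root_.CRDef.continuousAt_form_apply {θ : OneForm n M ℂ} {X : VF n M} {U : Set M}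
    (hU : IsOpen U) (hθ : FormSmoothOn θ U) (hX : VFSmoothOn ∞ X U) (hx : x ∈ U) :
    ContinuousAt (fun y => θ y (X y)) x := by
  have he := isSmoothChart_chartAt (n := n) x
  have hxs := mem_chart_source (Model n) x
  set e := chartAt (Model n) x
  have h1 : (fun y => θ y (X y)) =ᶠ[𝓝 x] fun y => formIn e θ (e y) (vfIn e X (e y)) := by
    filter_upwards [e.open_source.mem_nhds hxs] with y hy
    rw [vfIn_apply X hy]
    exact (formIn_apply he θ hy _).symm
  have h2 : ContinuousAt (fun y => formIn e θ (e y)) x :=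
    ContinuousAt.comp (f := e) (g := formIn e θ)
      (formIn_contDiffAt he hθ hx hxs).continuousAt (e.continuousAt hxs)
  have h3 : ContinuousAt (fun y => vfIn e X (e y)) x :=
    ContinuousAt.comp (f := e) (g := vfIn e X)
      (vfIn_contDiffAt he (by norm_num) hX hU hx hxs).continuousAt (e.continuousAt hxs)
  exact (h2.clm_apply h3).congr h1.symm

theorem continuousOn_ev_Z (l m : ι) (α δ : Fin n) :
    ContinuousOn (fun y => A.ev l α y (A.Z m δ y))
      ((A.chart l).source ∩ (A.chart m).source) := by
  intro y hy
  have hU := (A.chart l).open_source.inter (A.chart m).open_source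
  have hθ : FormSmoothOn (A.θ l α) ((A.chart l).source ∩ (A.chart m).source) :=
    fun z hz => A.θ_smooth l α z hz.1
  have h1 := continuousAt_form_apply hU hθ ((A.Z_smooth m δ).1.mono inter_subset_right) hy
  have h2 := continuousAt_form_apply hU hθ ((A.Z_smooth m δ).2.mono inter_subset_right) hy
  exact (h1.add (continuousAt_const.mul h2)).continuousWithinAt

theorem coef_transition (φ : C.Deform) {m : ι} (hl : x ∈ (A.chart l).source)
    (hm : x ∈ (A.chart m).source) (α β : Fin n) :
    A.coef φ l α β x = ∑ δ, ∑ γ,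
      A.coef φ m δ γ x * (A.evBar m γ x (A.Zbar l β x) * A.ev l α x (A.Z m δ x)) := by
  rw [A.coef_eq φ hl, A.deform_eq_sum φ hm]
  simp only [map_sum, map_smul, smul_eq_mul, Finset.sum_mul, mul_assoc]

/-- The estimate at a point is proved for an index m with ρ_m bounded below, but is claimed for
every l. The change of frame is continuous on the overlap of the chart domains, hence bounded on the
compact set closure(V_l) ∩ supp ρ_m. -/
theorem exists_transition_bound (l m : ι) : ∃ B : ℝ, 0 ≤ B ∧ ∀ x ∈ A.V l, A.ρ m x ≠ 0 →
    ∀ (μ ν : C.Deform) (r : ℝ), (∀ α β, ‖A.coef μ m α β x - A.coef ν m α β x‖ ≤ r) →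
      ∀ α β, ‖A.coef μ l α β x - A.coef ν l α β x‖ ≤ B * r := by
  set K := closure (A.V l) ∩ tsupport (A.ρ m) with hKdef
  have hK : IsCompact K := (A.V_compact l).inter_right (isClosed_tsupport _)
  have hKl : K ⊆ (A.chart l).source := inter_subset_left.trans (A.V_sub l)
  have hKm : K ⊆ (A.chart m).source := inter_subset_right.trans ((A.ρ_supp m).trans
    fun _ h => A.mem_source_of_mem_V h)
  choose a ha using fun p : Fin n × Fin n => hK.exists_bound_of_continuousOn
    ((A.continuousOn_ev_Z l m p.1 p.2).mono (subset_inter hKl hKm))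
  choose b hb using fun p : Fin n × Fin n => hK.exists_bound_of_continuousOn
    ((A.continuousOn_ev_Z m l p.1 p.2).mono (subset_inter hKm hKl))
  obtain ⟨a₀, ha₀, ha'⟩ := exists_nonneg_forall_ge a
  obtain ⟨b₀, hb₀, hb'⟩ := exists_nonneg_forall_ge b
  refine ⟨n * (n * (b₀ * a₀)), by positivity, fun x hx hρ μ ν r hr α β => ?_⟩
  have hxK : x ∈ K := ⟨subset_closure hx, subset_tsupport _ hρ⟩
  rw [A.coef_transition μ (hKl hxK) (hKm hxK), A.coef_transition ν (hKl hxK) (hKm hxK),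
    ← Finset.sum_sub_distrib]
  have hr0 : 0 ≤ r := (norm_nonneg _).trans (hr α β)
  refine (norm_sum_le_card_mul (b := n * (b₀ * a₀ * r)) fun δ => ?_).trans (le_of_eq (by ring))
  rw [← Finset.sum_sub_distrib]
  refine norm_sum_le_card_mul fun γ => ?_
  rw [← sub_mul, norm_mul, norm_mul, mul_comm]
  have h1 : ‖A.ev l α x (A.Z m δ x)‖ ≤ a₀ := (ha (α, δ) x hxK).trans (ha' _)
  have h2 : ‖A.evBar m γ x (A.Zbar l β x)‖ ≤ b₀ := by
    rw [A.evBar_apply, RCLike.norm_conj, Zbar, conjT_conjT]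
    exact (hb (γ, β) x hxK).trans (hb' _)
  have h3 := hr δ γ
  gcongr

end AdaptedAtlas

end CRDef

end

open scoped Manifold ContDiff TensorProduct ENNReal Topology
noncomputable section
namespace CRDef
open Set Filter MeasureTheory
set_option linter.unusedSectionVars false
set_option maxSynthPendingDepth 3

namespace AdaptedAtlas

variable {n : ℕ} {M : Type*} [TopologicalSpace M] [ChartedSpace (Model n) M]
  [IsManifold (𝓡 (2 * n + 1)) ∞ M]
  {C : CRStructure n M} {ι : Type*} [Fintype ι] (A : AdaptedAtlas C ι) {l : ι} {x : M}

/-! ### The action of contact diffeomorphisms -/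

/-- The frame-free criterion for invertibility transports it from one index to any other chart
containing both x and F(x). -/
theorem isUnit_pullA_of_exists {F : M → M} {φ : C.Deform} (hF : PreservesContact C F)
    (h : ∃ m, x ∈ (A.chart m).source ∧ F x ∈ (A.chart m).source ∧ IsUnit (A.pullA F φ m x).det)
    (hx : x ∈ (A.chart l).source) (hFx : F x ∈ (A.chart l).source) :
    IsUnit (A.pullA F φ l x).det := by
  obtain ⟨m, h1, h2, h3⟩ := h
  exact (A.isUnit_pullA_iff hF hx hFx).2 ((A.isUnit_pullA_iff hF h1 h2).1 h3)

/-- At each point the local estimate is used for an index whose cut-off is large there. These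
indices also supply the charts needed for existence of the pull-back, and the transition bound
carries the estimate to all frames. -/
theorem exists_linearization_bound [T2Space M] (A : AdaptedAtlas C ι) (hn : 1 ≤ n) {s : ℕ}
    (hs : 2 * n + 4 ≤ s) {κ : ℝ} (hκ : 0 ≤ κ) :
    ∃ δ > 0, ∃ B ≥ 0, ∀ (X W : VF n M) (ψ : C.Deform), VFSmoothOn 1 X univ →
      C.IsContactVF X → VFSmoothOn 1 W univ → A.IsFSDeform s ψ →
      MDifferentiable (𝓡 (2 * n + 1)) (𝓡 (2 * n + 1)) (C.flowExp (X + W)) →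
      PreservesContact C (C.flowExp (X + W)) →
      ∀ N, 0 < N → N ≤ δ → A.vfNorm (s + 1) X ≤ ENNReal.ofReal N →
      A.vfNorm (s + 1) W ≤ ENNReal.ofReal (κ * N ^ 2) → A.deformNorm s ψ ≤ ENNReal.ofReal N →
      (∃ μ, CRStructure.IsPullback (C.flowExp (X + W)) ψ μ) ∧
      ∀ μ ν : C.Deform, CRStructure.IsPullback (C.flowExp (X + W)) ψ μ → C.IsLinearized X ψ ν →
        ∀ l, ∀ x ∈ A.V l, ∀ α β, ‖A.coef μ l α β x - A.coef ν l α β x‖ ≤ B * N ^ 2 := by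
  have hc : 0 < 1 / (Fintype.card ι + 1 : ℝ) := by positivity
  choose δ hδ B hB h using fun l => A.exists_linearization_bound_local hn hs l hc hκ
  choose B' hB' h' using fun p : ι × ι => A.exists_transition_bound p.1 p.2
  obtain ⟨δ₀, hδ₀, hδ'⟩ := exists_pos_forall_le δ hδ
  obtain ⟨B₀, hB₀, hB₀'⟩ := exists_nonneg_forall_ge B
  obtain ⟨B₁, hB₁, hB₁'⟩ := exists_nonneg_forall_ge B'
  refine ⟨δ₀, hδ₀, B₁ * B₀, by positivity,
    fun X W ψ hX hXc hW hψ hF hFc N hN hNδ hXN hWN hψN => ?_⟩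
  have key : ∀ m x, 1 / (Fintype.card ι + 1 : ℝ) ≤ A.ρ m x → _ := fun m x hm =>
    h m X W ψ hX hW hψ hF N hN (hNδ.trans (hδ' m)) hXN hWN hψN x
      (A.mem_V_of_ρ_ne_zero (hc.trans_le hm).ne') hm
  choose m hm using fun x => A.exists_le_ρ x
  have hxm : ∀ x, x ∈ (A.chart (m x)).source := fun x =>
    A.mem_source_of_mem_V (A.mem_V_of_ρ_ne_zero (hc.trans_le (hm x)).ne')
  refine ⟨(A.existsUnique_isPullback hFc m fun x =>
    ⟨hxm x, (key _ x (hm x)).1, (key _ x (hm x)).2.1⟩).exists,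
    fun μ ν hμ hν l x hx α β => ?_⟩
  obtain ⟨k1, k2, k3⟩ := key _ x (hm x)
  have hmat := A.coefMat_of_isPullback hFc (hxm x) k1 k2 hμ
  refine (h' (l, m x) x hx (hc.trans_le (hm x)).ne' μ ν (B₀ * N ^ 2) (fun γ δ => ?_) α β).trans ?_
  · have h1 : A.coef μ (m x) γ δ x = ((A.pullA (C.flowExp (X + W)) ψ (m x) x)⁻¹ *
        A.pullB (C.flowExp (X + W)) ψ (m x) x) γ δ := by rw [← hmat]; rfl
    rw [h1, (A.isLinearized_iff hX hXc ψ ν).1 hν _ x (hxm x)]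
    refine (k3 γ δ).trans ?_
    have := hB₀' (m x)
    gcongr
  · have := hB₁' (l, m x)
    rw [← mul_assoc]
    gcongr

variable {s : ℕ} {𝒱 𝒰 : Set (VF n M)} {Ψ : VF n M → VF n M}

/-- Regularity of F is not derived from that of exp: it is part of being a contact diffeomorphism,
which membership of Ψ(X) in the image of Ψ guarantees. -/
theorem IsContactParametrization.mdifferentiable {A : AdaptedAtlas C ι} {r : ℕ}
    (hΨ : A.IsContactParametrization r 𝒱 𝒰 Ψ) {X : VF n M} (hX : X ∈ 𝒱) :
    MDifferentiable (𝓡 (2 * n + 1)) (𝓡 (2 * n + 1)) (C.flowExp (Ψ X)) ∧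
      PreservesContact C (C.flowExp (Ψ X)) := by
  obtain ⟨⟨f', -, -, h1, -⟩, h2⟩ := (hΨ.contact_iff _ (hΨ.maps X hX)).2 ⟨X, hX, rfl⟩
  exact ⟨h1.mdifferentiable (by simp), h2⟩

theorem exists_pullback_formula (A : AdaptedAtlas C ι) (hn : 1 ≤ n) (hs : 2 * n + 4 ≤ s)
    (hΨ : A.IsContactParametrization (s + 1) 𝒱 𝒰 Ψ) :
    ∃ ε : ℝ≥0∞, 0 < ε ∧ ∀ X ∈ 𝒱, ∀ φ : C.Deform, A.IsFSDeform s φ →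
      A.NearId (s + 1) ε (C.flowExp (Ψ X)) → A.deformNorm s φ < ε →
      (∃! μ : C.Deform, CRStructure.IsPullback (C.flowExp (Ψ X)) φ μ) ∧
      (∀ l, ∀ x ∈ A.V l, IsUnit (A.matA Ψ X X φ l x).det) ∧
      ∀ μ : C.Deform, CRStructure.IsPullback (C.flowExp (Ψ X)) φ μ →
        ∀ W : CVF n M, ∀ hW : C.IsAntiholSection W, ∀ x,
          (C.antihol x).mkQ (μ x ⟨W x, hW.2 x⟩ : CT n x) =
            C.dbarb X W x + (C.antihol x).mkQ (A.compTensor Ψ X φ x (W x))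
              + (C.antihol x).mkQ (A.tensorE Ψ X X φ x (W x)) := by
  obtain ⟨ε, hε, h⟩ := A.exists_isUnit_pullA hn hs
  refine ⟨ENNReal.ofReal ε, ENNReal.ofReal_pos.2 hε, fun X hX φ hφ hnear hnorm => ?_⟩
  obtain ⟨hF, hFc⟩ := hΨ.mdifferentiable hX
  have hu := h _ φ hF hφ hnear hnorm
  have hV : ∀ l, ∀ x ∈ A.V l, C.flowExp (Ψ X) x ∈ (A.chart l).source :=
    fun l x hx => hnear.1 l ⟨x, subset_closure hx, rfl⟩
  have hA : ∀ l, ∀ x ∈ A.V l, IsUnit (A.pullA (C.flowExp (Ψ X)) φ l x).det := fun l x hx =>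
    A.isUnit_pullA_of_exists hFc (hu x) (A.mem_source_of_mem_V hx) (hV l x hx)
  choose k hk using hu
  refine ⟨A.existsUnique_isPullback hFc k hk, fun l x hx => ?_, fun μ hμ W hW x => ?_⟩
  · rw [A.matA_eq]
    exact hA l x hx
  · exact A.pullback_formula Ψ (hΨ.dom X hX).1.1 (hΨ.dom X hX).2
      (hΨ.range _ (hΨ.maps X hX)).1 hFc hV hA hμ hW x

/-- The error is at most B·N² for every N slightly above p = ‖X‖ + ‖φ‖, and B·N ≤ ε for N ≤ δ'; a
quadratic error is thus absorbed in εp. -/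
theorem exists_linearization_estimate [T2Space M] (A : AdaptedAtlas C ι) (hn : 1 ≤ n)
    (hs : 2 * n + 4 ≤ s) (hΨ : A.IsContactParametrization (s + 1) 𝒱 𝒰 Ψ)
    {ε : ℝ≥0∞} (hε : 0 < ε) : ∃ δ : ℝ≥0∞, 0 < δ ∧
      ∀ X : VF n M, A.IsFSVF (s + 1) X → C.IsContactVF X → A.vfNorm (s + 1) X < δ →
      ∀ ψ : C.Deform, A.IsFSDeform s ψ → A.deformNorm s ψ < δ →
      ∀ ν : C.Deform, C.IsLinearized X ψ ν →
      ∃ μ : C.Deform, CRStructure.IsPullback (C.flowExp (Ψ X)) ψ μ ∧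
        ∀ l, ∀ x ∈ A.V l, ∀ α β,
          ‖A.coef μ l α β x - A.coef ν l α β x‖ₑ
            ≤ ε * (A.vfNorm (s + 1) X + A.deformNorm s ψ) := by
  -- ε may be infinite, so a positive finite number below it is used.
  obtain ⟨ε', hε'0, hε'⟩ := ENNReal.lt_iff_exists_nnreal_btwn.1 hε
  replace hε'0 : 0 < (ε' : ℝ) := by exact_mod_cast hε'0
  obtain ⟨δ₀, hδ₀, hdom⟩ := hΨ.dom_nhds
  obtain ⟨Bf, hBf, -, δ₁, hδ₁, K, hK⟩ := hΨ.quadratic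
  obtain ⟨δ₂, hδ₂, B, hB, h⟩ := A.exists_linearization_bound hn hs (κ := (K : ℝ)) K.coe_nonneg
  -- Half of δ' is allotted to each of the two norms, so that their sum stays below δ'; the second
  -- bound gives (B + 1)N ≤ ε'.
  set δ' : ℝ := min δ₂ (ε' / (B + 1)) with hδ'
  have hδ'0 : 0 < δ' := lt_min hδ₂ (by positivity)
  refine ⟨min δ₀ (min δ₁ (ENNReal.ofReal (δ' / 2))),
    lt_min hδ₀ (lt_min hδ₁ (ENNReal.ofReal_pos.2 (by positivity))),
    fun X hX hXc hXδ ψ hψ hψδ ν hν => ?_⟩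
  have hXV : X ∈ 𝒱 := hdom X hX hXc
    ((A.vfNorm_mono (by omega) X).trans_lt (hXδ.trans_le (min_le_left _ _)))
  obtain ⟨hF, hFc⟩ := hΨ.mdifferentiable hXV
  obtain ⟨hW, hWn⟩ := hK X hXV (hXδ.trans_le ((min_le_right _ _).trans (min_le_left _ _)))
    X X hX hXc hX hXc
  rw [hBf X hXV] at hF hFc ⊢
  set p := A.vfNorm (s + 1) X + A.deformNorm s ψ with hp
  have hpt : p < ⊤ := ENNReal.add_lt_top.2 ⟨hX.2, hψ.2⟩
  have hpδ : p.toReal < δ' := by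
    have h1 : p < ENNReal.ofReal (δ' / 2) + ENNReal.ofReal (δ' / 2) :=
      ENNReal.add_lt_add (hXδ.trans_le ((min_le_right _ _).trans (min_le_right _ _)))
        (hψδ.trans_le ((min_le_right _ _).trans (min_le_right _ _)))
    rw [← ENNReal.ofReal_add (by positivity) (by positivity), add_halves] at h1
    exact (ENNReal.lt_ofReal_iff_toReal_lt hpt.ne).1 h1
  have key : ∀ N, p.toReal < N → N ≤ δ' → _ := fun N hN hNδ => by
    have hN0 : 0 < N := ENNReal.toReal_nonneg.trans_lt hN
    have hpN : p ≤ ENNReal.ofReal N := (ENNReal.le_ofReal_iff_toReal_le hpt.ne hN0.le).2 hN.le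
    have hXN : A.vfNorm (s + 1) X ≤ ENNReal.ofReal N := le_self_add.trans hpN
    have hψN : A.deformNorm s ψ ≤ ENNReal.ofReal N := le_add_self.trans hpN
    refine h X (Bf X X X) ψ hX.1 hXc hW.1 hψ hF hFc N hN0 (hNδ.trans (min_le_left _ _)) hXN ?_ hψN
    refine hWn.trans ?_
    rw [ENNReal.ofReal_mul K.coe_nonneg, ENNReal.ofReal_coe_nnreal, sq, ENNReal.ofReal_mul hN0.le,
      ← mul_assoc]
    gcongr
  obtain ⟨μ, hμ⟩ := (key δ' hpδ le_rfl).1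
  refine ⟨μ, hμ, fun l x hx α β => ?_⟩
  have hreal : ‖A.coef μ l α β x - A.coef ν l α β x‖ ≤ ε' * p.toReal := by
    -- The estimates require N > 0 while p may vanish, so N is taken slightly larger than p and the
    -- excess τ is then let go to zero.
    refine le_of_forall_pos_le_add fun τ hτ => ?_
    have hN : p.toReal < min δ' (p.toReal + τ / ε') :=
      lt_min hpδ (lt_add_of_pos_right _ (by positivity))
    set N := min δ' (p.toReal + τ / ε') with hNdef
    have hN0 : 0 < N := ENNReal.toReal_nonneg.trans_lt hN
    have hNB : (B + 1) * N ≤ ε' := by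
      have : N ≤ ε' / (B + 1) := (min_le_left _ _).trans (min_le_right _ _)
      rwa [le_div_iff₀ (by positivity), mul_comm] at this
    calc ‖A.coef μ l α β x - A.coef ν l α β x‖ ≤ B * N ^ 2 :=
          (key N hN (min_le_left _ _)).2 μ ν hμ hν l x hx α β
      _ ≤ (B + 1) * N * N := by
          rw [mul_assoc, ← sq]
          gcongr
          linarith
      _ ≤ ε' * N := by gcongr
      _ ≤ ε' * (p.toReal + τ / ε') := by gcongr; exact min_le_right _ _
      _ = ε' * p.toReal + τ := by field_simp
  calc ‖A.coef μ l α β x - A.coef ν l α β x‖ₑ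
      = ENNReal.ofReal ‖A.coef μ l α β x - A.coef ν l α β x‖ := (ofReal_norm _).symm
    _ ≤ ENNReal.ofReal (ε' * p.toReal) := ENNReal.ofReal_le_ofReal hreal
    _ = ε' * p := by
        rw [ENNReal.ofReal_mul hε'0.le, ENNReal.ofReal_coe_nnreal, ENNReal.ofReal_toReal hpt.ne]
    _ ≤ ε * p := by gcongr

end AdaptedAtlas

end CRDef

end

open CRDef in
theorem mainTheorem8 {n : ℕ} (hn : 1 ≤ n) {M : Type*} [TopologicalSpace M]
    [ChartedSpace (Model n) M] [IsManifold (𝓡 (2 * n + 1)) ∞ M] [CompactSpace M] [T2Space M]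
    (C : CRStructure n M) {ι : Type*} [Fintype ι] (A : AdaptedAtlas C ι)
    (s : ℕ) (hs : 2 * n + 4 ≤ s)
    (𝒱 𝒰 : Set (VF n M)) (Ψ : VF n M → VF n M)
    (hΨ : A.IsContactParametrization (s + 1) 𝒱 𝒰 Ψ) :
    (∃ ε : ℝ≥0∞, 0 < ε ∧ ∀ X ∈ 𝒱, ∀ φ : C.Deform, A.IsFSDeform s φ →
      A.NearId (s + 1) ε (C.flowExp (Ψ X)) → A.deformNorm s φ < ε →
      (∃! μ : C.Deform, CRStructure.IsPullback (C.flowExp (Ψ X)) φ μ) ∧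
      (∀ l, ∀ x ∈ A.V l, IsUnit (A.matA Ψ X X φ l x).det) ∧
      ∀ μ : C.Deform, CRStructure.IsPullback (C.flowExp (Ψ X)) φ μ →
        ∀ W : CVF n M, ∀ hW : C.IsAntiholSection W, ∀ x,
          (C.antihol x).mkQ (μ x ⟨W x, hW.2 x⟩ : CT n x) =
            C.dbarb X W x + (C.antihol x).mkQ (A.compTensor Ψ X φ x (W x))
              + (C.antihol x).mkQ (A.tensorE Ψ X X φ x (W x))) ∧
    (∀ X : VF n M, A.IsFSVF (s + 1) X → C.IsContactVF X → ∀ ψ : C.Deform,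
      ∃! ν : C.Deform, C.IsLinearized X ψ ν) ∧
    (∀ ε : ℝ≥0∞, 0 < ε → ∃ δ : ℝ≥0∞, 0 < δ ∧
      ∀ X : VF n M, A.IsFSVF (s + 1) X → C.IsContactVF X → A.vfNorm (s + 1) X < δ →
      ∀ ψ : C.Deform, A.IsFSDeform s ψ → A.deformNorm s ψ < δ →
      ∀ ν : C.Deform, C.IsLinearized X ψ ν →
      ∃ μ : C.Deform, CRStructure.IsPullback (C.flowExp (Ψ X)) ψ μ ∧
        ∀ l, ∀ x ∈ A.V l, ∀ α β,
          ‖A.coef μ l α β x - A.coef ν l α β x‖ₑ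
            ≤ ε * (A.vfNorm (s + 1) X + A.deformNorm s ψ)) := by
  exact ⟨A.exists_pullback_formula hn hs hΨ,
    fun X hX hc ψ => A.existsUnique_isLinearized hX.1 hc ψ,
    fun ε hε => A.exists_linearization_estimate hn hs hΨ hε⟩
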